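/- All permutations are written in one-line notation, and $\sigma\le\pi$ means that some subsequence of $\pi$ is order isomorphic to $\sigma$. A *permutation class* is a downset $\mathcal C$ of permutations for $\le$, $\mathcal C_n$ is its set of members of length $n$, and its (upper) growth rate is $\limsup_{n\to\infty}|\mathcal C_n|^{1/n}$. The basis of $\mathcal C$ is the set of minimal permutations not in $\mathcal C$, and $\mathcal C$ is *finitely based* if its basis is finite. The sum $\pi\oplus\sigma$ is $\pi$ followed by a copy of $\sigma$ shifted above and to the right of it; a nonempty permutation is *sum indecomposable* if it is not the sum of two nonempty permutations; a class is *sum closed* if it is closed under $\oplus$. For a set $X$ of permutations, $\operatorname{Sub}(X)$ is the downward closure of $X$ and $\bigoplus X$ is the smallest sum closed class containing $X$. Let $U^o=\{\mu_7,\mu_9,\mu_{11},\dots\}$, where $\mu_{2k+7}$ ($k\ge 0$) is obtained from the increasing oscillation $2\,4\,1\,6\,3\,8\,5\cdots(2k+1)\,(2k+5)\,(2k+3)$ of length $2k+5$ by inflating by $12$ the two leaves of its inversion graph (its first entry and its maximum); for example $\mu_{7}=2\,3\,5\,1\,6\,7\,4$ and $\mu_{11}=2\,3\,5\,1\,7\,4\,9\,6\,10\,11\,8$.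 Let $\xi\approx 2.30522$ be the unique positive root of $x^5-2x^4-x^2-x-1$. A class *realizes* a sequence $(s_n)_{n\ge1}$ of nonnegative integers if it contains exactly $s_n$ sum indecomposable permutations of length $n$ for every $n\ge 1$. The sequence is *legal* if $s_1\le 1$, $s_2\le 1$, $s_3\le 3$, and: for $n\ge1$, $s_n=0$ implies $s_{n+1}=0$; for $n\ge 3$, $s_n\le 1$ implies $s_{n+1}\le 1$; for $n\ge 4$, $s_n\le 2$ implies $s_{n+1}\le 2$; for $n\ge 5$, $s_n\le 3$ implies $s_{n+1}\le 3$. It *ends in $1,1$* if either it is eventually zero and its last two nonzero entries both equal $1$, or it is eventually constantly $1$. **Proposition.** Let $i\ge 0$, and let $(s_n)$ be a legal sequence that does not end in $1,1$ and is dominated termwise by $1,1,2,3,4^{2i},5,4^\infty$ (that is, $s_1,s_2\le 1$, $s_3\le 2$, $s_4\le 3$, $s_{2i+5}\le 5$, and $s_n\le 4$ for all other $n\ge 5$). Then: 1. $(s_n)$ is realized by a sum closed permutation class; moreover, if $s_5\le 4$ (which is automatic when $i\ge1$), it is realized by a sum closed subclass of $\bigoplus\operatorname{Sub}(U^o)$.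 2. If $(s_n)$ leads to a growth rate less than $\xi$, i.e. if a sum closed class realizing $(s_n)$ has growth rate less than $\xi$, then $(s_n)$ is realized by a finitely based sum closed permutation class. -/

import Mathlib

open Filter
open scoped ENNReal

namespace PermClasses

/-! ### Permutations, containment, direct sums -/

/-- A permutation of some length `n`, in zero-based one-line notation
`π 0, π 1, …, π (n - 1)`. -/
abbrev Perm : Type := Σ n : ℕ, Equiv.Perm (Fin n)

/-- The length of a permutation. -/
def len (π : Perm) : ℕ := π.1

/-- `Contains π σ`: some subsequence of `π` is order isomorphic to `σ`, i.e. `σ ≤ π`. -/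
def Contains (π σ : Perm) : Prop :=
  ∃ f : Fin σ.1 ↪o Fin π.1, ∀ a b : Fin σ.1, σ.2 a < σ.2 b ↔ π.2 (f a) < π.2 (f b)

/-- The direct sum `π ⊕ σ`: `π` on the first `|π|` positions and values, followed by a copy
of `σ` shifted by `|π|` in both position and value. -/
def dsum (π σ : Perm) : Perm :=
  ⟨π.1 + σ.1, finSumFinEquiv.permCongr (Equiv.sumCongr π.2 σ.2)⟩

/-- A nonempty permutation is sum indecomposable if it is not the sum of two nonempty
permutations. -/
def SumIndecomposable (π : Perm) : Prop :=
  1 ≤ len π ∧ ∀ α β : Perm, π = dsum α β → len α = 0 ∨ len β = 0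

/-! ### Permutation classes -/

/-- A permutation class is a downset for the containment order. -/
def IsPermClass (C : Set Perm) : Prop :=
  ∀ π ∈ C, ∀ σ : Perm, Contains π σ → σ ∈ C

/-- `C` is sum closed if it contains `π ⊕ σ` whenever it contains `π` and `σ`. -/
def IsSumClosed (C : Set Perm) : Prop :=
  ∀ π ∈ C, ∀ σ ∈ C, dsum π σ ∈ C

/-- `Sub(X)`: the downward closure of `X`. -/
def downClosure (X : Set Perm) : Set Perm :=
  {σ | ∃ τ ∈ X, Contains τ σ}

/-- `⨁ X`: the smallest sum closed permutation class containing `X`. -/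
def sumClosure (X : Set Perm) : Set Perm :=
  {π | ∀ D : Set Perm, IsPermClass D → IsSumClosed D → X ⊆ D → π ∈ D}

/-- The basis of a permutation class: the containment-minimal permutations outside it. -/
def basis (C : Set Perm) : Set Perm :=
  {β | β ∉ C ∧ ∀ σ : Perm, Contains β σ → σ ≠ β → σ ∈ C}

/-- A class is finitely based if its basis is finite. -/
def FinitelyBased (C : Set Perm) : Prop := (basis C).Finite

/-- The number of members of `C` of length `n`. -/
noncomputable def numLength (C : Set Perm) (n : ℕ) : ℕ :=
  {π : Equiv.Perm (Fin n) | (⟨n, π⟩ : Perm) ∈ C}.ncard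

/-- The number of sum indecomposable members of `C` of length `n`. -/
noncomputable def numIndecomposable (C : Set Perm) (n : ℕ) : ℕ :=
  {π : Equiv.Perm (Fin n) | (⟨n, π⟩ : Perm) ∈ C ∧ SumIndecomposable ⟨n, π⟩}.ncard

/-- The upper growth rate `limsup |C_n|^(1/n)`, as an extended nonnegative real number.
(For sum closed classes it is the growth rate, as the limit exists.) -/
noncomputable def upperGrowthRate (C : Set Perm) : ℝ≥0∞ :=
  limsup (fun n : ℕ => (numLength C n : ℝ≥0∞) ^ (1 / (n : ℝ))) atTop

/-! ### Sequences

A sequence `(s_n)_{n ≥ 1}` is a function `s : ℕ → ℕ` whose value at `0` is never used. -/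

/-- `C` realizes `s` if it has exactly `s n` sum indecomposable members of each length `n ≥ 1`. -/
def Realizes (C : Set Perm) (s : ℕ → ℕ) : Prop :=
  ∀ n, 1 ≤ n → numIndecomposable C n = s n

/-- Legal sequences. -/
structure Legal (s : ℕ → ℕ) : Prop where
  zero_step : ∀ n, 1 ≤ n → s n = 0 → s (n + 1) = 0
  one_step : ∀ n, 3 ≤ n → s n ≤ 1 → s (n + 1) ≤ 1
  two_step : ∀ n, 4 ≤ n → s n ≤ 2 → s (n + 1) ≤ 2
  three_step : ∀ n, 5 ≤ n → s n ≤ 3 → s (n + 1) ≤ 3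
  first : s 1 ≤ 1
  second : s 2 ≤ 1
  third : s 3 ≤ 3

/-- `t` dominates `r`. -/
def Dominates (t r : ℕ → ℕ) : Prop := ∀ n, 1 ≤ n → r n ≤ t n

/-- The sequence `1, 1, 2, 3, 4^{2i}, 5, 4^∞`, whose entry `5` has index `2i + 5`. -/
def boundSeq (i n : ℕ) : ℕ :=
  if n ≤ 2 then 1
  else if n = 3 then 2
  else if n = 4 then 3
  else if n = 2 * i + 5 then 5
  else 4

/-- The sequence ends in `1, 1`: either it is finite (zero from some point on) and its last two
nonzero entries are both `1`, or it is infinite and ends in `1, 1, 1, …`. -/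
def EndsInOneOne (s : ℕ → ℕ) : Prop :=
  (∃ n, 1 ≤ n ∧ s n = 1 ∧ s (n + 1) = 1 ∧ ∀ m, n + 2 ≤ m → s m = 0) ∨
    ∃ n, ∀ m, n ≤ m → s m = 1

/-! ### The antichain `U^o` -/

/-- The one-line notation of `μ_{2k+7}` (see `mu`), with zero-based positions and values. -/
def muFun (k j : ℕ) : ℕ :=
  if j = 0 then 1
  else if j = 1 then 2
  else if j = 3 then 0
  else if j = 2 * k + 4 then 2 * k + 5
  else if j = 2 * k + 5 then 2 * k + 6
  else if j = 2 * k + 6 then 2 * k + 3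
  else if j % 2 = 0 then j + 2
  else j - 2

/-- The inverse of `muFun` on `{0, …, 2k+6}`. -/
def muInv (k v : ℕ) : ℕ :=
  if v = 0 then 3
  else if v = 1 then 0
  else if v = 2 then 1
  else if v = 2 * k + 3 then 2 * k + 6
  else if v = 2 * k + 5 then 2 * k + 4
  else if v = 2 * k + 6 then 2 * k + 5
  else if v % 2 = 0 then v - 2
  else v + 2

theorem muFun_lt (k j : ℕ) (h : j < 2 * k + 7) : muFun k j < 2 * k + 7 := by
  unfold muFun
  split_ifs <;> omega

theorem muInv_lt (k v : ℕ) (h : v < 2 * k + 7) : muInv k v < 2 * k + 7 := by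
  unfold muInv
  split_ifs <;> omega

theorem muInv_muFun (k j : ℕ) (h : j < 2 * k + 7) : muInv k (muFun k j) = j := by
  grind (splits := 40) [muFun, muInv]

theorem muFun_muInv (k v : ℕ) (h : v < 2 * k + 7) : muFun k (muInv k v) = v := by
  grind (splits := 40) [muFun, muInv]

/-- The permutation `μ_{2k+7} = 2 3 5 1 7 4 9 6 ⋯ (2k+5) (2k+2) (2k+6) (2k+7) (2k+4)` of length
`2k+7`, obtained from the increasing oscillation `2 4 1 6 3 8 5 ⋯ (2k+1) (2k+5) (2k+3)` of
length `2k+5` by inflating the two leaves of its inversion graph, the first entry `2` and the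
maximum entry `2k+5`, by `12`. For instance `μ_7 = 2 3 5 1 6 7 4` and
`μ_11 = 2 3 5 1 7 4 9 6 10 11 8`. -/
def mu (k : ℕ) : Equiv.Perm (Fin (2 * k + 7)) where
  toFun j := ⟨muFun k j, muFun_lt k j j.2⟩
  invFun v := ⟨muInv k v, muInv_lt k v v.2⟩
  left_inv j := Fin.ext (muInv_muFun k j j.2)
  right_inv v := Fin.ext (muFun_muInv k v v.2)

/-- The antichain `U^o = {μ_7, μ_9, μ_11, …}`. -/
def Uo : Set Perm := {π | ∃ k : ℕ, π = ⟨2 * k + 7, mu k⟩}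

/-! ### The constant `ξ` -/

/-- `ξ ≈ 2.30522`, the unique positive root of `x^5 - 2x^4 - x^2 - x - 1`. -/
noncomputable def xi : ℝ := sSup {x : ℝ | 0 < x ∧ x ^ 5 - 2 * x ^ 4 - x ^ 2 - x - 1 = 0}

theorem xi_aux_unique (x y : ℝ) (hx : 0 < x) (hxy : x < y)
    (h1 : x ^ 5 - 2 * x ^ 4 - x ^ 2 - x - 1 = 0)
    (h2 : y ^ 5 - 2 * y ^ 4 - y ^ 2 - y - 1 = 0) : False := by
  have hy : 0 < y := hx.trans hxy
  have e : x ^ 5 * (2 * y ^ 4 + y ^ 2 + y + 1) = y ^ 5 * (2 * x ^ 4 + x ^ 2 + x + 1) := by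
    linear_combination (-y ^ 5) * h1 * (-1) + x ^ 5 * h2 * (-1)
  have a1 : x ^ 5 * y ^ 4 < y ^ 5 * x ^ 4 := by
    have : 0 < x ^ 4 * y ^ 4 * (y - x) := by have := sub_pos.2 hxy; positivity
    nlinarith
  have a2 : x ^ 5 * y ^ 2 < y ^ 5 * x ^ 2 := by
    have h3 : x ^ 3 < y ^ 3 := pow_lt_pow_left₀ hxy hx.le (by norm_num)
    have : 0 < x ^ 2 * y ^ 2 * (y ^ 3 - x ^ 3) := by have := sub_pos.2 h3; positivity
    nlinarith
  have a3 : x ^ 5 * y < y ^ 5 * x := by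
    have h3 : x ^ 4 < y ^ 4 := pow_lt_pow_left₀ hxy hx.le (by norm_num)
    have : 0 < x * y * (y ^ 4 - x ^ 4) := by have := sub_pos.2 h3; positivity
    nlinarith
  have a4 : x ^ 5 < y ^ 5 := pow_lt_pow_left₀ hxy hx.le (by norm_num)
  linarith

theorem xi_spec :
    2.30522 < xi ∧ xi < 2.30523 ∧ xi ^ 5 - 2 * xi ^ 4 - xi ^ 2 - xi - 1 = 0 ∧
      ∀ y : ℝ, 0 < y → y ^ 5 - 2 * y ^ 4 - y ^ 2 - y - 1 = 0 → y = xi := by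
  obtain ⟨r, ⟨hr1, hr2⟩, hr⟩ : ∃ r ∈ Set.Ioo (2.30522 : ℝ) 2.30523,
      r ^ 5 - 2 * r ^ 4 - r ^ 2 - r - 1 = 0 := by
    have hc : ContinuousOn (fun x : ℝ => x ^ 5 - 2 * x ^ 4 - x ^ 2 - x - 1)
        (Set.Icc 2.30522 2.30523) := by fun_prop
    have := intermediate_value_Ioo (by norm_num : (2.30522 : ℝ) ≤ 2.30523) hc
    exact this ⟨by norm_num, by norm_num⟩
  have hr0 : 0 < r := by linarith
  have huniq : ∀ y : ℝ, 0 < y → y ^ 5 - 2 * y ^ 4 - y ^ 2 - y - 1 = 0 → y = r := by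
    intro y hy h
    rcases lt_trichotomy y r with hlt | heq | hgt
    · exact (xi_aux_unique y r hy hlt h hr).elim
    · exact heq
    · exact (xi_aux_unique r y hr0 hgt hr h).elim
  have hset : {x : ℝ | 0 < x ∧ x ^ 5 - 2 * x ^ 4 - x ^ 2 - x - 1 = 0} = {r} := by
    ext y
    simp only [Set.mem_ofPred_eq, Set.mem_singleton_iff]
    exact ⟨fun h => huniq y h.1 h.2, fun h => by subst h; exact ⟨hr0, hr⟩⟩
  have hxi : xi = r := by unfold xi; rw [hset]; exact csSup_singleton r
  rw [hxi]
  exact ⟨hr1, hr2, hr, huniq⟩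

end PermClasses

namespace PermClasses

/-! ### Indecomposability as connectivity of the inversion graph -/

/-! A permutation is sum indecomposable exactly when its inversion graph is connected, and a sum
closed class is determined by its indecomposable members. So it suffices to choose `s n`
indecomposables of each length `n` so that the choice is closed under indecomposable
subpermutations.

The choice is made around the infinite increasing oscillation, whose inversion graph is a path. Its
intervals, with end entries possibly doubled, give five families: two kinds of path (first point
upper or lower), paths forked at the lower left end, paths forked at the upper right end, and, in
odd lengths, paths forked at both ends. They supply 1, 1, 2, 3, 5, 4, 5, 4, … distinct permutations,
and `indecSet` takes the first `s n` of them. Containment between indecomposables factors into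
one-point deletions (`exists_contains_succ`). Inner path points are cut vertices, so a deletion can
only shorten or unfork an end (`Valid.delete`). Legality, together with the exclusion of a final 1,
1, is what makes the choice closed (`Legal.closed`). The double forks of odd length at least 7 are
the members of `Uo`; they contain all the other chosen permutations except the five-point star,
which `s 5 ≤ 4` excludes.

For the second part, splitting off the first summand shows that a class whose sequence dominates 1,
1, 2, 3, 4, 4, … has growth rate at least `xi`. A smaller growth rate therefore forces an entry
below that sequence, after which legality makes `s` eventually constant, equal to 0, 2 or 3. The
proper indecomposable subpermutations of a long basis element then lie in the first three families.
These families avoid certain configurations of at most five points, and a long one-point extension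
avoiding them is again in the three families (`Tame.exists_plots`). Hence long basis elements do not
exist. With a tail of 4s the argument would break down: the long double forks would be basis
elements. -/

theorem dsum_castAdd (α β : Perm) (a : Fin α.1) :
    ((dsum α β).2 (Fin.castAdd β.1 a)).1 = (α.2 a).1 := by
  show (finSumFinEquiv (Sum.map α.2 β.2 (finSumFinEquiv.symm (Fin.castAdd β.1 a)))).1 = _
  simp

theorem dsum_natAdd (α β : Perm) (b : Fin β.1) :
    ((dsum α β).2 (Fin.natAdd α.1 b)).1 = α.1 + (β.2 b).1 := by
  show (finSumFinEquiv (Sum.map α.2 β.2 (finSumFinEquiv.symm (Fin.natAdd α.1 b)))).1 = _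
  simp

theorem dsum_lt_iff (α β : Perm) (a : Fin (α.1 + β.1)) :
    ((dsum α β).2 a).1 < α.1 ↔ a.1 < α.1 := by
  refine Fin.addCases (fun i => ?_) (fun j => ?_) a
  · rw [dsum_castAdd α β i]; simp
  · rw [dsum_natAdd α β j]; simp

/-- A cut crossed by no inversion splits the permutation as a sum. -/
theorem exists_eq_dsum (π : Perm) (k : ℕ) (hk : k ≤ π.1)
    (h : ∀ a b : Fin π.1, a.1 < k → k ≤ b.1 → π.2 a < π.2 b) :
    ∃ α β : Perm, π = dsum α β ∧ α.1 = k ∧ β.1 = π.1 - k := by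
  obtain ⟨n, π⟩ := π
  obtain ⟨m, rfl⟩ : ∃ m, n = k + m := ⟨n - k, (Nat.add_sub_cancel' hk).symm⟩
  simp only at h
  have hlt : ∀ a : Fin (k + m), a.1 < k → (π a).1 < k := by
    intro a ha
    by_contra hc
    push Not at hc
    -- Counting: the `m` later entries all lie above `π a`, but a value that is at least `k` has
    -- fewer than `m` values above it.
    have h1 : (Finset.univ.map (Fin.natAddEmb k : Fin m ↪ Fin (k + m))).map π.toEmbedding ⊆
        Finset.Ioi (π a) := by
      intro v hv
      simp only [Finset.mem_map, Finset.mem_univ, true_and, exists_exists_eq_and] at hv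
      obtain ⟨b, rfl⟩ := hv
      simp only [Finset.mem_Ioi]
      exact h a _ ha (by simp)
    have h2 := Finset.card_le_card h1
    simp at h2
    have := (π a).2
    omega
  have hmaps : Set.MapsTo (finSumFinEquiv.symm.permCongr π) (Set.range (Sum.inl : Fin k → Fin k ⊕ Fin m))
      (Set.range (Sum.inl : Fin k → Fin k ⊕ Fin m)) := by
    rintro _ ⟨a, rfl⟩
    have h3 := hlt (Fin.castAdd m a) (by simp)
    refine ⟨⟨_, h3⟩, ?_⟩
    simp only [Equiv.permCongr_apply, Equiv.symm_symm, finSumFinEquiv_apply_left]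
    rw [Equiv.eq_symm_apply]
    ext
    simp
  obtain ⟨⟨α, β⟩, hαβ⟩ := Equiv.Perm.mem_sumCongrHom_range_of_perm_mapsTo_inl hmaps
  refine ⟨⟨k, α⟩, ⟨m, β⟩, ?_, rfl, by simp⟩
  unfold dsum
  simp only [Sigma.mk.injEq, heq_eq_eq, true_and]
  have h4 : Equiv.sumCongr α β = finSumFinEquiv.symm.permCongr π := hαβ
  rw [h4]
  ext x
  simp [Equiv.permCongr_apply]

/-- Connectivity is phrased through predicates invariant along edges, so that no walks have to be
handled. Every cut between consecutive positions is crossed by an inversion, which carries the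
predicate from one side to the other. -/
theorem sumIndecomposable_iff (π : Perm) :
    SumIndecomposable π ↔ 1 ≤ π.1 ∧ ∀ K : Fin π.1 → Prop,
      (∀ a b, a < b → π.2 b < π.2 a → (K a ↔ K b)) → ∀ a b, K a → K b := by
  constructor
  · rintro ⟨h1, h⟩
    refine ⟨h1, fun K hK => ?_⟩
    have hstep : ∀ i : ℕ, ∀ hi : i + 1 < π.1, K ⟨i, by omega⟩ ↔ K ⟨i + 1, hi⟩ := by
      intro i hi
      obtain ⟨u, w, hu, hw, huw⟩ : ∃ u w : Fin π.1, u.1 < i + 1 ∧ i + 1 ≤ w.1 ∧ π.2 w < π.2 u := by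
        by_contra hc
        push Not at hc
        obtain ⟨α, β, e, hα, hβ⟩ := exists_eq_dsum π (i + 1) hi.le (fun a b ha hb =>
          lt_of_le_of_ne (hc a b ha hb) (fun e => by
            have := π.2.injective e
            subst this; omega))
        rcases h α β e with h' | h' <;> unfold len at h' <;> omega
      -- An entry between `u` and `w` is either below `π u`, hence inverted with `u`, or above `π
      -- w`, hence inverted with `w`.
      have key : ∀ c : Fin π.1, u ≤ c → c ≤ w → (K c ↔ K u) := by
        intro c huc hcw
        have huw' := hK u w (by omega) huw
        rcases eq_or_lt_of_le huc with rfl | huc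
        · rfl
        rcases eq_or_lt_of_le hcw with rfl | hcw
        · exact huw'.symm
        by_cases hc : π.2 c < π.2 u
        · exact (hK u c huc hc).symm
        · rw [huw']
          exact hK c w hcw (lt_of_lt_of_le huw (not_lt.1 hc))
      rw [key ⟨i, by omega⟩ (by simp [Fin.le_def]; omega) (by simp [Fin.le_def]; omega),
        key ⟨i + 1, hi⟩ (by simp [Fin.le_def]; omega) (by simp [Fin.le_def]; omega)]
    have hall : ∀ i : ℕ, ∀ hi : i < π.1, K ⟨i, hi⟩ ↔ K ⟨0, by omega⟩ := by
      intro i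
      induction i with
      | zero => intro _; rfl
      | succ i ih => intro hi; rw [← hstep i hi, ih]
    intro a b ha
    exact (hall b.1 b.2).2 ((hall a.1 a.2).1 ha)
  · rintro ⟨h1, h⟩
    refine ⟨h1, ?_⟩
    rintro α β rfl
    unfold len
    by_contra hc
    push Not at hc
    obtain ⟨hα, hβ⟩ := hc
    have := h (fun a => a.1 < α.1) (fun a b hab hba => by
      have ha := dsum_lt_iff α β a
      have hb := dsum_lt_iff α β b
      rw [Fin.lt_def] at hab hba
      constructor
      · intro h'
        rw [← ha] at h'
        rw [← hb]; omega
      · intro h'; show a.1 < α.1; omega) ⟨0, by show 0 < α.1 + β.1; omega⟩ ⟨α.1, by show α.1 < α.1 + β.1; omega⟩ (by show 0 < α.1; omega)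
    simp at this

/-! ### Containment and sums -/

theorem Contains.refl (π : Perm) : Contains π π := ⟨RelEmbedding.refl _, fun _ _ => Iff.rfl⟩

theorem Contains.trans {π σ τ : Perm} (h : Contains π σ) (h' : Contains σ τ) : Contains π τ := by
  obtain ⟨f, hf⟩ := h
  obtain ⟨g, hg⟩ := h'
  exact ⟨g.trans f, fun a b => (hg a b).trans (hf _ _)⟩

theorem contains_dsum_left (π τ : Perm) : Contains (dsum π τ) π :=
  ⟨Fin.castAddOrderEmb τ.1, fun a b => by
    have ha := dsum_castAdd π τ a
    have hb := dsum_castAdd π τ b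
    show (π.2 a).1 < (π.2 b).1 ↔ ((dsum π τ).2 (Fin.castAdd _ a)).1 < ((dsum π τ).2 (Fin.castAdd _ b)).1
    rw [ha, hb]⟩

theorem contains_dsum_right (π τ : Perm) : Contains (dsum π τ) τ :=
  ⟨Fin.natAddOrderEmb π.1, fun a b => by
    have ha := dsum_natAdd π τ a
    have hb := dsum_natAdd π τ b
    show (τ.2 a).1 < (τ.2 b).1 ↔ ((dsum π τ).2 (Fin.natAdd _ a)).1 < ((dsum π τ).2 (Fin.natAdd _ b)).1
    rw [ha, hb]; omega⟩

/-- An indecomposable permutation contained in a sum is contained in one of the summands. -/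
theorem contains_of_contains_dsum {π τ σ : Perm} (hσ : SumIndecomposable σ)
    (h : Contains (dsum π τ) σ) : Contains π σ ∨ Contains τ σ := by
  obtain ⟨f, hf⟩ := h
  rw [sumIndecomposable_iff] at hσ
  -- No inversion of a sum joins its two summands, so the summand in which an entry lands is
  -- constant on the connected `σ`.
  have hK := hσ.2 (fun a => (f a).1 < π.1) (fun a b hab hba => by
    have ha := dsum_lt_iff π τ (f a)
    have hb := dsum_lt_iff π τ (f b)
    have h1 := (hf b a).1 hba
    have h2 := f.lt_iff_lt.2 hab
    rw [Fin.lt_def] at h1 h2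
    constructor
    · intro h'
      rw [← ha] at h'
      rw [← hb]; omega
    · intro h'; show (f a).1 < π.1; omega)
  by_cases h0 : (f ⟨0, hσ.1⟩).1 < π.1
  · left
    have hall : ∀ a, (f a).1 < π.1 := fun a => hK _ a h0
    refine ⟨OrderEmbedding.ofStrictMono (fun a => ⟨(f a).1, hall a⟩) (fun a b hab => ?_), fun a b => ?_⟩
    · exact f.lt_iff_lt.2 hab
    · rw [hf a b]
      have ha := dsum_castAdd π τ ⟨(f a).1, hall a⟩
      have hb := dsum_castAdd π τ ⟨(f b).1, hall b⟩
      have ea : Fin.castAdd τ.1 ⟨(f a).1, hall a⟩ = f a := rfl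
      have eb : Fin.castAdd τ.1 ⟨(f b).1, hall b⟩ = f b := rfl
      rw [ea] at ha; rw [eb] at hb
      rw [Fin.lt_def, ha, hb]; exact Iff.rfl
  · right
    have hall : ∀ a, π.1 ≤ (f a).1 := fun a => by
      by_contra hc
      exact h0 (hK a _ (not_le.1 hc))
    have hb' : ∀ a, (f a).1 - π.1 < τ.1 := fun a => by
      have h1 : (f a).1 < π.1 + τ.1 := (f a).2
      have := hall a
      omega
    refine ⟨OrderEmbedding.ofStrictMono (fun a => ⟨(f a).1 - π.1, hb' a⟩) (fun a b hab => ?_), fun a b => ?_⟩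
    · have h1 := f.lt_iff_lt.2 hab
      have := hall a
      rw [Fin.lt_def] at h1 ⊢
      simp only
      omega
    · rw [hf a b]
      have ha := dsum_natAdd π τ ⟨(f a).1 - π.1, hb' a⟩
      have hb := dsum_natAdd π τ ⟨(f b).1 - π.1, hb' b⟩
      have ea : Fin.natAdd π.1 ⟨(f a).1 - π.1, hb' a⟩ = f a := by
        ext; simp [hall a]
      have eb : Fin.natAdd π.1 ⟨(f b).1 - π.1, hb' b⟩ = f b := by
        ext; simp [hall b]
      rw [ea] at ha; rw [eb] at hb
      rw [Fin.lt_def, ha, hb]; exact Nat.add_lt_add_iff_left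

/-! ### The class of sums of a set of indecomposables -/

/-- The permutations all of whose indecomposable subpermutations lie in `S`. -/
def sumClass (S : Set Perm) : Set Perm :=
  {π | ∀ σ, SumIndecomposable σ → Contains π σ → σ ∈ S}

theorem isPermClass_sumClass (S : Set Perm) : IsPermClass (sumClass S) :=
  fun _ hπ _ h _ hτ h' => hπ _ hτ (h.trans h')

theorem isSumClosed_sumClass (S : Set Perm) : IsSumClosed (sumClass S) := by
  intro π hπ σ hσ τ hτ h
  rcases contains_of_contains_dsum hτ h with h | h
  · exact hπ _ hτ h
  · exact hσ _ hτ h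

/-- This turns the count of indecomposables of the class into the count of `S`. -/
theorem mem_sumClass_iff {S : Set Perm}
    (hS : ∀ π ∈ S, ∀ σ, SumIndecomposable σ → Contains π σ → σ ∈ S)
    {π : Perm} (hπ : SumIndecomposable π) : π ∈ sumClass S ↔ π ∈ S :=
  ⟨fun h => h _ hπ (Contains.refl π), fun h => hS π h⟩

theorem contains_of_len_zero (π : Perm) {σ : Perm} (h : σ.1 = 0) : Contains π σ := by
  obtain ⟨m, σ⟩ := σ
  subst h
  exact ⟨⟨⟨Fin.elim0, fun a => a.elim0⟩, fun {a} => a.elim0⟩, fun a => a.elim0⟩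

/-- Induction on the length, splitting decomposable permutations. Nonemptiness of `X` serves the
empty permutation, which is not a sum of indecomposables of positive number. -/
theorem sumClass_subset_sumClosure {S X : Set Perm} (hX : X.Nonempty)
    (h : S ⊆ downClosure X) : sumClass S ⊆ sumClosure (downClosure X) := by
  have key : ∀ n, ∀ π : Perm, π.1 = n → π ∈ sumClass S → π ∈ sumClosure (downClosure X) := by
    intro n
    induction n using Nat.strong_induction_on with
    | _ n ih =>
      intro π hn hπ
      by_cases h0 : π.1 = 0
      · obtain ⟨τ, hτ⟩ := hX
        exact fun D _ _ hD => hD ⟨τ, hτ, contains_of_len_zero τ h0⟩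
      by_cases hi : SumIndecomposable π
      · exact fun D _ _ hD => hD (h (hπ π hi (Contains.refl π)))
      · have : ∃ α β : Perm, π = dsum α β ∧ len α ≠ 0 ∧ len β ≠ 0 := by
          by_contra hc
          push Not at hc
          exact hi ⟨by unfold len; omega, fun α β e => or_iff_not_imp_left.2 (hc α β e)⟩
        obtain ⟨α, β, rfl, hα, hβ⟩ := this
        unfold len at hα hβ
        have hn' : α.1 + β.1 = n := hn
        have h1 := ih α.1 (by omega) α rfl
          (isPermClass_sumClass S _ hπ _ (contains_dsum_left α β))
        have h2 := ih β.1 (by omega) β rfl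
          (isPermClass_sumClass S _ hπ _ (contains_dsum_right α β))
        exact fun D hD hD' hD'' => hD' _ (h1 D hD hD' hD'') _ (h2 D hD hD' hD'')
  exact fun π hπ => key _ π rfl hπ

/-! ### Permutations as patterns of planar point sets -/

/-- The point `z` lies to the left of and above `w`. -/
def NW (z w : ℤ × ℤ) : Prop := z.1 < w.1 ∧ w.2 < z.2

/-- `π` is the pattern of the point set `s`. -/
def Plots (π : Perm) (s : Set (ℤ × ℤ)) : Prop :=
  ∃ f : Fin π.1 → ℤ × ℤ, Set.range f = s ∧
    ∀ a b, (a < b ↔ (f a).1 < (f b).1) ∧ (π.2 a < π.2 b ↔ (f a).2 < (f b).2)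

/-- The inversion graph of `s` is connected. -/
def Linked (s : Set (ℤ × ℤ)) : Prop :=
  s.Nonempty ∧ ∀ K : ℤ × ℤ → Prop,
    (∀ z ∈ s, ∀ w ∈ s, NW z w → (K z ↔ K w)) → ∀ z ∈ s, ∀ w ∈ s, K z → K w

/-- No two points of `s` share a coordinate. -/
def Generic (s : Set (ℤ × ℤ)) : Prop :=
  ∀ z ∈ s, ∀ w ∈ s, z ≠ w → z.1 ≠ w.1 ∧ z.2 ≠ w.2

theorem Plots.of_mono {π : Perm} {s : Set (ℤ × ℤ)} (f : Fin π.1 → ℤ × ℤ) (hf : Set.range f = s)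
    (h1 : ∀ a b, a < b → (f a).1 < (f b).1)
    (h2 : ∀ a b, π.2 a < π.2 b → (f a).2 < (f b).2) : Plots π s := by
  refine ⟨f, hf, fun a b => ⟨⟨h1 a b, fun h => ?_⟩, ⟨h2 a b, fun h => ?_⟩⟩⟩
  · by_contra hc
    rcases eq_or_lt_of_le (not_lt.1 hc) with rfl | hc
    · exact lt_irrefl _ h
    · exact lt_asymm h (h1 _ _ hc)
  · by_contra hc
    rcases eq_or_lt_of_le (not_lt.1 hc) with e | hc
    · have := π.2.injective e
      subst this
      exact lt_irrefl _ h
    · exact lt_asymm h (h2 _ _ hc)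

theorem exists_plots_self (π : Perm) : ∃ s, Plots π s :=
  ⟨_, fun a => ((a.1 : ℤ), ((π.2 a).1 : ℤ)), rfl, fun a b => by simp⟩

theorem injective_of_lt_iff {n : ℕ} {f : Fin n → ℤ × ℤ}
    (h : ∀ a b, a < b ↔ (f a).1 < (f b).1) : Function.Injective f := by
  intro a b hab
  have h1 := h a b
  have h2 := h b a
  rw [hab] at h1 h2
  simp only [lt_self_iff_false, iff_false, not_lt] at h1 h2
  exact le_antisymm h2 h1

theorem Plots.ncard {π : Perm} {s : Set (ℤ × ℤ)} (h : Plots π s) : s.ncard = π.1 := by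
  obtain ⟨f, rfl, hf⟩ := h
  rw [← Set.image_univ, Set.ncard_image_of_injective _ (injective_of_lt_iff fun a b => (hf a b).1),
    Set.ncard_univ, Nat.card_eq_fintype_card, Fintype.card_fin]

theorem Plots.finite {π : Perm} {s : Set (ℤ × ℤ)} (h : Plots π s) : s.Finite := by
  obtain ⟨f, rfl, -⟩ := h
  exact Set.finite_range f

theorem Plots.generic {π : Perm} {s : Set (ℤ × ℤ)} (h : Plots π s) : Generic s := by
  obtain ⟨f, rfl, hf⟩ := h
  rintro _ ⟨a, rfl⟩ _ ⟨b, rfl⟩ hab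
  have hne : a ≠ b := fun e => hab (by rw [e])
  have h1 := hf a b
  have h2 := hf b a
  constructor
  · rcases lt_or_gt_of_ne hne with h | h
    · exact (h1.1.1 h).ne
    · exact (h2.1.1 h).ne'
  · rcases lt_or_gt_of_ne (π.2.injective.ne hne) with h | h
    · exact (h1.2.1 h).ne
    · exact (h2.2.1 h).ne'

theorem Generic.mono {s t : Set (ℤ × ℤ)} (h : Generic s) (hts : t ⊆ s) : Generic t :=
  fun z hz w hw => h z (hts hz) w (hts hw)

theorem exists_perm_of_injective {n : ℕ} (g : Fin n → ℤ) (hg : Function.Injective g) :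
    ∃ τ : Equiv.Perm (Fin n), ∀ a b, τ a < τ b → g a < g b := by
  refine ⟨(Tuple.sort g).symm, fun a b hab => ?_⟩
  have h := Tuple.monotone_sort g hab.le
  simp only [Function.comp_apply, Equiv.apply_symm_apply] at h
  refine lt_of_le_of_ne h fun e => ?_
  rw [hg e] at hab
  exact lt_irrefl _ hab

theorem exists_plots {s : Set (ℤ × ℤ)} (hs : s.Finite) (hg : Generic s) : ∃ π, Plots π s := by
  obtain ⟨n, e, he, hes⟩ : ∃ n : ℕ, ∃ e : Fin n → ℤ × ℤ, Function.Injective e ∧ Set.range e = s := by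
    have : Finite s := hs
    obtain ⟨n, ⟨e⟩⟩ := Finite.exists_equiv_fin s
    exact ⟨n, fun i => e.symm i, Subtype.val_injective.comp e.symm.injective, by
      ext z; constructor
      · rintro ⟨i, rfl⟩; exact (e.symm i).2
      · intro hz; exact ⟨e ⟨z, hz⟩, by simp⟩⟩
  subst hes
  have h1 : Function.Injective fun i => (e i).1 := fun a b hab => by
    by_contra hne
    exact (hg _ ⟨a, rfl⟩ _ ⟨b, rfl⟩ (he.ne hne)).1 hab
  have h2 : Function.Injective fun i => (e i).2 := fun a b hab => by
    by_contra hne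
    exact (hg _ ⟨a, rfl⟩ _ ⟨b, rfl⟩ (he.ne hne)).2 hab
  set σ := Tuple.sort fun i => (e i).1
  obtain ⟨τ, hτ⟩ := exists_perm_of_injective (fun i => (e (σ i)).2) (h2.comp σ.injective)
  refine ⟨⟨n, τ⟩, Plots.of_mono (fun i => e (σ i)) ?_ ?_ hτ⟩
  · exact σ.surjective.range_comp e
  · intro a b hab
    exact lt_of_le_of_ne (Tuple.monotone_sort (fun i => (e i).1) hab.le)
      (fun e' => hab.ne (σ.injective (h1 e')))

theorem Plots.image {π : Perm} {s : Set (ℤ × ℤ)} (h : Plots π s) (φ : ℤ × ℤ → ℤ × ℤ)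
    (h1 : ∀ z ∈ s, ∀ w ∈ s, z.1 < w.1 → (φ z).1 < (φ w).1)
    (h2 : ∀ z ∈ s, ∀ w ∈ s, z.2 < w.2 → (φ z).2 < (φ w).2) : Plots π (φ '' s) := by
  obtain ⟨f, rfl, hf⟩ := h
  exact Plots.of_mono (φ ∘ f) (Set.range_comp φ f)
    (fun a b hab => h1 _ ⟨a, rfl⟩ _ ⟨b, rfl⟩ ((hf a b).1.1 hab))
    (fun a b hab => h2 _ ⟨a, rfl⟩ _ ⟨b, rfl⟩ ((hf a b).2.1 hab))

/-- Both enumerations list the points by increasing abscissa, so they coincide; the ordinates then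
determine the values. -/
theorem Plots.unique {π σ : Perm} {s : Set (ℤ × ℤ)} (h : Plots π s) (h' : Plots σ s) : π = σ := by
  have hlen := h.ncard.symm.trans h'.ncard
  have hgen := h.generic
  obtain ⟨n, π⟩ := π
  obtain ⟨m, σ⟩ := σ
  simp only at hlen
  subst hlen
  obtain ⟨f, rfl, hf⟩ := h
  obtain ⟨g, hgs, hg⟩ := h'
  have e1 : (fun a => (f a).1) = fun a => (g a).1 := by
    refine (StrictMono.range_inj (fun a b hab => (hf a b).1.1 hab)
      (fun a b hab => (hg a b).1.1 hab)).1 ?_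
    have := congrArg (Set.image Prod.fst) hgs
    rw [← Set.range_comp, ← Set.range_comp] at this
    exact this.symm
  have e2 : f = g := by
    funext a
    by_contra hne
    exact (hgen _ ⟨a, rfl⟩ _ (hgs ▸ ⟨a, rfl⟩) hne).1 (congrFun e1 a)
  subst e2
  have e3 : (fun a => π (σ.symm a)) = id := by
    refine (StrictMono.range_inj (fun a b hab => ?_) strictMono_id).1 ?_
    · rw [(hf _ _).2, ← (hg _ _).2]
      simpa using hab
    · rw [Set.range_id]
      exact (π.surjective.comp σ.symm.surjective).range_eq
  congr 1
  ext a
  have := congrFun e3 (σ a)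
  simp only [Equiv.symm_apply_apply, id] at this
  rw [this]

theorem Plots.contains {π σ : Perm} {s t : Set (ℤ × ℤ)} (h : Plots π s) (h' : Plots σ t)
    (hts : t ⊆ s) : Contains π σ := by
  obtain ⟨f, rfl, hf⟩ := h
  obtain ⟨g, rfl, hg⟩ := h'
  have : ∀ b, ∃ a, f a = g b := fun b => hts ⟨b, rfl⟩
  choose k hk using this
  refine ⟨OrderEmbedding.ofStrictMono k fun a b hab => ?_, fun a b => ?_⟩
  · rw [(hf _ _).1, hk, hk]; exact (hg a b).1.1 hab
  · show _ ↔ π.2 (k a) < π.2 (k b)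
    rw [(hf _ _).2, hk, hk]; exact (hg a b).2

theorem Plots.exists_of_contains {π σ : Perm} {s : Set (ℤ × ℤ)} (h : Plots π s)
    (h' : Contains π σ) : ∃ t ⊆ s, Plots σ t := by
  obtain ⟨f, rfl, hf⟩ := h
  obtain ⟨g, hg⟩ := h'
  exact ⟨_, Set.range_comp_subset_range g f, f ∘ g, rfl, fun a b =>
    ⟨(g.lt_iff_lt.symm).trans (hf _ _).1, (hg a b).trans (hf _ _).2⟩⟩

theorem Plots.exists_sub {π : Perm} {s t : Set (ℤ × ℤ)} (h : Plots π s) (hts : t ⊆ s) :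
    ∃ σ, Plots σ t ∧ Contains π σ := by
  obtain ⟨σ, hσ⟩ := exists_plots (h.finite.subset hts) (h.generic.mono hts)
  exact ⟨σ, hσ, h.contains hσ hts⟩

theorem Plots.sumIndecomposable_iff {π : Perm} {s : Set (ℤ × ℤ)} (h : Plots π s) :
    SumIndecomposable π ↔ Linked s := by
  rw [PermClasses.sumIndecomposable_iff]
  obtain ⟨f, rfl, hf⟩ := h
  have hinj := injective_of_lt_iff fun a b => (hf a b).1
  constructor
  · rintro ⟨h1, h2⟩
    refine ⟨⟨_, ⟨⟨0, h1⟩, rfl⟩⟩, ?_⟩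
    rintro K hK _ ⟨a, rfl⟩ _ ⟨b, rfl⟩ hab
    exact h2 (fun a => K (f a)) (fun a b hab hba =>
      hK _ ⟨a, rfl⟩ _ ⟨b, rfl⟩ ⟨(hf a b).1.1 hab, (hf b a).2.1 hba⟩) a b hab
  · rintro ⟨⟨_, a, rfl⟩, h2⟩
    refine ⟨by have := a.2; omega, fun K hK a b hab => ?_⟩
    obtain ⟨c, hc, e⟩ := h2 (fun z => ∃ c, K c ∧ f c = z) (by
      rintro _ ⟨a, rfl⟩ _ ⟨b, rfl⟩ hab
      have := hK a b ((hf a b).1.2 hab.1) ((hf b a).2.2 hab.2)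
      constructor
      · rintro ⟨c, hc, e⟩
        exact ⟨b, this.1 (hinj e ▸ hc), rfl⟩
      · rintro ⟨c, hc, e⟩
        exact ⟨a, this.2 (hinj e ▸ hc), rfl⟩) _ ⟨a, rfl⟩ _ ⟨b, rfl⟩ ⟨a, hab, rfl⟩
    exact hinj e ▸ hc

/-! ### Growing linked sets one point at a time -/

theorem Linked.insert {s : Set (ℤ × ℤ)} (h : Linked s) {w y : ℤ × ℤ} (hw : w ∈ s)
    (hwy : NW w y ∨ NW y w) : Linked (insert y s) := by
  refine ⟨⟨y, Set.mem_insert _ _⟩, fun K hK => ?_⟩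
  have h1 := h.2 K fun z hz w hw => hK z (Set.mem_insert_of_mem _ hz) w (Set.mem_insert_of_mem _ hw)
  have h2 : K w ↔ K y := by
    rcases hwy with h | h
    · exact hK _ (Set.mem_insert_of_mem _ hw) _ (Set.mem_insert _ _) h
    · exact (hK _ (Set.mem_insert _ _) _ (Set.mem_insert_of_mem _ hw) h).symm
  rintro z (rfl | hz) z' (rfl | hz') hk
  · exact hk
  · exact h1 _ hw _ hz' (h2.2 hk)
  · exact h2.1 (h1 _ hz _ hw hk)
  · exact h1 _ hz _ hz' hk

theorem linked_singleton (z : ℤ × ℤ) : Linked {z} :=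
  ⟨⟨z, rfl⟩, by rintro K - _ rfl _ rfl h; exact h⟩

/-- Otherwise no edge of `s` would leave `t`, and membership in `t` would be an invariant predicate
that is not constant. -/
theorem Linked.exists_insert {s t : Set (ℤ × ℤ)} (hs : Linked s) (ht : Linked t) (hts : t ⊂ s) :
    ∃ y ∈ s, y ∉ t ∧ Linked (Insert.insert y t) := by
  by_contra hc
  push Not at hc
  obtain ⟨y, hy, hyt⟩ := Set.exists_of_ssubset hts
  obtain ⟨w, hw⟩ := ht.1
  refine hyt (hs.2 (· ∈ t) (fun z hz w hw hzw => ⟨fun h => ?_, fun h => ?_⟩) w (hts.1 hw) y hy hw)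
  · by_contra hwt
    exact hc w hw hwt (ht.insert h (Or.inl hzw))
  · by_contra hzt
    exact hc z hz hzt (ht.insert h (Or.inr hzw))

/-- Grow `t` inside `s` one point at a time, keeping it linked; the last point added is the one to
remove. -/
theorem Linked.exists_diff_singleton {s t : Set (ℤ × ℤ)} (hfin : s.Finite) (hs : Linked s)
    (ht : Linked t) (hts : t ⊂ s) : ∃ x ∈ s, x ∉ t ∧ Linked (s \ {x}) := by
  induction h : (s \ t).ncard using Nat.strong_induction_on generalizing t with
  | _ n ih =>
    obtain ⟨y, hy, hyt, hl⟩ := hs.exists_insert ht hts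
    have hsub : Insert.insert y t ⊆ s := Set.insert_subset hy hts.1
    rcases eq_or_ssubset_of_subset hsub with e | hss
    · refine ⟨y, hy, hyt, ?_⟩
      rwa [← e, Set.insert_sdiff_of_mem _ (Set.mem_singleton y), Set.sdiff_singleton_eq_self hyt]
    · obtain ⟨x, hx, hxt, hl'⟩ := ih _ (by
        rw [← h]
        refine Set.ncard_lt_ncard ⟨Set.sdiff_subset_sdiff_right (Set.subset_insert _ _), fun h' => ?_⟩
          (hfin.subset Set.sdiff_subset)
        exact (h' ⟨hy, hyt⟩).2 (Set.mem_insert _ _)) hl hss rfl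
      exact ⟨x, hx, fun h => hxt (Set.mem_insert_of_mem _ h), hl'⟩

/-- Between two indecomposable permutations there is one of colength one. -/
theorem exists_contains_succ {π σ : Perm} (hπ : SumIndecomposable π) (hσ : SumIndecomposable σ)
    (h : Contains π σ) (hne : σ ≠ π) :
    ∃ τ, SumIndecomposable τ ∧ Contains π τ ∧ Contains τ σ ∧ τ.1 + 1 = π.1 := by
  obtain ⟨s, hs⟩ := exists_plots_self π
  obtain ⟨t, hts, ht⟩ := hs.exists_of_contains h
  have hss : t ⊂ s := lt_of_le_of_ne hts fun e => hne ((e ▸ ht).unique hs)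
  obtain ⟨x, hx, hxt, hl⟩ := Linked.exists_diff_singleton hs.finite (hs.sumIndecomposable_iff.1 hπ)
    (ht.sumIndecomposable_iff.1 hσ) hss
  obtain ⟨τ, hτ, hπτ⟩ := hs.exists_sub (t := s \ {x}) Set.sdiff_subset
  refine ⟨τ, hτ.sumIndecomposable_iff.2 hl, hπτ,
    hτ.contains ht fun z hz => ⟨hts hz, fun e => hxt (e ▸ hz)⟩, ?_⟩
  rw [← hτ.ncard, ← hs.ncard, Set.ncard_sdiff_singleton_add_one hx hs.finite]

/-- Reduces closure under indecomposable subpermutations to one-point deletions. -/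
theorem mem_of_contains {S : Set Perm} (hS : ∀ π ∈ S, SumIndecomposable π)
    (h : ∀ π ∈ S, ∀ σ, SumIndecomposable σ → Contains π σ → σ.1 + 1 = π.1 → σ ∈ S) :
    ∀ π ∈ S, ∀ σ, SumIndecomposable σ → Contains π σ → σ ∈ S := by
  intro π hπ σ hσ hc
  induction hn : π.1 using Nat.strong_induction_on generalizing π with
  | _ n ih =>
    by_cases e : σ = π
    · exact e ▸ hπ
    · obtain ⟨τ, hτ, h1, h2, h3⟩ := exists_contains_succ (hS π hπ) hσ hc e
      exact ih τ.1 (by omega) τ (h π hπ τ hτ h1 h3) h2 rfl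

/-! ### One-point extensions -/

theorem exists_odd_between {n : ℕ} (p : Fin n → ℤ) (hp : ∀ c, p c % 2 = 0) (L : Fin n → Prop)
    (h : ∀ c d, L c → ¬ L d → p c < p d) :
    ∃ a : ℤ, a % 2 = 1 ∧ ∀ c, (L c → p c < a) ∧ (¬ L c → a < p c) := by
  classical
  by_cases hL : ∃ c, L c
  · obtain ⟨c, hc, hmax⟩ := Finset.exists_max_image (Finset.univ.filter L) p
      (by obtain ⟨c, hc⟩ := hL; exact ⟨c, by simpa using hc⟩)
    simp only [Finset.mem_filter, Finset.mem_univ, true_and] at hc hmax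
    refine ⟨p c + 1, by have := hp c; omega, fun d => ⟨fun hd => ?_, fun hd => ?_⟩⟩
    · have := hmax d hd; omega
    · have := h c d hc hd
      have := hp c
      have := hp d
      omega
  · push Not at hL
    by_cases hn : n = 0
    · subst hn
      exact ⟨1, rfl, fun c => c.elim0⟩
    · obtain ⟨c, -, hmin⟩ := Finset.exists_min_image (Finset.univ : Finset (Fin n)) p
        ⟨⟨0, by omega⟩, by simp⟩
      refine ⟨p c - 1, by have := hp c; omega, fun d => ⟨fun hd => absurd hd (hL d), fun _ => ?_⟩⟩
      have := hmin d (Finset.mem_univ d)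
      omega

/-- Even coordinates leave an odd value free in every gap, so the extra point can be placed without
moving the others. Its odd coordinates later keep it apart from all points of the oscillation. -/
theorem exists_plots_insert {π τ : Perm} {s : Set (ℤ × ℤ)} (h : Contains π τ)
    (hlen : τ.1 + 1 = π.1) (hτ : Plots τ s) (heven : ∀ z ∈ s, z.1 % 2 = 0 ∧ z.2 % 2 = 0) :
    ∃ a b : ℤ, a % 2 = 1 ∧ b % 2 = 1 ∧ Plots π (insert (a, b) s) := by
  obtain ⟨f, rfl, hf⟩ := hτ
  obtain ⟨g, hg⟩ := h
  obtain ⟨x, hx⟩ : ∃ x, ∀ c, g c ≠ x := by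
    by_contra hc
    push Not at hc
    have := Fintype.card_le_of_surjective g hc
    simp at this
    omega
  have hall : ∀ y, y = x ∨ ∃ c, g c = y := by
    intro y
    by_contra hc
    push Not at hc
    have h1 : Finset.univ.map g.toEmbedding ⊆ (Finset.univ.erase x).erase y := by
      intro z hz
      simp only [Finset.mem_map, Finset.mem_univ, true_and] at hz
      obtain ⟨c, rfl⟩ := hz
      simp only [Finset.mem_erase, Finset.mem_univ, and_true]
      exact ⟨hc.2 c, hx c⟩
    have h2 := Finset.card_le_card h1
    rw [Finset.card_map, Finset.card_erase_of_mem (by simp [hc.1]),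
      Finset.card_erase_of_mem (by simp)] at h2
    simp at h2
    have := x.2
    have := y.2
    have : x.1 ≠ y.1 := fun e => hc.1 (Fin.ext e.symm)
    omega
  obtain ⟨a, ha, hac⟩ := exists_odd_between (fun c => (f c).1) (fun c => (heven _ ⟨c, rfl⟩).1)
    (fun c => g c < x) (fun c d hc hd => by
      rw [← (hf c d).1, ← g.lt_iff_lt]
      exact lt_of_lt_of_le hc (not_lt.1 hd))
  obtain ⟨b, hb, hbc⟩ := exists_odd_between (fun c => (f c).2) (fun c => (heven _ ⟨c, rfl⟩).2)
    (fun c => π.2 (g c) < π.2 x) (fun c d hc hd => by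
      rw [← (hf c d).2, hg]
      exact lt_of_lt_of_le hc (not_lt.1 hd))
  refine ⟨a, b, ha, hb, ?_⟩
  classical
  let F : Fin π.1 → ℤ × ℤ := fun y => if h : ∃ c, g c = y then f h.choose else (a, b)
  have hFg : ∀ c, F (g c) = f c := fun c => by
    have : ∃ c', g c' = g c := ⟨c, rfl⟩
    simp only [F, dif_pos this]
    rw [g.injective this.choose_spec]
  have hFx : F x = (a, b) := by
    simp only [F]
    rw [dif_neg]
    push Not
    exact hx
  refine Plots.of_mono F ?_ ?_ ?_
  · ext z
    constructor
    · rintro ⟨y, rfl⟩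
      rcases hall y with rfl | ⟨c, rfl⟩
      · exact Or.inl hFx
      · rw [hFg]; exact Or.inr ⟨c, rfl⟩
    · rintro (rfl | ⟨c, rfl⟩)
      · exact ⟨x, hFx⟩
      · exact ⟨g c, hFg c⟩
  · intro y y' hyy
    rcases hall y with rfl | ⟨c, rfl⟩ <;> rcases hall y' with rfl | ⟨d, rfl⟩
    · exact absurd hyy (lt_irrefl _)
    · rw [hFx, hFg]; exact (hac d).2 (not_lt.2 hyy.le)
    · rw [hFx, hFg]; exact (hac c).1 hyy
    · rw [hFg, hFg]; exact (hf c d).1.1 (g.lt_iff_lt.1 hyy)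
  · intro y y' hyy
    rcases hall y with rfl | ⟨c, rfl⟩ <;> rcases hall y' with rfl | ⟨d, rfl⟩
    · exact absurd hyy (lt_irrefl _)
    · rw [hFx, hFg]; exact (hbc d).2 (not_lt.2 hyy.le)
    · rw [hFx, hFg]; exact (hbc c).1 hyy
    · rw [hFg, hFg]; exact (hf c d).2.1 ((hg c d).2 hyy)

/-! ### The infinite increasing oscillation and its forked intervals -/

/-- The `j`-th point of the infinite increasing oscillation; its inversion graph is the path
`P 0, P 1, P 2, …`. -/
def P (j : ℕ) : ℤ × ℤ :=
  if j % 2 = 0 then (8 * j - 12, 8 * j + 12) else (8 * j, 8 * j)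

/-- A twin of `P j` for even `j`. -/
def Q (j : ℕ) : ℤ × ℤ := (8 * j - 10, 8 * j + 14)

theorem P_even (t : ℕ) : P (2 * t) = (16 * (t : ℤ) - 12, 16 * (t : ℤ) + 12) := by
  simp only [P]; rw [if_pos (by omega)]; ext <;> push_cast <;> ring

theorem P_odd (t : ℕ) : P (2 * t + 1) = (16 * (t : ℤ) + 8, 16 * (t : ℤ) + 8) := by
  simp only [P]; rw [if_neg (by omega)]; ext <;> push_cast <;> ring

theorem Q_even (t : ℕ) : Q (2 * t) = (16 * (t : ℤ) - 10, 16 * (t : ℤ) + 14) := by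
  simp only [Q]; ext <;> push_cast <;> ring

/-- The coordinate sum measures the position along the path. For `Q j` it is `16 * j + 4`, so twins
are never path points and fall between consecutive ones. -/
theorem P_add (j : ℕ) : (P j).1 + (P j).2 = 16 * j := by
  simp only [P]; split_ifs <;> simp only <;> ring

theorem P_injective : Function.Injective P := by
  intro i j h
  have h1 := P_add i
  have h2 := P_add j
  rw [h] at h1
  omega

theorem P_ne_Q (i j : ℕ) : P i ≠ Q j := by
  intro h
  have h1 := P_add i
  rw [h] at h1
  simp only [Q] at h1
  omega

theorem Q_injective : Function.Injective Q := by
  intro i j h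
  simp only [Q, Prod.mk.injEq] at h
  omega

theorem P_add_two (j : ℕ) : P (j + 2) = ((P j).1 + 16, (P j).2 + 16) := by
  simp only [P, Nat.add_mod_right]
  split_ifs <;> ext <;> simp only <;> push_cast <;> ring

theorem Q_add_two (j : ℕ) : Q (j + 2) = ((Q j).1 + 16, (Q j).2 + 16) := by
  simp only [Q]
  ext <;> simp only <;> push_cast <;> ring

/-- The interval `P lo, …, P hi` of the oscillation, with its ends forked as prescribed by `l`
and `r`. -/
def F (lo hi : ℕ) (l r : Bool) : Set (ℤ × ℤ) :=
  {z | (∃ j, lo ≤ j ∧ j ≤ hi ∧ z = P j) ∨ (l = true ∧ z = Q lo) ∨ (r = true ∧ z = Q hi)}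

theorem P_mem_F {lo hi j : ℕ} {l r : Bool} (h1 : lo ≤ j) (h2 : j ≤ hi) : P j ∈ F lo hi l r :=
  Or.inl ⟨j, h1, h2, rfl⟩

theorem Q_mem_F_left {lo hi : ℕ} {r : Bool} : Q lo ∈ F lo hi true r := Or.inr (Or.inl ⟨rfl, rfl⟩)

theorem Q_mem_F_right {lo hi : ℕ} {l : Bool} : Q hi ∈ F lo hi l true := Or.inr (Or.inr ⟨rfl, rfl⟩)

theorem F_eq_insert_right (lo hi : ℕ) (l : Bool) : F lo hi l true = insert (Q hi) (F lo hi l false) := by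
  ext z
  simp only [F, Set.mem_ofPred_eq, Set.mem_insert_iff]
  simp only [true_and, Bool.false_eq_true, false_and, or_false]
  rw [← or_assoc, or_comm]

theorem F_eq_insert_left (lo hi : ℕ) (r : Bool) : F lo hi true r = insert (Q lo) (F lo hi false r) := by
  ext z
  simp only [F, Set.mem_ofPred_eq, Set.mem_insert_iff]
  simp only [true_and, Bool.false_eq_true, false_and, false_or]
  rw [or_left_comm]

theorem F_eq_insert_P_right {lo hi : ℕ} (h : lo ≤ hi + 1) (l : Bool) :
    F lo (hi + 1) l false = insert (P (hi + 1)) (F lo hi l false) := by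
  ext z
  simp only [F, Set.mem_ofPred_eq, Set.mem_insert_iff]
  simp only [Bool.false_eq_true, false_and, or_false]
  constructor
  · rintro (⟨j, h1, h2, rfl⟩ | h')
    · rcases Nat.lt_or_ge hi j with h3 | h3
      · left; congr 1; omega
      · exact Or.inr (Or.inl ⟨j, h1, h3, rfl⟩)
    · tauto
  · rintro (rfl | ⟨j, h1, h2, rfl⟩ | h')
    · exact Or.inl ⟨_, h, le_rfl, rfl⟩
    · exact Or.inl ⟨j, h1, by omega, rfl⟩
    · tauto

theorem F_eq_insert_P_left {lo hi : ℕ} (h : lo ≤ hi) (r : Bool) :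
    F lo hi false r = insert (P lo) (F (lo + 1) hi false r) := by
  ext z
  simp only [F, Set.mem_ofPred_eq, Set.mem_insert_iff]
  simp only [Bool.false_eq_true, false_and, false_or]
  constructor
  · rintro (⟨j, h1, h2, rfl⟩ | h')
    · rcases Nat.eq_or_lt_of_le h1 with rfl | h3
      · exact Or.inl rfl
      · exact Or.inr (Or.inl ⟨j, h3, h2, rfl⟩)
    · tauto
  · rintro (rfl | ⟨j, h1, h2, rfl⟩ | h')
    · exact Or.inl ⟨_, le_rfl, h, rfl⟩
    · exact Or.inl ⟨j, by omega, h2, rfl⟩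
    · tauto

theorem F_self (lo : ℕ) : F lo lo false false = {P lo} := by
  ext z
  simp only [F, Set.mem_ofPred_eq, Set.mem_singleton_iff, Bool.false_eq_true, false_and, or_false]
  constructor
  · rintro ⟨j, h1, h2, rfl⟩; rw [le_antisymm h2 h1]
  · rintro rfl; exact ⟨lo, le_rfl, le_rfl, rfl⟩

theorem P_adj (j : ℕ) : NW (P j) (P (j + 1)) ∨ NW (P (j + 1)) (P j) := by
  rcases Nat.even_or_odd' j with ⟨t, rfl | rfl⟩
  · left; rw [P_even, P_odd]; constructor <;> simp only <;> omega
  · right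
    rw [show 2 * t + 1 + 1 = 2 * (t + 1) by ring, P_even, P_odd]
    constructor <;> simp only <;> omega

theorem Q_adj (t : ℕ) : NW (Q (2 * t)) (P (2 * t + 1)) := by
  rw [Q_even, P_odd]; constructor <;> simp only <;> omega

theorem Q_adj' (t : ℕ) : NW (Q (2 * t + 2)) (P (2 * t + 1)) := by
  rw [show 2 * t + 2 = 2 * (t + 1) by ring, Q_even, P_odd]; constructor <;> simp only <;> omega

theorem linked_F_path {lo hi : ℕ} (h : lo ≤ hi) : Linked (F lo hi false false) := by
  induction hi, h using Nat.le_induction with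
  | base => rw [F_self]; exact linked_singleton _
  | succ hi h ih =>
    rw [F_eq_insert_P_right (by omega)]
    exact ih.insert (P_mem_F h le_rfl) (P_adj hi)

theorem linked_F {lo hi : ℕ} {l r : Bool} (h : lo ≤ hi) (hl : l = true → lo % 2 = 0 ∧ lo < hi)
    (hr : r = true → hi % 2 = 0 ∧ lo < hi) : Linked (F lo hi l r) := by
  have h1 : Linked (F lo hi l false) := by
    cases l with
    | false => exact linked_F_path h
    | true =>
      obtain ⟨h2, h3⟩ := hl rfl
      obtain ⟨t, rfl⟩ : ∃ t, lo = 2 * t := ⟨lo / 2, by omega⟩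
      rw [F_eq_insert_left]
      exact (linked_F_path h).insert (w := P (2 * t + 1)) (P_mem_F (by omega) (by omega))
        (Or.inr (Q_adj t))
  cases r with
  | false => exact h1
  | true =>
    obtain ⟨h2, h3⟩ := hr rfl
    obtain ⟨t, rfl⟩ : ∃ t, hi = 2 * t + 2 := ⟨hi / 2 - 1, by omega⟩
    rw [F_eq_insert_right]
    exact h1.insert (w := P (2 * t + 1)) (P_mem_F (by omega) (by omega)) (Or.inr (Q_adj' t))

theorem F_finite (lo hi : ℕ) (l r : Bool) : (F lo hi l r).Finite := by
  refine Set.Finite.subset (((Set.finite_Icc lo hi).image P).union (Set.toFinite {Q lo, Q hi})) ?_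
  rintro z (⟨j, h1, h2, rfl⟩ | ⟨-, rfl⟩ | ⟨-, rfl⟩)
  · exact Or.inl ⟨j, ⟨h1, h2⟩, rfl⟩
  · exact Or.inr (Or.inl rfl)
  · exact Or.inr (Or.inr rfl)

theorem ncard_F {lo hi : ℕ} {l r : Bool} (h : lo < hi ∨ l = false ∧ r = false) :
    (F lo hi l r).ncard = hi + 1 - lo + l.toNat + r.toNat := by
  have h0 : (F lo hi false false).ncard = hi + 1 - lo := by
    have : F lo hi false false = P '' Set.Icc lo hi := by
      ext z
      simp only [F, Set.mem_ofPred_eq, Set.mem_image, Set.mem_Icc, Bool.false_eq_true, false_and,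
        or_false]
      exact ⟨fun ⟨j, h1, h2, e⟩ => ⟨j, ⟨h1, h2⟩, e.symm⟩, fun ⟨j, ⟨h1, h2⟩, e⟩ => ⟨j, h1, h2, e.symm⟩⟩
    rw [this, Set.ncard_image_of_injective _ P_injective]
    simp [Set.ncard_eq_toFinset_card']
  have h1 : (F lo hi l false).ncard = hi + 1 - lo + l.toNat := by
    cases l with
    | false => simpa using h0
    | true =>
      rw [F_eq_insert_left, Set.ncard_insert_of_notMem _ (F_finite _ _ _ _), h0]
      · rfl
      · rintro (⟨j, -, -, e⟩ | ⟨e, -⟩ | ⟨e, -⟩)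
        · exact P_ne_Q _ _ e.symm
        · cases e
        · cases e
  cases r with
  | false => simpa using h1
  | true =>
    rw [F_eq_insert_right, Set.ncard_insert_of_notMem _ (F_finite _ _ _ _), h1]
    · rfl
    · rintro (⟨j, -, -, e⟩ | ⟨e, e'⟩ | ⟨e, -⟩)
      · exact P_ne_Q _ _ e.symm
      · have := Q_injective e'
        rcases h with h | ⟨-, h⟩
        · omega
        · cases h
      · cases e

/-! ### Relative positions and inversions in a forked interval -/

theorem P_lt (i j : ℕ) (h : i < j) :
    (j = i + 1 ∧ i % 2 = 0 ∧ (P i).1 < (P j).1 ∧ (P j).2 < (P i).2) ∨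
    (j = i + 1 ∧ i % 2 = 1 ∧ (P j).1 < (P i).1 ∧ (P i).2 < (P j).2) ∨
    (i + 2 ≤ j ∧ (P i).1 < (P j).1 ∧ (P i).2 < (P j).2) := by
  simp only [P]
  split_ifs <;> simp only <;> omega

/-- The points of a forked interval are in general position. -/
theorem generic_F {lo hi : ℕ} {l r : Bool} (hl : l = true → lo % 2 = 0)
    (hr : r = true → hi % 2 = 0) : Generic (F lo hi l r) := by
  have hPP : ∀ i j, P i ≠ P j → (P i).1 ≠ (P j).1 ∧ (P i).2 ≠ (P j).2 := by
    intro i j hij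
    have hne : i ≠ j := fun e => hij (by rw [e])
    rcases lt_or_gt_of_ne hne with h | h
    · have := P_lt i j h; omega
    · have := P_lt j i h; omega
  have hPQ : ∀ i j, j % 2 = 0 → (P i).1 ≠ (Q j).1 ∧ (P i).2 ≠ (Q j).2 := by
    intro i j h
    simp only [P, Q]
    split_ifs <;> simp only <;> omega
  have hQQ : ∀ i j, Q i ≠ Q j → (Q i).1 ≠ (Q j).1 ∧ (Q i).2 ≠ (Q j).2 := by
    intro i j h
    have : i ≠ j := fun e => h (by rw [e])
    simp only [Q]; omega
  rintro z (⟨i, -, -, rfl⟩ | ⟨e, rfl⟩ | ⟨e, rfl⟩) w (⟨j, -, -, rfl⟩ | ⟨e', rfl⟩ | ⟨e', rfl⟩) hne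
  · exact hPP _ _ hne
  · exact hPQ _ _ (hl e')
  · exact hPQ _ _ (hr e')
  · exact ⟨(hPQ j _ (hl e)).1.symm, (hPQ j _ (hl e)).2.symm⟩
  · exact hQQ _ _ hne
  · exact hQQ _ _ hne
  · exact ⟨(hPQ j _ (hr e)).1.symm, (hPQ j _ (hr e)).2.symm⟩
  · exact hQQ _ _ hne
  · exact hQQ _ _ hne

theorem even_F {lo hi : ℕ} {l r : Bool} : ∀ z ∈ F lo hi l r, z.1 % 2 = 0 ∧ z.2 % 2 = 0 := by
  rintro z (⟨i, -, -, rfl⟩ | ⟨e, rfl⟩ | ⟨e, rfl⟩)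
  · simp only [P]; split_ifs <;> simp only <;> omega
  · simp only [Q]; omega
  · simp only [Q]; omega

/-- The inversions of a forked interval. -/
theorem NW_F {lo hi : ℕ} {l r : Bool} (hl : l = true → lo % 2 = 0) (hr : r = true → hi % 2 = 0)
    (hlt : lo < hi ∨ r = false)
    {z w : ℤ × ℤ} (hz : z ∈ F lo hi l r) (hw : w ∈ F lo hi l r) (h : NW z w) :
    ∃ t, w = P (2 * t + 1) ∧ lo ≤ 2 * t + 1 ∧ 2 * t + 1 ≤ hi ∧
      ((z = P (2 * t) ∧ lo ≤ 2 * t) ∨ (z = P (2 * t + 2) ∧ 2 * t + 2 ≤ hi) ∨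
        (l = true ∧ lo = 2 * t ∧ z = Q lo) ∨ (r = true ∧ hi = 2 * t + 2 ∧ z = Q hi)) := by
  obtain ⟨h1, h2⟩ := h
  rcases hw with ⟨j, hj1, hj2, rfl⟩ | ⟨e', rfl⟩ | ⟨e', rfl⟩
  · rcases hz with ⟨i, hi1, hi2, rfl⟩ | ⟨e, rfl⟩ | ⟨e, rfl⟩
    · have hij : i ≠ j := by rintro rfl; omega
      rcases lt_or_gt_of_ne hij with h | h
      · have := P_lt i j h
        refine ⟨i / 2, ?_, by omega, by omega, Or.inl ⟨?_, by omega⟩⟩ <;> congr 1 <;> omega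
      · have := P_lt j i h
        refine ⟨j / 2, ?_, by omega, by omega, Or.inr (Or.inl ⟨?_, by omega⟩)⟩ <;> congr 1 <;> omega
    · have h3 := hl e
      have h4 : j = lo + 1 := by
        simp only [P, Q] at h1 h2
        split_ifs at h1 h2 <;> simp only at h1 h2 <;> omega
      exact ⟨lo / 2, by congr 1; omega, by omega, by omega,
        Or.inr (Or.inr (Or.inl ⟨e, by omega, rfl⟩))⟩
    · have h3 := hr e
      have h4 : j + 1 = hi := by
        simp only [P, Q] at h1 h2
        split_ifs at h1 h2 <;> simp only at h1 h2 <;> omega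
      exact ⟨j / 2, by congr 1; omega, by omega, by omega,
        Or.inr (Or.inr (Or.inr ⟨e, by omega, rfl⟩))⟩
  · have h3 := hl e'
    rcases hz with ⟨i, hi1, hi2, rfl⟩ | ⟨e, rfl⟩ | ⟨e, rfl⟩
    · exfalso
      simp only [P, Q] at h1 h2
      split_ifs at h1 h2 <;> simp only at h1 h2 <;> omega
    · omega
    · simp only [Q] at h1 h2
      rcases hlt with h | h
      · omega
      · rw [h] at e; cases e
  · have h3 := hr e'
    rcases hz with ⟨i, hi1, hi2, rfl⟩ | ⟨e, rfl⟩ | ⟨e, rfl⟩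
    · exfalso
      simp only [P, Q] at h1 h2
      split_ifs at h1 h2 <;> simp only at h1 h2 <;> omega
    · simp only [Q] at h1 h2
      rcases hlt with h | h
      · omega
      · rw [h] at e'; cases e'
    · omega

/-! ### Isomorphic point sets -/

theorem plots_F_add_two {π : Perm} {lo hi : ℕ} {l r : Bool} :
    Plots π (F (lo + 2) (hi + 2) l r) ↔ Plots π (F lo hi l r) := by
  constructor
  · intro h
    have := h.image (fun z => (z.1 - 16, z.2 - 16)) (by intros; simp only; omega)
      (by intros; simp only; omega)
    convert this using 1
    ext z
    simp only [Set.mem_image]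
    constructor
    · rintro (⟨j, h1, h2, rfl⟩ | ⟨e, rfl⟩ | ⟨e, rfl⟩)
      · exact ⟨P (j + 2), P_mem_F (by omega) (by omega), by rw [P_add_two]; simp⟩
      · exact ⟨Q (lo + 2), Or.inr (Or.inl ⟨e, rfl⟩), by rw [Q_add_two]; simp⟩
      · exact ⟨Q (hi + 2), Or.inr (Or.inr ⟨e, rfl⟩), by rw [Q_add_two]; simp⟩
    · rintro ⟨_, ⟨j, h1, h2, rfl⟩ | ⟨e, rfl⟩ | ⟨e, rfl⟩, rfl⟩
      · obtain ⟨i, rfl⟩ : ∃ i, j = i + 2 := ⟨j - 2, by omega⟩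
        exact Or.inl ⟨i, by omega, by omega, by rw [P_add_two]; simp⟩
      · exact Or.inr (Or.inl ⟨e, by rw [Q_add_two]; simp⟩)
      · exact Or.inr (Or.inr ⟨e, by rw [Q_add_two]; simp⟩)
  · intro h
    have := h.image (fun z => (z.1 + 16, z.2 + 16)) (by intros; simp only; omega)
      (by intros; simp only; omega)
    convert this using 1
    ext z
    simp only [Set.mem_image]
    constructor
    · rintro (⟨j, h1, h2, rfl⟩ | ⟨e, rfl⟩ | ⟨e, rfl⟩)
      · obtain ⟨i, rfl⟩ : ∃ i, j = i + 2 := ⟨j - 2, by omega⟩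
        exact ⟨P i, P_mem_F (by omega) (by omega), by rw [P_add_two]⟩
      · exact ⟨Q lo, Or.inr (Or.inl ⟨e, rfl⟩), by rw [Q_add_two]⟩
      · exact ⟨Q hi, Or.inr (Or.inr ⟨e, rfl⟩), by rw [Q_add_two]⟩
    · rintro ⟨_, ⟨j, h1, h2, rfl⟩ | ⟨e, rfl⟩ | ⟨e, rfl⟩, rfl⟩
      · exact Or.inl ⟨j + 2, by omega, by omega, by rw [P_add_two]⟩
      · exact Or.inr (Or.inl ⟨e, by rw [Q_add_two]⟩)
      · exact Or.inr (Or.inr ⟨e, by rw [Q_add_two]⟩)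

/-- Replacing the point `x` of a point set by a point `y` in the same relative position. -/
theorem Plots.replace {π : Perm} {s : Set (ℤ × ℤ)} {x y : ℤ × ℤ} (h : Plots π (insert x s))
    (hxs : x ∉ s)
    (hxy : ∀ z ∈ s, (x.1 < z.1 → y.1 < z.1) ∧ (z.1 < x.1 → z.1 < y.1) ∧
      (x.2 < z.2 → y.2 < z.2) ∧ (z.2 < x.2 → z.2 < y.2)) : Plots π (insert y s) := by
  classical
  have hne : ∀ z ∈ s, z ≠ x := fun z hz e => hxs (e ▸ hz)
  have key := h.image (fun z => if z = x then y else z) ?_ ?_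
  · convert key using 1
    rw [Set.image_insert_eq, if_pos rfl]
    congr 1
    ext z
    simp only [Set.mem_image]
    constructor
    · intro hz
      exact ⟨z, hz, if_neg (hne z hz)⟩
    · rintro ⟨w, hw, rfl⟩
      rw [if_neg (hne w hw)]
      exact hw
  · rintro z (rfl | hz) w (rfl | hw) hzw
    · exact absurd hzw (lt_irrefl _)
    · rw [if_pos rfl, if_neg (hne w hw)]
      exact (hxy w hw).1 hzw
    · rw [if_pos rfl, if_neg (hne z hz)]
      exact (hxy z hz).2.1 hzw
    · rw [if_neg (hne w hw), if_neg (hne z hz)]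
      exact hzw
  · rintro z (rfl | hz) w (rfl | hw) hzw
    · exact absurd hzw (lt_irrefl _)
    · rw [if_pos rfl, if_neg (hne w hw)]
      exact (hxy w hw).2.2.1 hzw
    · rw [if_pos rfl, if_neg (hne z hz)]
      exact (hxy z hz).2.2.2 hzw
    · rw [if_neg (hne w hw), if_neg (hne z hz)]
      exact hzw

/-! ### One-point deletions of forked intervals -/

theorem P_mem_F_iff {lo hi j : ℕ} {l r : Bool} : P j ∈ F lo hi l r ↔ lo ≤ j ∧ j ≤ hi := by
  constructor
  · rintro (⟨i, h1, h2, e⟩ | ⟨-, e⟩ | ⟨-, e⟩)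
    · rw [P_injective e]; exact ⟨h1, h2⟩
    · exact absurd e (P_ne_Q _ _)
    · exact absurd e (P_ne_Q _ _)
  · rintro ⟨h1, h2⟩; exact P_mem_F h1 h2

theorem Q_mem_F_iff {lo hi j : ℕ} {l r : Bool} :
    Q j ∈ F lo hi l r ↔ (l = true ∧ j = lo) ∨ (r = true ∧ j = hi) := by
  constructor
  · rintro (⟨i, h1, h2, e⟩ | ⟨h, e⟩ | ⟨h, e⟩)
    · exact absurd e.symm (P_ne_Q _ _)
    · exact Or.inl ⟨h, Q_injective e⟩
    · exact Or.inr ⟨h, Q_injective e⟩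
  · rintro (⟨h, rfl⟩ | ⟨h, rfl⟩)
    · exact Or.inr (Or.inl ⟨h, rfl⟩)
    · exact Or.inr (Or.inr ⟨h, rfl⟩)

theorem insert_diff_self {x : ℤ × ℤ} {s : Set (ℤ × ℤ)} (h : x ∉ s) : insert x s \ {x} = s := by
  rw [Set.insert_sdiff_of_mem _ (Set.mem_singleton x), Set.sdiff_singleton_eq_self h]

/-- No coordinate of the remaining points separates `P lo` from its twin, so deleting either one
leaves the same pattern. -/
theorem plots_untwin_left {π : Perm} {lo hi : ℕ} {r : Bool} (hlo : lo % 2 = 0) (hlt : lo < hi)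
    (hr : r = true → hi % 2 = 0) (h : Plots π (insert (Q lo) (F (lo + 1) hi false r))) :
    Plots π (F lo hi false r) := by
  rw [F_eq_insert_P_left hlt.le]
  refine h.replace (by rw [Q_mem_F_iff]; simp; omega) ?_
  rintro z (⟨j, h1, h2, rfl⟩ | ⟨e, -⟩ | ⟨e, rfl⟩)
  · simp only [P, Q]; rw [if_pos hlo]
    split_ifs <;> simp only <;> omega
  · cases e
  · have := hr e
    simp only [P, Q]; rw [if_pos hlo]; simp only; omega

theorem plots_untwin_right {π : Perm} {lo hi : ℕ} {l : Bool} (hhi : (hi + 1) % 2 = 0) (hlt : lo ≤ hi)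
    (hl : l = true → lo % 2 = 0) (h : Plots π (insert (Q (hi + 1)) (F lo hi l false))) :
    Plots π (F lo (hi + 1) l false) := by
  rw [F_eq_insert_P_right (by omega)]
  refine h.replace (by rw [Q_mem_F_iff]; simp; omega) ?_
  rintro z (⟨j, h1, h2, rfl⟩ | ⟨e, rfl⟩ | ⟨e, -⟩)
  · simp only [P, Q]; rw [if_pos hhi]
    split_ifs <;> simp only <;> omega
  · have := hl e
    simp only [P, Q]; rw [if_pos hhi]; simp only; omega
  · cases e

/-- An inner path point is a cut vertex: once it is gone, no edge joins coordinate sums below `16 *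
j` to larger ones. -/
theorem not_linked_F_diff {lo hi j : ℕ} {l r : Bool} (hl : l = true → lo % 2 = 0)
    (hr : r = true → hi % 2 = 0) (h1 : lo < j) (h2 : j < hi) :
    ¬ Linked (F lo hi l r \ {P j}) := by
  intro h
  have := h.2 (fun z => z.1 + z.2 < 16 * j) ?_ (P lo)
    ⟨P_mem_F le_rfl (by omega), fun e => by have := P_injective e; omega⟩ (P hi)
    ⟨P_mem_F (by omega) le_rfl, fun e => by have := P_injective e; omega⟩
    (by simp only [P_add]; omega)
  · simp only [P_add] at this; omega
  · rintro z ⟨hz, hzj⟩ w ⟨hw, hwj⟩ hzw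
    obtain ⟨t, rfl, ht1, ht2, h⟩ := NW_F hl hr (Or.inl (h1.trans h2)) hz hw hzw
    have hj1 : j ≠ 2 * t + 1 := fun e => hwj (by rw [e]; rfl)
    simp only [P_add]
    rcases h with ⟨rfl, -⟩ | ⟨rfl, -⟩ | ⟨e, rfl, rfl⟩ | ⟨e, rfl, rfl⟩
    · have hj2 : j ≠ 2 * t := fun e => hzj (by rw [e]; rfl)
      simp only [P_add]; omega
    · have hj2 : j ≠ 2 * t + 2 := fun e => hzj (by rw [e]; rfl)
      simp only [P_add]; omega
    · simp only [Q]; omega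
    · simp only [Q]; omega

/-- Only the ends can be deleted without disconnecting: a forked end loses its fork, a plain end
loses its last point. -/
theorem plots_F_diff {π : Perm} {lo hi : ℕ} {l r : Bool} {x : ℤ × ℤ} (hl : l = true → lo % 2 = 0)
    (hr : r = true → hi % 2 = 0) (hlt : lo < hi) (hx : x ∈ F lo hi l r)
    (hlink : Linked (F lo hi l r \ {x})) (hπ : Plots π (F lo hi l r \ {x})) :
    (l = true ∧ Plots π (F lo hi false r)) ∨ (l = false ∧ Plots π (F (lo + 1) hi false r)) ∨
    (r = true ∧ Plots π (F lo hi l false)) ∨ (r = false ∧ Plots π (F lo (hi - 1) l false)) := by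
  rcases hx with ⟨j, h1, h2, rfl⟩ | ⟨rfl, rfl⟩ | ⟨rfl, rfl⟩
  · rcases Nat.eq_or_lt_of_le h1 with rfl | h1
    · cases l with
      | true =>
        refine Or.inl ⟨rfl, plots_untwin_left (hl rfl) hlt hr ?_⟩
        rwa [F_eq_insert_left, F_eq_insert_P_left h2, Set.insert_comm, insert_diff_self] at hπ
        rintro (e | e)
        · exact P_ne_Q _ _ e
        · rw [P_mem_F_iff] at e; omega
      | false =>
        refine Or.inr (Or.inl ⟨rfl, ?_⟩)
        rwa [F_eq_insert_P_left h2, insert_diff_self] at hπ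
        rw [P_mem_F_iff]; omega
    rcases Nat.eq_or_lt_of_le h2 with rfl | h2
    · obtain ⟨hi, rfl⟩ : ∃ h, j = h + 1 := ⟨j - 1, by omega⟩
      cases r with
      | true =>
        refine Or.inr (Or.inr (Or.inl ⟨rfl, plots_untwin_right (hr rfl) (by omega) hl ?_⟩))
        rwa [F_eq_insert_right, F_eq_insert_P_right (by omega), Set.insert_comm, insert_diff_self] at hπ
        rintro (e | e)
        · exact P_ne_Q _ _ e
        · rw [P_mem_F_iff] at e; omega
      | false =>
        refine Or.inr (Or.inr (Or.inr ⟨rfl, ?_⟩))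
        rwa [F_eq_insert_P_right (by omega), insert_diff_self] at hπ
        rw [P_mem_F_iff]; omega
    · exact absurd hlink (not_linked_F_diff hl hr h1 h2)
  · refine Or.inl ⟨rfl, ?_⟩
    rwa [F_eq_insert_left, insert_diff_self] at hπ
    rw [Q_mem_F_iff]; simp; omega
  · refine Or.inr (Or.inr (Or.inl ⟨rfl, ?_⟩))
    rwa [F_eq_insert_right, insert_diff_self] at hπ
    rw [Q_mem_F_iff]; simp; omega

/-- This and the next three lemmas record the coincidences between families in small lengths; they
account for the thresholds in `Valid`. -/
theorem plots_F_one_one {π : Perm} (h : Plots π (F 1 1 false false)) :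
    Plots π (F 0 0 false false) := by
  rw [F_self] at h ⊢
  rw [← insert_empty_eq] at h ⊢
  exact h.replace (by simp) (by simp)

theorem F_zero_one : F 0 1 false false = insert (P 0) {P 1} := by
  rw [F_eq_insert_P_left (by omega), F_self]

theorem plots_F_one_two {π : Perm} (h : Plots π (F 1 2 false false)) :
    Plots π (F 0 1 false false) := by
  rw [F_eq_insert_P_right (by omega), F_self] at h
  rw [F_zero_one]
  refine h.replace (by simp [P]) ?_
  rintro z rfl
  simp [P]

theorem plots_F_zero_one_fork {π : Perm} (h : Plots π (F 0 1 true false)) :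
    Plots π (F 0 2 false false) := by
  rw [F_eq_insert_left] at h
  rw [F_eq_insert_P_right (by omega)]
  refine h.replace (by simp [Q_mem_F_iff]) ?_
  rw [F_zero_one]
  rintro z (rfl | rfl) <;> simp [P, Q]

theorem plots_F_zero_two_fork {π : Perm} (h : Plots π (F 0 2 false true)) :
    Plots π (F 0 2 true false) := by
  rw [F_eq_insert_right, F_eq_insert_P_right (by omega), Set.insert_comm] at h
  rw [F_eq_insert_left, F_eq_insert_P_right (by omega)]
  have hP : P 2 ∉ insert (Q 2) (F 0 1 false false) := by
    rintro (e | e)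
    · exact P_ne_Q _ _ e
    · rw [P_mem_F_iff] at e; omega
  have h1 := h.replace (y := Q 0) hP (by
    rw [F_zero_one]
    rintro z (rfl | rfl | rfl) <;> simp [P, Q])
  rw [Set.insert_comm] at h1 ⊢
  refine h1.replace ?_ ?_
  · rintro (e | e)
    · have := Q_injective e; omega
    · rw [Q_mem_F_iff] at e; simp at e
  · rw [F_zero_one]
    rintro z (rfl | rfl | rfl) <;> simp [P, Q]

/-! ### The five families of trees -/

/-- The five families: paths starting at an upper or a lower point, paths forked at the left or
at the right, and paths forked at both ends. -/
def fig (k n : ℕ) : Set (ℤ × ℤ) :=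
  if k = 0 then F 0 (n - 1) false false
  else if k = 1 then F 1 n false false
  else if k = 2 then F 0 (n - 2) true false
  -- Only an even end has a twin here, so the parity of the left end is adjusted to make the right
  -- end even.
  else if k = 3 then F (n % 2) (n - 2 + n % 2) false true
  else F 0 (n - 3) true true

/-- The lengths for which `fig k n` is used. -/
def Valid (k n : ℕ) : Prop :=
  -- Each family enters at the length from which it differs from the earlier ones.
  (k = 0 ∧ 1 ≤ n) ∨ (k = 1 ∧ 3 ≤ n) ∨ (k = 2 ∧ 4 ≤ n) ∨ (k = 3 ∧ 5 ≤ n) ∨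
    (k = 4 ∧ 5 ≤ n ∧ n % 2 = 1)

theorem fig_zero (n : ℕ) : fig 0 n = F 0 (n - 1) false false := rfl
theorem fig_one (n : ℕ) : fig 1 n = F 1 n false false := rfl
theorem fig_two (n : ℕ) : fig 2 n = F 0 (n - 2) true false := rfl
theorem fig_three (n : ℕ) : fig 3 n = F (n % 2) (n - 2 + n % 2) false true := rfl
theorem fig_four (n : ℕ) : fig 4 n = F 0 (n - 3) true true := rfl

theorem Valid.linked {k n : ℕ} (h : Valid k n) : Linked (fig k n) := by
  rcases h with ⟨rfl, h⟩ | ⟨rfl, h⟩ | ⟨rfl, h⟩ | ⟨rfl, h⟩ | ⟨rfl, h, h'⟩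
  · exact linked_F (by omega) (by simp) (by simp)
  · exact linked_F (by omega) (by simp) (by simp)
  · exact linked_F (by omega) (by simp; omega) (by simp)
  · exact linked_F (by omega) (by simp) (by simp; omega)
  · exact linked_F (by omega) (by simp; omega) (by simp; omega)

theorem Valid.ncard {k n : ℕ} (h : Valid k n) : (fig k n).ncard = n := by
  rcases h with ⟨rfl, h⟩ | ⟨rfl, h⟩ | ⟨rfl, h⟩ | ⟨rfl, h⟩ | ⟨rfl, h, h'⟩
  · rw [fig_zero, ncard_F (Or.inr ⟨rfl, rfl⟩)]; simp; omega
  · rw [fig_one, ncard_F (Or.inr ⟨rfl, rfl⟩)]; simp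
  · rw [fig_two, ncard_F (Or.inl (by omega))]; simp; omega
  · rw [fig_three, ncard_F (Or.inl (by omega))]; simp; omega
  · rw [fig_four, ncard_F (Or.inl (by omega))]; simp; omega

theorem Valid.exists_plots {k n : ℕ} (h : Valid k n) : ∃ π : Equiv.Perm (Fin n), Plots ⟨n, π⟩ (fig k n) := by
  have hgen : Generic (fig k n) := by
    rcases h with ⟨rfl, h⟩ | ⟨rfl, h⟩ | ⟨rfl, h⟩ | ⟨rfl, h⟩ | ⟨rfl, h, h'⟩
    · exact generic_F (by simp) (by simp)
    · exact generic_F (by simp) (by simp)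
    · exact generic_F (by simp) (by simp)
    · exact generic_F (by simp) (by simp; omega)
    · exact generic_F (by simp) (by simp; omega)
  have hfin : (fig k n).Finite := by
    unfold fig
    split_ifs <;> exact F_finite _ _ _ _
  obtain ⟨⟨m, π⟩, hπ⟩ := PermClasses.exists_plots hfin hgen
  have := hπ.ncard
  rw [h.ncard] at this
  simp only at this
  subst this
  exact ⟨π, hπ⟩

/-- One-point deletions within the five families. -/
theorem Valid.delete {k n : ℕ} (h : Valid k n) (hn : 2 ≤ n) {π : Perm} {x : ℤ × ℤ} (hx : x ∈ fig k n)
    (hlink : Linked (fig k n \ {x})) (hπ : Plots π (fig k n \ {x})) :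
    ∃ k', Valid k' (n - 1) ∧ k' ≤ max 1 k ∧ k' ≤ 3 ∧ Plots π (fig k' (n - 1)) := by
  have mk : ∀ k' lo hi l r, Plots π (F lo hi l r) → k' ≤ max 1 k → k' ≤ 3 → Valid k' (n - 1) →
      fig k' (n - 1) = F lo hi l r →
      ∃ k', Valid k' (n - 1) ∧ k' ≤ max 1 k ∧ k' ≤ 3 ∧ Plots π (fig k' (n - 1)) :=
    fun k' lo hi l r h1 h2 h3 h4 h5 => ⟨k', h4, h2, h3, h5 ▸ h1⟩
  have hB : Plots π (F 1 (n - 1) false false) →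
      ∃ k', Valid k' (n - 1) ∧ k' ≤ max 1 k ∧ k' ≤ 3 ∧ Plots π (fig k' (n - 1)) := by
    intro h
    by_cases h2 : n = 2
    · subst h2
      exact mk 0 0 0 false false (plots_F_one_one h) (by omega) (by omega)
        (Or.inl ⟨rfl, by omega⟩) rfl
    by_cases h3 : n = 3
    · subst h3
      exact mk 0 0 1 false false (plots_F_one_two h) (by omega) (by omega)
        (Or.inl ⟨rfl, by omega⟩) rfl
    exact mk 1 _ _ _ _ h (by omega) (by omega) (Or.inr (Or.inl ⟨rfl, by omega⟩)) rfl
  rcases h with ⟨rfl, h⟩ | ⟨rfl, h⟩ | ⟨rfl, h⟩ | ⟨rfl, h⟩ | ⟨rfl, h, h'⟩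
  · rcases plots_F_diff (by simp) (by simp) (by omega) hx hlink hπ with
      ⟨e, -⟩ | ⟨-, h1⟩ | ⟨e, -⟩ | ⟨-, h1⟩
    · cases e
    · exact hB h1
    · cases e
    · exact mk 0 _ _ _ _ h1 (by omega) (by omega) (Or.inl ⟨rfl, by omega⟩) rfl
  · rcases plots_F_diff (by simp) (by simp) (by omega) hx hlink hπ with
      ⟨e, -⟩ | ⟨-, h1⟩ | ⟨e, -⟩ | ⟨-, h1⟩
    · cases e
    · obtain ⟨m, rfl⟩ : ∃ m, n = m + 2 := ⟨n - 2, by omega⟩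
      exact mk 0 _ _ _ _ (plots_F_add_two.1 h1) (by omega) (by omega) (Or.inl ⟨rfl, by omega⟩) rfl
    · cases e
    · exact hB h1
  · rcases plots_F_diff (by simp) (by simp) (by omega) hx hlink hπ with
      ⟨-, h1⟩ | ⟨e, -⟩ | ⟨e, -⟩ | ⟨-, h1⟩
    · exact mk 0 _ _ _ _ h1 (by omega) (by omega) (Or.inl ⟨rfl, by omega⟩) rfl
    · cases e
    · cases e
    · by_cases h4 : n = 4
      · subst h4
        exact mk 0 _ _ _ _ (plots_F_zero_one_fork h1) (by omega) (by omega)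
          (Or.inl ⟨rfl, by omega⟩) rfl
      · exact mk 2 _ _ _ _ h1 (by omega) (by omega) (Or.inr (Or.inr (Or.inl ⟨rfl, by omega⟩)))
          (by rw [fig_two]; congr 1)
  · rcases plots_F_diff (by simp) (by simp; omega) (by omega) hx hlink hπ with
      ⟨e, -⟩ | ⟨-, h1⟩ | ⟨-, h1⟩ | ⟨e, -⟩
    · cases e
    · rcases Nat.mod_two_eq_zero_or_one n with h2 | h2
      · rw [h2] at h1
        refine mk 3 _ _ _ _ h1 (by omega) (by omega)
          (Or.inr (Or.inr (Or.inr (Or.inl ⟨rfl, by omega⟩)))) ?_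
        rw [fig_three]; congr 1 <;> omega
      · rw [h2] at h1
        obtain ⟨m, rfl⟩ : ∃ m, n = m + 5 := ⟨n - 5, by omega⟩
        -- The interval now starts at 2 and is shifted back to 0. If only four points remain, they
        -- form a star, which is counted in family 2.
        have h3 := plots_F_add_two (lo := 0) (hi := m + 2).1 h1
        by_cases h5 : m = 0
        · subst h5
          exact mk 2 _ _ _ _ (plots_F_zero_two_fork h3) (by omega) (by omega)
            (Or.inr (Or.inr (Or.inl ⟨rfl, by omega⟩))) rfl
        · refine mk 3 _ _ _ _ h3 (by omega) (by omega)
            (Or.inr (Or.inr (Or.inr (Or.inl ⟨rfl, by omega⟩)))) ?_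
          rw [fig_three]; congr 1 <;> omega
    · rcases Nat.mod_two_eq_zero_or_one n with h2 | h2
      · rw [h2] at h1
        exact mk 0 _ _ _ _ h1 (by omega) (by omega) (Or.inl ⟨rfl, by omega⟩) rfl
      · rw [h2] at h1
        refine mk 1 _ _ _ _ h1 (by omega) (by omega) (Or.inr (Or.inl ⟨rfl, by omega⟩)) ?_
        rw [fig_one]; congr 1; omega
    · cases e
  · rcases plots_F_diff (by simp) (by simp; omega) (by omega) hx hlink hπ with
      ⟨-, h1⟩ | ⟨e, -⟩ | ⟨-, h1⟩ | ⟨e, -⟩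
    · by_cases h5 : n = 5
      · subst h5
        exact mk 2 _ _ _ _ (plots_F_zero_two_fork h1) (by omega) (by omega)
          (Or.inr (Or.inr (Or.inl ⟨rfl, by omega⟩))) rfl
      · refine mk 3 _ _ _ _ h1 (by omega) (by omega)
          (Or.inr (Or.inr (Or.inr (Or.inl ⟨rfl, by omega⟩)))) ?_
        rw [fig_three]; congr 1 <;> omega
    · cases e
    · refine mk 2 _ _ _ _ h1 (by omega) (by omega) (Or.inr (Or.inr (Or.inl ⟨rfl, by omega⟩))) ?_
      rw [fig_two]; congr 1
    · cases e

/-! ### The five families are disjoint -/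

/-- Point sets with the same pattern are order isomorphic in both coordinates, so properties
expressed by comparisons can tell patterns apart. -/
theorem Plots.transfer {π : Perm} {s t : Set (ℤ × ℤ)} (h : Plots π s) (h' : Plots π t) :
    ∃ φ : ℤ × ℤ → ℤ × ℤ, (∀ z ∈ s, φ z ∈ t) ∧ (∀ w ∈ t, ∃ z ∈ s, φ z = w) ∧
      ∀ z ∈ s, ∀ w ∈ s, (z.1 < w.1 ↔ (φ z).1 < (φ w).1) ∧ (z.2 < w.2 ↔ (φ z).2 < (φ w).2) := by
  classical
  obtain ⟨f, rfl, hf⟩ := h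
  obtain ⟨g, rfl, hg⟩ := h'
  have hinj := injective_of_lt_iff fun a b => (hf a b).1
  let φ : ℤ × ℤ → ℤ × ℤ := fun z => if h : ∃ a, f a = z then g h.choose else z
  have hφ : ∀ a, φ (f a) = g a := fun a => by
    have : ∃ b, f b = f a := ⟨a, rfl⟩
    simp only [φ, dif_pos this]
    rw [hinj this.choose_spec]
  refine ⟨φ, ?_, ?_, ?_⟩
  · rintro _ ⟨a, rfl⟩; exact ⟨a, (hφ a).symm⟩
  · rintro _ ⟨a, rfl⟩; exact ⟨_, ⟨a, rfl⟩, hφ a⟩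
  · rintro _ ⟨a, rfl⟩ _ ⟨b, rfl⟩
    rw [hφ, hφ]
    exact ⟨(hf a b).1.symm.trans (hg a b).1, (hf a b).2.symm.trans (hg a b).2⟩

/-- There is a fork at the lower left end. -/
def ForkLow (s : Set (ℤ × ℤ)) : Prop :=
  ∃ u ∈ s, ∃ w ∈ s, ∃ c ∈ s, NW u c ∧ NW w c ∧ u.1 < w.1 ∧ u.2 < w.2 ∧
    ∀ z ∈ s, z ≠ u → z ≠ w → z ≠ c → w.1 < z.1 ∧ w.2 < z.2

/-- There is a fork at the upper right end. -/
def ForkHigh (s : Set (ℤ × ℤ)) : Prop :=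
  ∃ u ∈ s, ∃ w ∈ s, ∃ c ∈ s, NW u c ∧ NW w c ∧ u.1 < w.1 ∧ u.2 < w.2 ∧
    ∀ z ∈ s, z ≠ u → z ≠ w → z ≠ c → z.1 < u.1 ∧ z.2 < u.2

/-- The leftmost point is a leaf. -/
def LeftLeaf (s : Set (ℤ × ℤ)) : Prop :=
  ∃ u ∈ s, ∃ c ∈ s, NW u c ∧ ∀ z ∈ s, z ≠ u → z ≠ c → u.1 < z.1 ∧ u.2 < z.2

theorem ForkLow.transfer {π : Perm} {s t : Set (ℤ × ℤ)} (h : Plots π s) (h' : Plots π t)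
    (hs : ForkLow s) : ForkLow t := by
  obtain ⟨φ, h1, h2, h3⟩ := h.transfer h'
  obtain ⟨u, hu, w, hw, c, hc, huc, hwc, a1, a2, h4⟩ := hs
  refine ⟨φ u, h1 u hu, φ w, h1 w hw, φ c, h1 c hc, ⟨(h3 u hu c hc).1.1 huc.1, (h3 c hc u hu).2.1 huc.2⟩,
    ⟨(h3 w hw c hc).1.1 hwc.1, (h3 c hc w hw).2.1 hwc.2⟩, (h3 u hu w hw).1.1 a1, (h3 u hu w hw).2.1 a2, ?_⟩
  intro z' hz'
  obtain ⟨z, hz, rfl⟩ := h2 z' hz'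
  intro b1 b2 b3
  have := h4 z hz (by rintro rfl; exact b1 rfl) (by rintro rfl; exact b2 rfl)
    (by rintro rfl; exact b3 rfl)
  exact ⟨(h3 w hw z hz).1.1 this.1, (h3 w hw z hz).2.1 this.2⟩

theorem ForkHigh.transfer {π : Perm} {s t : Set (ℤ × ℤ)} (h : Plots π s) (h' : Plots π t)
    (hs : ForkHigh s) : ForkHigh t := by
  obtain ⟨φ, h1, h2, h3⟩ := h.transfer h'
  obtain ⟨u, hu, w, hw, c, hc, huc, hwc, a1, a2, h4⟩ := hs
  refine ⟨φ u, h1 u hu, φ w, h1 w hw, φ c, h1 c hc, ⟨(h3 u hu c hc).1.1 huc.1, (h3 c hc u hu).2.1 huc.2⟩,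
    ⟨(h3 w hw c hc).1.1 hwc.1, (h3 c hc w hw).2.1 hwc.2⟩, (h3 u hu w hw).1.1 a1, (h3 u hu w hw).2.1 a2, ?_⟩
  intro z' hz'
  obtain ⟨z, hz, rfl⟩ := h2 z' hz'
  intro b1 b2 b3
  have := h4 z hz (by rintro rfl; exact b1 rfl) (by rintro rfl; exact b2 rfl)
    (by rintro rfl; exact b3 rfl)
  exact ⟨(h3 z hz u hu).1.1 this.1, (h3 z hz u hu).2.1 this.2⟩

theorem LeftLeaf.transfer {π : Perm} {s t : Set (ℤ × ℤ)} (h : Plots π s) (h' : Plots π t)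
    (hs : LeftLeaf s) : LeftLeaf t := by
  obtain ⟨φ, h1, h2, h3⟩ := h.transfer h'
  obtain ⟨u, hu, c, hc, huc, h4⟩ := hs
  refine ⟨φ u, h1 u hu, φ c, h1 c hc, ⟨(h3 u hu c hc).1.1 huc.1, (h3 c hc u hu).2.1 huc.2⟩, ?_⟩
  intro z' hz'
  obtain ⟨z, hz, rfl⟩ := h2 z' hz'
  intro b1 b3
  have := h4 z hz (by rintro rfl; exact b1 rfl) (by rintro rfl; exact b3 rfl)
  exact ⟨(h3 u hu z hz).1.1 this.1, (h3 u hu z hz).2.1 this.2⟩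

theorem forkLow_F {hi : ℕ} {r : Bool} (hr : r = true → hi % 2 = 0) (hhi : 2 ≤ hi) :
    ForkLow (F 0 hi true r) := by
  refine ⟨P 0, P_mem_F le_rfl (by omega), Q 0, Q_mem_F_left, P 1, P_mem_F (by omega) (by omega),
    by simp [NW, P], by simp [NW, P, Q], by simp [P, Q], by simp [P, Q], ?_⟩
  rintro z (⟨j, h1, h2, rfl⟩ | ⟨e, rfl⟩ | ⟨e, rfl⟩) b1 b2 b3
  · have : j ≠ 0 := by rintro rfl; exact b1 rfl
    have : j ≠ 1 := by rintro rfl; exact b3 rfl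
    simp only [P, Q]
    split_ifs <;> simp only <;> omega
  · exact absurd rfl b2
  · have := hr e
    simp only [Q]; omega

theorem forkHigh_F {lo hi : ℕ} {l : Bool} (hl : l = true → lo % 2 = 0) (hhi : hi % 2 = 0)
    (h : lo + 2 ≤ hi) : ForkHigh (F lo hi l true) := by
  obtain ⟨t, rfl⟩ : ∃ t, hi = 2 * t + 2 := ⟨hi / 2 - 1, by omega⟩
  refine ⟨P (2 * (t + 1)), P_mem_F (by omega) (by omega), Q (2 * (t + 1)), Q_mem_F_right,
    P (2 * t + 1), P_mem_F (by omega) (by omega), ?_, ?_, ?_, ?_, ?_⟩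
  · rw [P_even, P_odd]; constructor <;> simp only <;> omega
  · rw [Q_even, P_odd]; constructor <;> simp only <;> omega
  · rw [Q_even, P_even]; simp only; omega
  · rw [Q_even, P_even]; simp only; omega
  rintro z (⟨j, h1, h2, rfl⟩ | ⟨e, rfl⟩ | ⟨e, rfl⟩) b1 b2 b3
  · have : j ≠ 2 * t + 2 := by rintro rfl; exact b1 rfl
    have : j ≠ 2 * t + 1 := by rintro rfl; exact b3 rfl
    simp only [P_even]
    simp only [P]
    split_ifs <;> simp only <;> omega
  · have := hl e
    simp only [P_even]
    simp only [Q]; omega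
  · exact absurd rfl b2

/-- If the path has a point before the three of the supposed fork, it lies too low; otherwise the
fork consists of the first three path points and the fourth lies below the third. -/
theorem not_forkLow_F {lo hi : ℕ} {r : Bool} (hr : r = true → hi % 2 = 0) (h : lo + 3 ≤ hi) :
    ¬ ForkLow (F lo hi false r) := by
  rintro ⟨u, hu, w, hw, c, hc, huc, hwc, a1, a2, h4⟩
  obtain ⟨t, rfl, ht1, ht2, hu'⟩ := NW_F (by simp) hr (Or.inl (by omega)) hu hc huc
  obtain ⟨t', e, -, -, hw'⟩ := NW_F (by simp) hr (Or.inl (by omega)) hw hc hwc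
  have e := P_injective e
  obtain rfl : t = t' := by omega
  have hw2 : 16 * (t : ℤ) + 12 ≤ w.2 := by
    rcases hw' with ⟨rfl, -⟩ | ⟨rfl, -⟩ | ⟨e, -, -⟩ | ⟨-, rfl, rfl⟩
    · rw [P_even]
    · rw [show 2 * t + 2 = 2 * (t + 1) by ring, P_even]; simp only; omega
    · cases e
    · rw [show 2 * t + 2 = 2 * (t + 1) by ring, Q_even]; simp only; omega
  by_cases hlo : lo ≤ 2 * t - 1 ∧ 1 ≤ t
  · obtain ⟨t, rfl⟩ : ∃ s, t = s + 1 := ⟨t - 1, by omega⟩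
    have := h4 (P (2 * t + 1)) (P_mem_F (by omega) (by omega)) ?_ ?_ ?_
    · rw [P_odd] at this; simp only at this; omega
    · rintro rfl; rw [P_odd] at huc; rw [P_odd] at huc; have := huc.1; have := huc.2; simp only at *; omega
    · rintro rfl; rw [P_odd] at hw2; simp only at hw2; omega
    · intro e; have := P_injective e; omega
  · have hne : hi ≠ 2 * t + 2 := by omega
    have hx : u = P (2 * t) ∧ w = P (2 * t + 2) ∧ lo ≤ 2 * t := by
      rcases hu' with ⟨rfl, h5⟩ | ⟨rfl, -⟩ | ⟨e, -, -⟩ | ⟨-, e, -⟩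
      · rcases hw' with ⟨rfl, -⟩ | ⟨rfl, -⟩ | ⟨e, -, -⟩ | ⟨-, e, -⟩
        · omega
        · exact ⟨rfl, rfl, h5⟩
        · cases e
        · omega
      · rcases hw' with ⟨rfl, -⟩ | ⟨rfl, -⟩ | ⟨e, -, -⟩ | ⟨-, e, -⟩
        · rw [show 2 * t + 2 = 2 * (t + 1) by ring, P_even, P_even] at a1; simp only at a1; omega
        · omega
        · cases e
        · omega
      · cases e
      · omega
    obtain ⟨rfl, rfl, hlo'⟩ := hx
    have := h4 (P (2 * (t + 1) + 1)) (P_mem_F (by omega) (by omega))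
      (fun e => by have := P_injective e; omega) (fun e => by have := P_injective e; omega)
      (fun e => by have := P_injective e; omega)
    rw [show 2 * t + 2 = 2 * (t + 1) by ring, P_even, P_odd] at this
    simp only at this; omega

theorem not_forkHigh_F {lo hi : ℕ} {l : Bool} (hl : l = true → lo % 2 = 0) (h : lo + 3 ≤ hi) :
    ¬ ForkHigh (F lo hi l false) := by
  rintro ⟨u, hu, w, hw, c, hc, huc, hwc, a1, a2, h4⟩
  obtain ⟨t, rfl, ht1, ht2, hu'⟩ := NW_F hl (by simp) (Or.inl (by omega)) hu hc huc
  obtain ⟨t', e, -, -, hw'⟩ := NW_F hl (by simp) (Or.inl (by omega)) hw hc hwc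
  have e := P_injective e
  obtain rfl : t = t' := by omega
  have hu1 : u.1 ≤ 16 * (t : ℤ) + 4 := by
    rcases hu' with ⟨rfl, -⟩ | ⟨rfl, -⟩ | ⟨-, rfl, rfl⟩ | ⟨e, -, -⟩
    · rw [P_even]; simp only; omega
    · rw [show 2 * t + 2 = 2 * (t + 1) by ring, P_even]; simp only; omega
    · rw [Q_even]; simp only; omega
    · cases e
  have hu2 : 16 * (t : ℤ) + 12 ≤ u.2 := by
    rcases hu' with ⟨rfl, -⟩ | ⟨rfl, -⟩ | ⟨-, rfl, rfl⟩ | ⟨e, -, -⟩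
    · rw [P_even]
    · rw [show 2 * t + 2 = 2 * (t + 1) by ring, P_even]; simp only; omega
    · rw [Q_even]; simp only; omega
    · cases e
  have hw2 : w.2 ≤ 16 * (t : ℤ) + 28 ∧ w.1 ≤ 16 * (t : ℤ) + 4 := by
    rcases hw' with ⟨rfl, -⟩ | ⟨rfl, -⟩ | ⟨-, rfl, rfl⟩ | ⟨e, -, -⟩
    · rw [P_even]; simp only; omega
    · rw [show 2 * t + 2 = 2 * (t + 1) by ring, P_even]; simp only; omega
    · rw [Q_even]; simp only; omega
    · cases e
  by_cases hlo : 2 * t + 3 ≤ hi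
  · have := h4 (P (2 * (t + 1) + 1)) (P_mem_F (by omega) (by omega)) ?_ ?_ ?_
    · rw [P_odd] at this; simp only at this; omega
    · rintro rfl; rw [P_odd] at hu1; simp only at hu1; omega
    · rintro rfl; rw [P_odd] at hw2; simp only at hw2; omega
    · intro e; have := P_injective e; omega
  · have hlo2 : lo + 1 ≤ 2 * t := by omega
    have hx : u = P (2 * t) := by
      rcases hu' with ⟨rfl, h5⟩ | ⟨rfl, -⟩ | ⟨-, e, -⟩ | ⟨e, -, -⟩
      · rfl
      · rcases hw' with ⟨rfl, -⟩ | ⟨rfl, -⟩ | ⟨-, e, -⟩ | ⟨e, -, -⟩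
        · rw [show 2 * t + 2 = 2 * (t + 1) by ring, P_even, P_even] at a1; simp only at a1; omega
        · omega
        · omega
        · cases e
      · omega
      · cases e
    subst hx
    obtain ⟨t, rfl⟩ : ∃ s, t = s + 1 := ⟨t - 1, by omega⟩
    have := h4 (P (2 * t + 1)) (P_mem_F (by omega) (by omega))
      (fun e => by have := P_injective e; omega) ?_ (fun e => by have := P_injective e; omega)
    · rw [P_even, P_odd] at this
      simp only at this; omega
    · rintro rfl
      rw [P_even, P_odd] at a1; rw [P_odd, P_odd] at hwc
      have := hwc.1; have := hwc.2
      simp only at *; omega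

theorem leftLeaf_F {hi : ℕ} (h : 1 ≤ hi) : LeftLeaf (F 0 hi false false) := by
  refine ⟨P 0, P_mem_F le_rfl (by omega), P 1, P_mem_F (by omega) h, by simp [NW, P], ?_⟩
  rintro z (⟨j, h1, h2, rfl⟩ | ⟨e, -⟩ | ⟨e, -⟩) b1 b3
  · have : j ≠ 0 := by rintro rfl; exact b1 rfl
    have : j ≠ 1 := by rintro rfl; exact b3 rfl
    simp only [P]
    split_ifs <;> simp only <;> omega
  · cases e
  · cases e

theorem not_leftLeaf_F {hi : ℕ} (h : 3 ≤ hi) : ¬ LeftLeaf (F 1 hi false false) := by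
  rintro ⟨u, hu, c, hc, huc, h4⟩
  obtain ⟨t, rfl, ht1, ht2, hu'⟩ := NW_F (by simp) (by simp) (Or.inr rfl) hu hc huc
  rcases hu' with ⟨rfl, h5⟩ | ⟨rfl, -⟩ | ⟨e, -⟩ | ⟨e, -⟩
  · obtain ⟨t, rfl⟩ : ∃ s, t = s + 1 := ⟨t - 1, by omega⟩
    have := h4 (P (2 * t + 1)) (P_mem_F (by omega) (by omega))
      (fun e => by have := P_injective e; omega) (fun e => by have := P_injective e; omega)
    rw [P_even, P_odd] at this; simp only at this; omega
  · by_cases h1 : 2 * t + 3 ≤ hi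
    · have := h4 (P (2 * (t + 1) + 1)) (P_mem_F (by omega) (by omega))
        (fun e => by have := P_injective e; omega) (fun e => by have := P_injective e; omega)
      rw [show 2 * t + 2 = 2 * (t + 1) by ring, P_even, P_odd] at this; simp only at this; omega
    · have := h4 (P (2 * t)) (P_mem_F (by omega) (by omega))
        (fun e => by have := P_injective e; omega) (fun e => by have := P_injective e; omega)
      rw [show 2 * t + 2 = 2 * (t + 1) by ring, P_even, P_even] at this; simp only at this; omega
  · cases e
  · cases e

/-- A low fork marks families 2 and 4, a high fork families 3 and 4, and the leftmost point being a
leaf separates the two kinds of path. -/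
theorem Valid.eq_of_lt {k k' n : ℕ} (h : Valid k n) (h' : Valid k' n) (hlt : k < k') {π : Perm}
    (hπ : Plots π (fig k n)) (hπ' : Plots π (fig k' n)) : False := by
  have hfl : (k' = 2 ∨ k' = 4) → ForkLow (fig k' n) := by
    rintro (rfl | rfl)
    · rcases h' with ⟨e, -⟩ | ⟨e, -⟩ | ⟨-, h'⟩ | ⟨e, -⟩ | ⟨e, -⟩ <;> try omega
      exact forkLow_F (by simp) (by omega)
    · rcases h' with ⟨e, -⟩ | ⟨e, -⟩ | ⟨e, h'⟩ | ⟨e, -⟩ | ⟨e, h', h''⟩ <;> try omega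
      exact forkLow_F (by simp; omega) (by omega)
  have hnfl : (4 ≤ n ∧ k ≤ 1) ∨ (5 ≤ n ∧ k = 3) → ¬ ForkLow (fig k n) := by
    rintro (⟨h1, h2⟩ | ⟨h1, rfl⟩)
    · obtain rfl | rfl : k = 0 ∨ k = 1 := by omega
      · exact not_forkLow_F (by simp) (by omega)
      · exact not_forkLow_F (by simp) (by omega)
    · exact not_forkLow_F (by simp; omega) (by omega)
  have hfh : 3 ≤ k' → ForkHigh (fig k' n) := by
    intro h1
    rcases h' with ⟨e, -⟩ | ⟨e, -⟩ | ⟨e, h'⟩ | ⟨rfl, h'⟩ | ⟨rfl, h', h''⟩ <;> try omega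
    · exact forkHigh_F (by simp) (by omega) (by omega)
    · exact forkHigh_F (by simp) (by omega) (by omega)
  have hnfh : 5 ≤ n → k ≤ 2 → ¬ ForkHigh (fig k n) := by
    intro h1 h2
    obtain rfl | rfl | rfl : k = 0 ∨ k = 1 ∨ k = 2 := by omega
    · exact not_forkHigh_F (by simp) (by omega)
    · exact not_forkHigh_F (by simp) (by omega)
    · exact not_forkHigh_F (by simp) (by omega)
  have hk' : k' ≤ 4 := by unfold Valid at h'; omega
  have hn : 3 ≤ n ∧ (2 ≤ k' → 4 ≤ n) ∧ (3 ≤ k' → 5 ≤ n) := by unfold Valid at h'; omega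
  by_cases c1 : k' = 2 ∨ k' = 4
  · by_cases c2 : k = 2
    · exact hnfh (by omega) (by omega) (ForkHigh.transfer hπ' hπ (hfh (by omega)))
    · exact hnfl (by omega) (ForkLow.transfer hπ' hπ (hfl c1))
  · by_cases c2 : k' = 3
    · exact hnfh (by omega) (by omega) (ForkHigh.transfer hπ' hπ (hfh (by omega)))
    · obtain rfl : k = 0 := by omega
      obtain rfl : k' = 1 := by omega
      exact not_leftLeaf_F (by omega) (LeftLeaf.transfer hπ hπ' (leftLeaf_F (by omega)))

theorem Valid.eq_of_plots {k k' n : ℕ} (h : Valid k n) (h' : Valid k' n) {π : Perm}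
    (hπ : Plots π (fig k n)) (hπ' : Plots π (fig k' n)) : k = k' := by
  rcases lt_trichotomy k k' with hlt | e | hlt
  · exact (h.eq_of_lt h' hlt hπ hπ').elim
  · exact e
  · exact (h'.eq_of_lt h hlt hπ' hπ).elim

/-! ### The set of indecomposables prescribed by a sequence -/

/-- The first `s n` of the families at each length `n`. -/
def indecSet (s : ℕ → ℕ) : Set Perm :=
  {π | ∃ k, k < s π.1 ∧ Valid k π.1 ∧ Plots π (fig k π.1)}

theorem sumIndecomposable_of_mem_indecSet {s : ℕ → ℕ} {π : Perm} (h : π ∈ indecSet s) :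
    SumIndecomposable π := by
  obtain ⟨k, -, hv, hp⟩ := h
  exact hp.sumIndecomposable_iff.2 hv.linked

/-- The condition on `s` that makes `indecSet s` closed under indecomposable subpermutations. -/
def Closed (s : ℕ → ℕ) : Prop :=
  ∀ k n, 2 ≤ n → k < s n → Valid k n → ∀ k', Valid k' (n - 1) → k' ≤ max 1 k → k' ≤ 3 →
    k' < s (n - 1)

theorem Closed.mem_indecSet {s : ℕ → ℕ} (hs : Closed s) :
    ∀ π ∈ indecSet s, ∀ σ, SumIndecomposable σ → Contains π σ → σ ∈ indecSet s := by
  refine mem_of_contains (fun π => sumIndecomposable_of_mem_indecSet) ?_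
  rintro π ⟨k, hk, hv, hp⟩ σ hσ hc hlen
  obtain ⟨t, hts, ht⟩ := hp.exists_of_contains hc
  have h1 : 1 ≤ σ.1 := hσ.1
  obtain ⟨x, hx⟩ : ∃ x, fig k π.1 \ t = {x} := by
    rw [← Set.ncard_eq_one, Set.ncard_sdiff hts ht.finite, hv.ncard, ht.ncard]
    omega
  have hxm : x ∈ fig k π.1 := by
    have : x ∈ fig k π.1 \ t := by rw [hx]; rfl
    exact this.1
  have ht' : fig k π.1 \ {x} = t := by rw [← hx, Set.sdiff_sdiff_cancel_left hts]
  have hn : π.1 - 1 = σ.1 := by omega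
  obtain ⟨k', h2, h3, h4, h5⟩ := hv.delete (by omega) hxm (by rw [ht']; exact ht.sumIndecomposable_iff.1 hσ)
    (by rw [ht']; exact ht)
  have h6 := hs k π.1 (by omega) hk hv k' h2 h3 h4
  rw [hn] at h2 h5 h6
  exact ⟨k', h6, h2, h5⟩

theorem Closed.realizes {s : ℕ → ℕ} (hs : Closed s) (hv : ∀ n, 1 ≤ n → ∀ k < s n, Valid k n) :
    Realizes (sumClass (indecSet s)) s := by
  intro n hn
  have h1 : {π : Equiv.Perm (Fin n) | (⟨n, π⟩ : Perm) ∈ sumClass (indecSet s) ∧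
      SumIndecomposable ⟨n, π⟩} = {π | (⟨n, π⟩ : Perm) ∈ indecSet s} := by
    ext π
    constructor
    · rintro ⟨h, h'⟩; exact (mem_sumClass_iff hs.mem_indecSet h').1 h
    · intro h
      have h' := sumIndecomposable_of_mem_indecSet h
      exact ⟨(mem_sumClass_iff hs.mem_indecSet h').2 h, h'⟩
  unfold numIndecomposable
  rw [h1]
  have hex : ∀ k : Fin (s n), ∃ π : Equiv.Perm (Fin n), Plots ⟨n, π⟩ (fig k n) :=
    fun k => (hv n hn k k.2).exists_plots
  choose e he using hex
  have hinj : Function.Injective e := by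
    intro k k' hkk
    have h2 := he k'
    rw [← hkk] at h2
    exact Fin.ext ((hv n hn k k.2).eq_of_plots (hv n hn k' k'.2) (he k) h2)
  have hrange : {π : Equiv.Perm (Fin n) | (⟨n, π⟩ : Perm) ∈ indecSet s} = Set.range e := by
    ext π
    constructor
    · rintro ⟨k, hk, hv', hp⟩
      refine ⟨⟨k, hk⟩, ?_⟩
      have := (he ⟨k, hk⟩).unique hp
      simpa using this
    · rintro ⟨k, rfl⟩
      exact ⟨k, k.2, hv n hn k k.2, he k⟩
  rw [hrange, ← Set.image_univ, Set.ncard_image_of_injective _ hinj, Set.ncard_univ,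
    Nat.card_eq_fintype_card, Fintype.card_fin]

/-! ### Legal sequences -/

/-- The entry 5 sits at the odd index `2 * i + 5`, where a double fork exists. -/
theorem valid_of_dominates {i : ℕ} {s : ℕ → ℕ} (hdom : Dominates (boundSeq i) s) :
    ∀ n, 1 ≤ n → ∀ k < s n, Valid k n := by
  intro n hn k hk
  have := hdom n hn
  unfold boundSeq at this
  unfold Valid
  split_ifs at this <;> omega

theorem Legal.eq_zero_of_le {s : ℕ → ℕ} (h : Legal s) {n m : ℕ} (hn : 1 ≤ n) (h0 : s n = 0)
    (hm : n ≤ m) : s m = 0 := by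
  induction m, hm using Nat.le_induction with
  | base => exact h0
  | succ m hm ih => exact h.zero_step m (by omega) ih

/-- From length 3 on, an entry equal to 1 is the last nonzero one. -/
theorem Legal.eq_zero_of_eq_one {s : ℕ → ℕ} (h : Legal s) (hend : ¬ EndsInOneOne s) {n : ℕ}
    (hn : 3 ≤ n) (h1 : s n = 1) : s (n + 1) = 0 := by
  by_contra hne
  have h2 : ∀ m, n ≤ m → s m ≤ 1 := by
    intro m hm
    induction m, hm using Nat.le_induction with
    | base => omega
    | succ m hm ih => exact h.one_step m (by omega) ih
  by_cases hall : ∀ m, n ≤ m → s m = 1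
  · exact hend (Or.inr ⟨n, hall⟩)
  push Not at hall
  have hz : ∃ m, n ≤ m ∧ s m = 0 := by
    obtain ⟨m, hm, hm'⟩ := hall
    exact ⟨m, hm, by have := h2 m hm; omega⟩
  classical
  obtain ⟨hm1, hm2⟩ := Nat.find_spec hz
  have hmin : ∀ j, n ≤ j → j < Nat.find hz → s j = 1 := by
    intro j hj hlt
    have := Nat.find_min hz hlt
    have := h2 j hj
    have : s j ≠ 0 := fun e => Nat.find_min hz hlt ⟨hj, e⟩
    omega
  set m := Nat.find hz with hmdef
  have hmn : n + 2 ≤ m := by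
    have : m ≠ n := by intro e; rw [e] at hm2; omega
    have : m ≠ n + 1 := by intro e; rw [e] at hm2; omega
    omega
  refine hend (Or.inl ⟨m - 2, by omega, hmin _ (by omega) (by omega), hmin _ (by omega) (by omega), ?_⟩)
  intro j hj
  exact h.eq_zero_of_le (by omega) hm2 (by omega)

/-- Deletion never raises the family index, except that one kind of path yields both. So an entry 2
or 3 may only be followed by entries that are no larger, which is legality, and an entry 1 from
length 3 on must be followed by 0. The thresholds 3, 4, 5 of legality are the lengths at which
families 1, 2, 3 appear. -/
theorem Legal.closed {s : ℕ → ℕ} (h : Legal s) (hend : ¬ EndsInOneOne s) : Closed s := by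
  intro k n hn hk hv k' hv' h1 h2
  have hzero := h.zero_step (n - 1) (by omega)
  have hn1 : n - 1 + 1 = n := by omega
  rw [hn1] at hzero
  have hone : 4 ≤ n → s (n - 1) = 1 → s n = 0 := fun h3 h4 => by
    have := h.eq_zero_of_eq_one hend (n := n - 1) (by omega) h4
    rwa [hn1] at this
  have htwo := h.two_step (n - 1)
  have hthree := h.three_step (n - 1)
  rw [hn1] at htwo hthree
  have hk'n : (k' = 1 → 4 ≤ n) ∧ (k' = 2 → 5 ≤ n) ∧ (k' = 3 → 6 ≤ n) := by
    unfold Valid at hv'; omega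
  have hs0 : s (n - 1) ≠ 0 := fun e => by have := hzero e; omega
  have hs1 : 4 ≤ n → s (n - 1) ≠ 1 := fun h3 e => by have := hone h3 e; omega
  omega

/-! ### The antichain -/

/-- The point of the doubly forked path corresponding to position `j` of `mu k`. -/
def muPt (k j : ℕ) : ℤ × ℤ :=
  if j = 0 then P 0
  else if j = 1 then Q 0
  else if j = 2 * k + 4 then P (2 * k + 4)
  else if j = 2 * k + 5 then Q (2 * k + 4)
  else if j = 2 * k + 6 then P (2 * k + 3)
  else if j % 2 = 0 then P j
  else P (j - 2)

/-- Lists positions, coordinates and values as linear expressions, so that the order comparisons in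
`plots_mu` become pure arithmetic. -/
theorem muPt_spec (k j : ℕ) (hj : j < 2 * k + 7) :
    (j = 0 ∧ (muPt k j).1 = -12 ∧ (muPt k j).2 = 12 ∧ muFun k j = 1) ∨
    (j = 1 ∧ (muPt k j).1 = -10 ∧ (muPt k j).2 = 14 ∧ muFun k j = 2) ∨
    (j = 3 ∧ (muPt k j).1 = 8 ∧ (muPt k j).2 = 8 ∧ muFun k j = 0) ∨
    (j = 2 * k + 4 ∧ (muPt k j).1 = 16 * k + 20 ∧ (muPt k j).2 = 16 * k + 44 ∧
      muFun k j = 2 * k + 5) ∨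
    (j = 2 * k + 5 ∧ (muPt k j).1 = 16 * k + 22 ∧ (muPt k j).2 = 16 * k + 46 ∧
      muFun k j = 2 * k + 6) ∨
    (j = 2 * k + 6 ∧ (muPt k j).1 = 16 * k + 24 ∧ (muPt k j).2 = 16 * k + 24 ∧
      muFun k j = 2 * k + 3) ∨
    (2 ≤ j ∧ j ≤ 2 * k + 2 ∧ j % 2 = 0 ∧ (muPt k j).1 = 8 * j - 12 ∧ (muPt k j).2 = 8 * j + 12 ∧
      muFun k j = j + 2) ∨
    (5 ≤ j ∧ j ≤ 2 * k + 3 ∧ j % 2 = 1 ∧ (muPt k j).1 = 8 * j - 16 ∧ (muPt k j).2 = 8 * j - 16 ∧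
      muFun k j = j - 2) := by
  unfold muPt muFun
  have h1 : P (2 * k + 4) = (16 * (k : ℤ) + 20, 16 * (k : ℤ) + 44) := by
    rw [show 2 * k + 4 = 2 * (k + 2) by ring, P_even]; ext <;> push_cast <;> ring
  have h2 : Q (2 * k + 4) = (16 * (k : ℤ) + 22, 16 * (k : ℤ) + 46) := by
    rw [show 2 * k + 4 = 2 * (k + 2) by ring, Q_even]; ext <;> push_cast <;> ring
  have h3 : P (2 * k + 3) = (16 * (k : ℤ) + 24, 16 * (k : ℤ) + 24) := by
    rw [show 2 * k + 3 = 2 * (k + 1) + 1 by ring, P_odd]; ext <;> push_cast <;> ring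
  by_cases c0 : j = 0
  · subst c0; left; simp [P]
  by_cases c1 : j = 1
  · subst c1; right; left; simp [Q]
  by_cases c3 : j = 3
  · subst c3
    rw [if_neg c0, if_neg c1, if_neg (by omega), if_neg (by omega), if_neg (by omega), if_neg (by omega)]
    right; right; left; simp [P]
  simp only [if_neg c0, if_neg c1, if_neg c3]
  iterate 3 right
  by_cases c4 : j = 2 * k + 4
  · left; rw [if_pos c4, if_pos c4, h1]; exact ⟨c4, rfl, rfl, rfl⟩
  by_cases c5 : j = 2 * k + 5
  · right; left; rw [if_neg c4, if_neg c4, if_pos c5, if_pos c5, h2]; exact ⟨c5, rfl, rfl, rfl⟩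
  by_cases c6 : j = 2 * k + 6
  · right; right; left
    rw [if_neg c4, if_neg c4, if_neg c5, if_neg c5, if_pos c6, if_pos c6, h3]
    exact ⟨c6, rfl, rfl, rfl⟩
  simp only [if_neg c4, if_neg c5, if_neg c6]
  iterate 3 right
  clear h1 h2 h3
  rcases Nat.mod_two_eq_zero_or_one j with h | h
  · left
    rw [if_pos h, if_pos h]
    simp only [P]
    rw [if_pos h]
    exact ⟨by omega, by omega, h, rfl, rfl, trivial⟩
  · right
    rw [if_neg (by omega), if_neg (by omega)]
    simp only [P]
    rw [if_neg (by omega)]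
    exact ⟨by omega, by omega, h, by simp only; omega, by simp only; omega, trivial⟩

theorem plots_mu (k : ℕ) : Plots ⟨2 * k + 7, mu k⟩ (fig 4 (2 * k + 7)) := by
  rw [fig_four, show 2 * k + 7 - 3 = 2 * k + 4 by omega]
  have hex : ∀ z ∈ F 0 (2 * k + 4) true true, ∃ j, j < 2 * k + 7 ∧ muPt k j = z := by
    rintro z (⟨j, h1, h2, rfl⟩ | ⟨-, rfl⟩ | ⟨-, rfl⟩)
    · rcases Nat.mod_two_eq_zero_or_one j with h3 | h3
      · refine ⟨j, by omega, ?_⟩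
        unfold muPt
        by_cases c0 : j = 0
        · rw [if_pos c0, c0]
        by_cases c4 : j = 2 * k + 4
        · rw [if_neg c0, if_neg (by omega), if_pos c4, c4]
        · rw [if_neg c0, if_neg (by omega), if_neg c4, if_neg (by omega), if_neg (by omega), if_pos h3]
      · by_cases h4 : j = 2 * k + 3
        · refine ⟨2 * k + 6, by omega, ?_⟩
          unfold muPt
          rw [if_neg (by omega), if_neg (by omega), if_neg (by omega), if_neg (by omega), if_pos rfl, h4]
        · refine ⟨j + 2, by omega, ?_⟩
          unfold muPt
          rw [if_neg (by omega), if_neg (by omega), if_neg (by omega), if_neg (by omega),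
            if_neg (by omega), if_neg (by omega), Nat.add_sub_cancel]
    · exact ⟨1, by omega, by simp [muPt]⟩
    · refine ⟨2 * k + 5, by omega, ?_⟩
      unfold muPt
      rw [if_neg (by omega), if_neg (by omega), if_neg (by omega), if_pos rfl]
  refine Plots.of_mono (fun j => muPt k j.1) ?_ ?_ ?_
  · apply Set.Subset.antisymm
    · rintro _ ⟨⟨j, hj⟩, rfl⟩
      simp only at hj ⊢
      unfold muPt
      split_ifs
      · exact P_mem_F (by omega) (by omega)
      · exact Q_mem_F_left
      · exact P_mem_F (by omega) (by omega)
      · exact Q_mem_F_right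
      · exact P_mem_F (by omega) (by omega)
      · exact P_mem_F (by omega) (by omega)
      · exact P_mem_F (by omega) (by omega)
    · intro z hz
      obtain ⟨j, hj, rfl⟩ := hex z hz
      exact ⟨⟨j, hj⟩, rfl⟩
  · rintro ⟨a, ha⟩ ⟨b, hb⟩ hab
    simp only at ha hb
    simp only [Fin.mk_lt_mk] at hab
    simp only
    have h1 := muPt_spec k a ha
    have h2 := muPt_spec k b hb
    clear hex
    rcases h1 with h1 | h1 | h1 | h1 | h1 | h1 | h1 | h1 <;> omega
  · rintro ⟨a, ha⟩ ⟨b, hb⟩ hab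
    simp only at ha hb
    have hab : muFun k a < muFun k b := hab
    simp only
    have h1 := muPt_spec k a ha
    have h2 := muPt_spec k b hb
    clear hex
    rcases h1 with h1 | h1 | h1 | h1 | h1 | h1 | h1 | h1 <;> omega

theorem F_subset_fig {lo hi K : ℕ} {l r : Bool} (hl : l = true → lo = 0)
    (hr : r = true → hi = 2 * K + 4) (hK : hi ≤ 2 * K + 4) :
    F lo hi l r ⊆ fig 4 (2 * K + 7) := by
  rw [fig_four, show 2 * K + 7 - 3 = 2 * K + 4 by omega]
  rintro z (⟨j, h1, h2, rfl⟩ | ⟨e, rfl⟩ | ⟨e, rfl⟩)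
  · exact P_mem_F (by omega) (by omega)
  · rw [hl e]; exact Q_mem_F_left
  · rw [hr e]; exact Q_mem_F_right

/-- Families 0 to 3 sit inside a long enough double fork, and a double fork of length at least 7 is
itself in `Uo`. Only the star of length 5 is left over. -/
theorem indecSet_subset_downClosure {s : ℕ → ℕ} (h5 : s 5 ≤ 4) :
    indecSet s ⊆ downClosure Uo := by
  rintro π ⟨k, hk, hv, hp⟩
  have key : ∀ K, fig k π.1 ⊆ fig 4 (2 * K + 7) → π ∈ downClosure Uo := fun K h =>
    ⟨_, ⟨K, rfl⟩, (plots_mu K).contains hp h⟩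
  have h5' : π.1 = 5 → k ≠ 4 := by intro e; rw [e] at hk; omega
  rcases hv with ⟨rfl, h⟩ | ⟨rfl, h⟩ | ⟨rfl, h⟩ | ⟨rfl, h⟩ | ⟨rfl, h, h'⟩
  · exact key π.1 (F_subset_fig (by simp) (by simp) (by omega))
  · exact key π.1 (F_subset_fig (by simp) (by simp) (by omega))
  · exact key π.1 (F_subset_fig (by simp) (by simp) (by omega))
  -- A right fork must sit at the right end of the double fork, so `2 * K + 4` has to equal its last
  -- index.
  · exact key ((π.1 - 2 + π.1 % 2 - 4) / 2) (F_subset_fig (by simp) (by intro; omega) (by omega))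
  · refine key ((π.1 - 7) / 2) (Eq.subset ?_)
    congr 1
    omega

/-- Legal sequences below the bound that do not end in `1, 1` are realized. -/
theorem exists_realization {i : ℕ} {s : ℕ → ℕ} (hlegal : Legal s) (hdom : Dominates (boundSeq i) s)
    (hend : ¬ EndsInOneOne s) :
    Realizes (sumClass (indecSet s)) s ∧
      (s 5 ≤ 4 → sumClass (indecSet s) ⊆ sumClosure (downClosure Uo)) :=
  ⟨(hlegal.closed hend).realizes (valid_of_dominates hdom), fun h5 =>
    sumClass_subset_sumClosure ⟨_, 0, rfl⟩ (indecSet_subset_downClosure h5)⟩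

/-! ### Local obstructions -/

/-- The local obstructions avoided by paths and by paths forked at the lower left end. -/
structure Tame (X : Set (ℤ × ℤ)) : Prop where
  tri : ∀ u ∈ X, ∀ v ∈ X, ∀ w ∈ X, NW u v → NW v w → False
  square : ∀ u ∈ X, ∀ u' ∈ X, ∀ w ∈ X, ∀ w' ∈ X, u ≠ u' → w ≠ w' →
    NW u w → NW u w' → NW u' w → NW u' w' → False
  three : ∀ u ∈ X, ∀ w ∈ X, ∀ w' ∈ X, ∀ w'' ∈ X, w ≠ w' → w ≠ w'' → w' ≠ w'' →
    NW u w → NW u w' → NW u w'' → False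
  four : ∀ c ∈ X, ∀ u ∈ X, ∀ u' ∈ X, ∀ u'' ∈ X, ∀ v ∈ X, u ≠ u' → u ≠ u'' → u ≠ v → u' ≠ u'' →
    u' ≠ v → u'' ≠ v → NW u c → NW u' c → NW u'' c → NW v c → False
  -- This condition distinguishes the ends: at a lower left fork the two leftmost neighbours of the
  -- centre are leaves, whereas at the upper right end of a long path the leftmost neighbour
  -- continues the path.
  leaf : ∀ c ∈ X, ∀ u ∈ X, ∀ u' ∈ X, ∀ u'' ∈ X, ∀ d ∈ X, u.1 < u'.1 → u'.1 < u''.1 → d ≠ c →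
    NW u c → NW u' c → NW u'' c → NW u d ∨ NW u' d → False

theorem Tame.transfer {π : Perm} {s t : Set (ℤ × ℤ)} (h : Plots π s) (h' : Plots π t)
    (ht : Tame t) : Tame s := by
  obtain ⟨φ, h1, -, h3⟩ := h.transfer h'
  have hNW : ∀ z ∈ s, ∀ w ∈ s, NW z w → NW (φ z) (φ w) := fun z hz w hw hzw =>
    ⟨(h3 z hz w hw).1.1 hzw.1, (h3 w hw z hz).2.1 hzw.2⟩
  have hne : ∀ z ∈ s, ∀ w ∈ s, z ≠ w → φ z ≠ φ w := by
    intro z hz w hw hzw e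
    have a1 := h3 z hz w hw
    have a2 := h3 w hw z hz
    rw [e] at a1 a2
    simp only [lt_self_iff_false, iff_false, not_lt] at a1 a2
    exact hzw (Prod.ext (le_antisymm a2.1 a1.1) (le_antisymm a2.2 a1.2))
  refine ⟨?_, ?_, ?_, ?_, ?_⟩
  · intro u hu v hv w hw a b
    exact ht.tri _ (h1 u hu) _ (h1 v hv) _ (h1 w hw) (hNW _ hu _ hv a) (hNW _ hv _ hw b)
  · intro u hu u' hu' w hw w' hw' n1 n2 a b c d
    exact ht.square _ (h1 u hu) _ (h1 u' hu') _ (h1 w hw) _ (h1 w' hw') (hne _ hu _ hu' n1)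
      (hne _ hw _ hw' n2) (hNW _ hu _ hw a) (hNW _ hu _ hw' b) (hNW _ hu' _ hw c)
      (hNW _ hu' _ hw' d)
  · intro u hu w hw w' hw' w'' hw'' n1 n2 n3 a b c
    exact ht.three _ (h1 u hu) _ (h1 w hw) _ (h1 w' hw') _ (h1 w'' hw'') (hne _ hw _ hw' n1)
      (hne _ hw _ hw'' n2) (hne _ hw' _ hw'' n3) (hNW _ hu _ hw a) (hNW _ hu _ hw' b)
      (hNW _ hu _ hw'' c)
  · intro c hc u hu u' hu' u'' hu'' v hv n1 n2 n3 n4 n5 n6 a1 a2 a3 a4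
    exact ht.four _ (h1 c hc) _ (h1 u hu) _ (h1 u' hu') _ (h1 u'' hu'') _ (h1 v hv)
      (hne _ hu _ hu' n1) (hne _ hu _ hu'' n2) (hne _ hu _ hv n3) (hne _ hu' _ hu'' n4)
      (hne _ hu' _ hv n5) (hne _ hu'' _ hv n6) (hNW _ hu _ hc a1) (hNW _ hu' _ hc a2)
      (hNW _ hu'' _ hc a3) (hNW _ hv _ hc a4)
  · intro c hc u hu u' hu' u'' hu'' d hd n1 n2 n3 a1 a2 a3 a4
    exact ht.leaf _ (h1 c hc) _ (h1 u hu) _ (h1 u' hu') _ (h1 u'' hu'') _ (h1 d hd)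
      ((h3 u hu u' hu').1.1 n1) ((h3 u' hu' u'' hu'').1.1 n2) (hne _ hd _ hc n3)
      (hNW _ hu _ hc a1) (hNW _ hu' _ hc a2) (hNW _ hu'' _ hc a3)
      (a4.imp (hNW _ hu _ hd) (hNW _ hu' _ hd))

theorem P_spec (j : ℕ) : (j % 2 = 0 ∧ (P j).1 = 8 * j - 12 ∧ (P j).2 = 8 * j + 12) ∨
    (j % 2 = 1 ∧ (P j).1 = 8 * j ∧ (P j).2 = 8 * j) := by
  simp only [P]
  split_ifs with h
  · exact Or.inl ⟨h, rfl, rfl⟩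
  · exact Or.inr ⟨by omega, rfl, rfl⟩

theorem P_of_even {j : ℕ} (h : j % 2 = 0) : P j = (8 * (j : ℤ) - 12, 8 * (j : ℤ) + 12) := if_pos h

theorem P_of_odd {j : ℕ} (h : j % 2 = 1) : P j = (8 * (j : ℤ), 8 * (j : ℤ)) :=
  if_neg (by omega)

theorem Q_spec (j : ℕ) : (Q j).1 = 8 * j - 10 ∧ (Q j).2 = 8 * j + 14 := ⟨rfl, rfl⟩

theorem tame_F {lo hi : ℕ} {l : Bool} (hl : l = true → lo % 2 = 0) : Tame (F lo hi l false) := by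
  have key : ∀ {z w}, z ∈ F lo hi l false → w ∈ F lo hi l false → NW z w →
      ∃ t, w = P (2 * t + 1) ∧ lo ≤ 2 * t + 1 ∧
        (z = P (2 * t) ∨ z = P (2 * t + 2) ∨ (lo = 2 * t ∧ z = Q lo)) := by
    intro z w hz hw h
    obtain ⟨t, h1, h2, -, h3⟩ := NW_F hl (by simp) (Or.inr rfl) hz hw h
    refine ⟨t, h1, h2, ?_⟩
    rcases h3 with ⟨h, -⟩ | ⟨h, -⟩ | ⟨-, h⟩ | ⟨h, -⟩
    · exact Or.inl h
    · exact Or.inr (Or.inl h)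
    · exact Or.inr (Or.inr h)
    · cases h
  have key' : ∀ {t z w}, w ∈ F lo hi l false → z ∈ F lo hi l false → NW z w → w = P (2 * t + 1) →
      (z = P (2 * t) ∨ z = P (2 * t + 2) ∨ (lo = 2 * t ∧ z = Q lo)) := by
    intro t z w hw hz h e
    obtain ⟨t', e', -, h'⟩ := key hz hw h
    have := P_injective (e.symm.trans e')
    obtain rfl : t = t' := by omega
    exact h'
  refine ⟨?_, ?_, ?_, ?_, ?_⟩
  · intro u hu v hv w hw a b
    obtain ⟨t, rfl, -, -⟩ := key hu hv a
    obtain ⟨t', -, -, e | e | ⟨-, e⟩⟩ := key hv hw b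
    · have := P_injective e; omega
    · have := P_injective e; omega
    · exact P_ne_Q _ _ e
  · intro u hu u' hu' w hw w' hw' n1 n2 a b c d
    obtain ⟨t, rfl, -, h1⟩ := key hu hw a
    obtain ⟨t', rfl, -, h2⟩ := key hu hw' b
    have h3 := key' hw hu' c rfl
    have h4 := key' hw' hu' d rfl
    have ht : t ≠ t' := fun e => n2 (by rw [e])
    have aux : ∀ {z}, (z = P (2 * t) ∨ z = P (2 * t + 2) ∨ (lo = 2 * t ∧ z = Q lo)) →
        (z = P (2 * t') ∨ z = P (2 * t' + 2) ∨ (lo = 2 * t' ∧ z = Q lo)) →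
        (t' = t + 1 ∧ z = P (2 * t + 2)) ∨ (t = t' + 1 ∧ z = P (2 * t)) := by
      rintro z (rfl | rfl | ⟨e, rfl⟩) (h | h | ⟨h, h'⟩)
      · have := P_injective h; omega
      · have := P_injective h; right; exact ⟨by omega, rfl⟩
      · exact absurd h' (P_ne_Q _ _)
      · have := P_injective h; left; exact ⟨by omega, rfl⟩
      · have := P_injective h; omega
      · exact absurd h' (P_ne_Q _ _)
      · exact absurd h.symm (P_ne_Q _ _)
      · exact absurd h.symm (P_ne_Q _ _)
      · omega
    rcases aux h1 h2 with ⟨h5, rfl⟩ | ⟨h5, rfl⟩ <;> rcases aux h3 h4 with ⟨h6, rfl⟩ | ⟨h6, rfl⟩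
    · exact n1 rfl
    · omega
    · omega
    · exact n1 rfl
  · intro u hu w hw w' hw' w'' hw'' n1 n2 n3 a b c
    obtain ⟨t, rfl, -, h1⟩ := key hu hw a
    obtain ⟨t', rfl, -, h2⟩ := key hu hw' b
    obtain ⟨t'', rfl, -, h3⟩ := key hu hw'' c
    have ht : t ≠ t' := fun e => n1 (by rw [e])
    have ht' : t ≠ t'' := fun e => n2 (by rw [e])
    have ht'' : t' ≠ t'' := fun e => n3 (by rw [e])
    rcases h1 with rfl | rfl | ⟨e, rfl⟩
    · rcases h2 with h | h | ⟨-, h⟩ <;> rcases h3 with h' | h' | ⟨-, h'⟩ <;>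
        first
        | exact absurd h (P_ne_Q _ _)
        | exact absurd h' (P_ne_Q _ _)
        | (have := P_injective h; have := P_injective h'; omega)
    · rcases h2 with h | h | ⟨-, h⟩ <;> rcases h3 with h' | h' | ⟨-, h'⟩ <;>
        first
        | exact absurd h (P_ne_Q _ _)
        | exact absurd h' (P_ne_Q _ _)
        | (have := P_injective h; have := P_injective h'; omega)
    · rcases h2 with h | h | ⟨h, -⟩
      · exact absurd h.symm (P_ne_Q _ _)
      · exact absurd h.symm (P_ne_Q _ _)
      · omega
  · intro c hc u hu u' hu' u'' hu'' v hv n1 n2 n3 n4 n5 n6 a1 a2 a3 a4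
    obtain ⟨t, rfl, -, h1⟩ := key hu hc a1
    have h2 := key' hc hu' a2 rfl
    have h3 := key' hc hu'' a3 rfl
    have h4 := key' hc hv a4 rfl
    rcases h1 with rfl | rfl | ⟨-, rfl⟩ <;> rcases h2 with rfl | rfl | ⟨-, rfl⟩ <;>
      first
      | exact n1 rfl
      | (rcases h3 with rfl | rfl | ⟨-, rfl⟩ <;>
          first
          | exact n2 rfl
          | exact n4 rfl
          | (rcases h4 with rfl | rfl | ⟨-, rfl⟩ <;>
              first
              | exact n3 rfl
              | exact n5 rfl
              | exact n6 rfl))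
  · intro c hc u hu u' hu' u'' hu'' d hd n1 n2 n3 a1 a2 a3 a4
    obtain ⟨t, rfl, -, h1⟩ := key hu hc a1
    have h2 := key' hc hu' a2 rfl
    have h3 := key' hc hu'' a3 rfl
    have e1 := P_spec (2 * t)
    have e2 := P_spec (2 * t + 2)
    have e3 := Q_spec lo
    have h4 : lo = 2 * t ∧ u = P (2 * t) ∧ u' = Q lo := by
      rcases h1 with rfl | rfl | ⟨h1, rfl⟩ <;> rcases h2 with rfl | rfl | ⟨h2, rfl⟩ <;>
        rcases h3 with rfl | rfl | ⟨h3, rfl⟩ <;>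
        first
        | (exfalso; omega)
        | exact ⟨h2, rfl, rfl⟩
    obtain ⟨h4, rfl, rfl⟩ := h4
    rcases a4 with h | h
    · obtain ⟨t', rfl, h5, e | e | ⟨-, e⟩⟩ := key hu hd h
      · have := P_injective e
        obtain rfl : t = t' := by omega
        exact n3 rfl
      · have := P_injective e; omega
      · exact P_ne_Q _ _ e
    · obtain ⟨t', rfl, h5, e | e | ⟨e, -⟩⟩ := key hu' hd h
      · exact P_ne_Q _ _ e.symm
      · exact P_ne_Q _ _ e.symm
      · obtain rfl : t = t' := by omega
        exact n3 rfl

/-- Adjacency in the inversion graph. -/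
def Inv (z w : ℤ × ℤ) : Prop := NW z w ∨ NW w z

theorem Tame.no_triangle {X : Set (ℤ × ℤ)} (h : Tame X) {u v w : ℤ × ℤ} (hu : u ∈ X) (hv : v ∈ X)
    (hw : w ∈ X) (h1 : Inv u v) (h2 : Inv v w) (h3 : Inv u w) : False := by
  rcases h1 with a | a <;> rcases h2 with b | b <;> rcases h3 with c | c
  · exact h.tri _ hu _ hv _ hw a b
  · exact h.tri _ hu _ hv _ hw a b
  · exact h.tri _ hu _ hw _ hv c b
  · exact h.tri _ hw _ hu _ hv c a
  · exact h.tri _ hv _ hu _ hw a c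
  · exact h.tri _ hv _ hw _ hu b c
  · exact h.tri _ hv _ hu _ hw a c
  · exact h.tri _ hw _ hv _ hu b a

theorem Tame.no_square {X : Set (ℤ × ℤ)} (h : Tame X) {u u' w w' : ℤ × ℤ} (hu : u ∈ X)
    (hu' : u' ∈ X) (hw : w ∈ X) (hw' : w' ∈ X) (n1 : u ≠ u') (n2 : w ≠ w') (h1 : Inv u w)
    (h2 : Inv u w') (h3 : Inv u' w) (h4 : Inv u' w') : False := by
  rcases h1 with a | a <;> rcases h2 with b | b
  · rcases h3 with c | c
    · rcases h4 with d | d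
      · exact h.square _ hu _ hu' _ hw _ hw' n1 n2 a b c d
      · exact h.tri _ hu _ hw' _ hu' b d
    · exact h.tri _ hu _ hw _ hu' a c
  · exact h.tri _ hw' _ hu _ hw b a
  · exact h.tri _ hw _ hu _ hw' a b
  · rcases h3 with c | c
    · exact h.tri _ hu' _ hw _ hu c a
    · rcases h4 with d | d
      · exact h.tri _ hu' _ hw' _ hu d b
      · exact h.square _ hw _ hw' _ hu _ hu' n2 n1 a c b d

/-! ### Tame one-point extensions -/

section Extension

variable {lo hi : ℕ} {l : Bool} {x : ℤ × ℤ}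

/-- A point of a tame extension is adjacent to at most one point of the path. -/
theorem Tame.unique_inv (h : Tame (insert x (F lo hi l false))) (hx : x.1 % 2 = 1) {i j : ℕ}
    (hi1 : lo ≤ i) (hij : i < j) (hj : j ≤ hi) (h1 : Inv x (P i)) (h2 : Inv x (P j)) : False := by
  have hm : ∀ k, lo ≤ k → k ≤ hi → P k ∈ insert x (F lo hi l false) := fun k a b =>
    Or.inr (P_mem_F a b)
  have hxm : x ∈ insert x (F lo hi l false) := Or.inl rfl
  by_cases h3 : Inv x (P (i + 1))
  · exact h.no_triangle hxm (hm i hi1 (by omega)) (hm (i + 1) (by omega) (by omega)) h1 (P_adj i) h3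
  have hlt : i + 2 ≤ j := by
    by_contra hc
    obtain rfl : j = i + 1 := by omega
    exact h3 h2
  -- A point inverted with two path points further apart is inverted with `P (i + 1)` or `P (i +
  -- 2)`. The first is excluded, and the second closes a 4-cycle through `P (i + 1)`.
  have h4 : Inv x (P (i + 2)) := by
    by_cases e : j = i + 2
    · exact e ▸ h2
    have e0 := P_spec i
    have e1 := P_spec (i + 1)
    have e2 := P_spec (i + 2)
    have e3 := P_spec j
    unfold Inv NW at *
    omega
  refine h.no_square hxm (hm (i + 1) (by omega) (by omega)) (hm i hi1 (by omega))
    (hm (i + 2) (by omega) (by omega)) ?_ (fun e => by have := P_injective e; omega) h1 h4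
    (Or.symm (P_adj i)) (P_adj (i + 1))
  intro e
  have := P_spec (i + 1)
  rw [← e] at this
  omega

theorem exists_inv_of_linked (hlo : lo ≤ hi) (hx : x ∉ F lo hi l false)
    (h : Linked (insert x (F lo hi l false))) : ∃ z ∈ F lo hi l false, Inv x z := by
  by_contra hc
  push Not at hc
  have := h.2 (· = x) ?_ x (Or.inl rfl) (P lo) (Or.inr (P_mem_F le_rfl hlo)) rfl
  · exact hx (this ▸ P_mem_F le_rfl hlo)
  · rintro z (rfl | hz) w (rfl | hw) hzw
    · rfl
    · exact absurd (Or.inl hzw) (hc w hw)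
    · exact absurd (Or.inr hzw) (hc z hz)
    · exact ⟨fun e => absurd (e ▸ hz) hx, fun e => absurd (e ▸ hw) hx⟩

theorem notMem_F_of_odd (hx : x.1 % 2 = 1) : x ∉ F lo hi l false := fun h => by
  have := even_F _ h
  omega

/-- Being inverted with the last point and not with the three before it confines `x` to a region in
which it compares with every other point as `P (hi + 1)` does. -/
theorem plots_extend_right {π : Perm} (hl : l = true → lo % 2 = 0) (hlen : lo + 5 ≤ hi)
    (hx : x.1 % 2 = 1) (hx2 : x.2 % 2 = 1) (hπ : Plots π (insert x (F lo hi l false))) (h1 : Inv x (P hi))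
    (hun : ∀ i, lo ≤ i → i < hi → ¬ Inv x (P i)) : Plots π (F lo (hi + 1) l false) := by
  rw [F_eq_insert_P_right (by omega)]
  refine hπ.replace (notMem_F_of_odd hx) ?_
  have b1 := hun (hi - 1) (by omega) (by omega)
  have b2 := hun (hi - 2) (by omega) (by omega)
  have b3 := hun (hi - 3) (by omega) (by omega)
  have e0 := P_spec hi
  have e1 := P_spec (hi - 1)
  have e2 := P_spec (hi - 2)
  have e3 := P_spec (hi - 3)
  have e4 := P_spec (hi + 1)
  have key : (hi % 2 = 0 ∧ 8 * (hi : ℤ) - 8 < x.1 ∧ 8 * (hi : ℤ) - 4 < x.2 ∧ x.2 < 8 * hi + 12) ∨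
      (hi % 2 = 1 ∧ 8 * (hi : ℤ) - 16 < x.1 ∧ x.1 < 8 * hi ∧ 8 * (hi : ℤ) + 4 < x.2) := by
    clear e0 e1 e2 e3 e4 hun hπ
    have c1 : ((hi - 1 : ℕ) : ℤ) = hi - 1 := by omega
    have c2 : ((hi - 2 : ℕ) : ℤ) = hi - 2 := by omega
    have c3 : ((hi - 3 : ℕ) : ℤ) = hi - 3 := by omega
    rcases Nat.mod_two_eq_zero_or_one hi with hp | hp
    · left
      simp only [Inv, NW, not_or, not_and, not_lt, c1, c2, c3,
        P_of_even hp, P_of_odd (j := hi - 1) (by omega), P_of_even (j := hi - 2) (by omega), P_of_odd (j := hi - 3) (by omega)] at b1 b2 b3 h1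
      omega
    · right
      simp only [Inv, NW, not_or, not_and, not_lt, c1, c2, c3,
        P_of_odd hp, P_of_even (j := hi - 1) (by omega), P_of_odd (j := hi - 2) (by omega), P_of_even (j := hi - 3) (by omega)] at b1 b2 b3 h1
      omega
  clear b1 b2 b3 e1 e2 e3 h1 hun
  rintro z (⟨j, h1, h2, rfl⟩ | ⟨e, rfl⟩ | ⟨e, -⟩)
  · have e5 := P_spec j
    by_cases hj : j = hi
    · subst hj; omega
    · by_cases hj' : j + 1 = hi
      · subst hj'; push_cast at *; omega
      · omega
  · have e5 := Q_spec lo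
    have := hl e
    omega
  · cases e

theorem plots_extend_left {π : Perm} (hlo : 2 ≤ lo) (hlen : lo + 5 ≤ hi)
    (hx : x.1 % 2 = 1) (hx2 : x.2 % 2 = 1) (hπ : Plots π (insert x (F lo hi false false))) (h1 : Inv x (P lo))
    (hun : ∀ i, lo < i → i ≤ hi → ¬ Inv x (P i)) : Plots π (F (lo - 1) hi false false) := by
  rw [F_eq_insert_P_left (by omega), Nat.sub_add_cancel (by omega)]
  refine hπ.replace (notMem_F_of_odd hx) ?_
  have b1 := hun (lo + 1) (by omega) (by omega)
  have b2 := hun (lo + 2) (by omega) (by omega)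
  have b3 := hun (lo + 3) (by omega) (by omega)
  have e0 := P_spec lo
  have e1 := P_spec (lo + 1)
  have e2 := P_spec (lo + 2)
  have e3 := P_spec (lo + 3)
  have e4 := P_spec (lo - 1)
  have key : (lo % 2 = 0 ∧ 8 * (lo : ℤ) - 12 < x.1 ∧ x.1 < 8 * lo + 4 ∧ x.2 < 8 * lo + 8) ∨
      (lo % 2 = 1 ∧ x.1 < 8 * (lo : ℤ) - 4 ∧ x.2 < 8 * lo + 16 ∧ 8 * (lo : ℤ) < x.2) := by
    clear e0 e1 e2 e3 e4 hun hπ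
    have c1 : ((lo + 1 : ℕ) : ℤ) = lo + 1 := by omega
    have c2 : ((lo + 2 : ℕ) : ℤ) = lo + 2 := by omega
    have c3 : ((lo + 3 : ℕ) : ℤ) = lo + 3 := by omega
    rcases Nat.mod_two_eq_zero_or_one lo with hp | hp
    · left
      simp only [Inv, NW, not_or, not_and, not_lt, c1, c2, c3,
        P_of_even hp, P_of_odd (j := lo + 1) (by omega), P_of_even (j := lo + 2) (by omega), P_of_odd (j := lo + 3) (by omega)] at b1 b2 b3 h1
      omega
    · right
      simp only [Inv, NW, not_or, not_and, not_lt, c1, c2, c3,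
        P_of_odd hp, P_of_even (j := lo + 1) (by omega), P_of_odd (j := lo + 2) (by omega), P_of_even (j := lo + 3) (by omega)] at b1 b2 b3 h1
      omega
  clear b1 b2 b3 e1 e2 e3 h1 hun
  rintro z (⟨j, h1, h2, rfl⟩ | ⟨e, -⟩ | ⟨e, -⟩)
  · have e5 := P_spec j
    by_cases hj : j = lo
    · subst hj; omega
    · by_cases hj' : j = lo + 1
      · subst hj'; push_cast at *; omega
      · omega
  · cases e
  · cases e

theorem plots_fork_left {π : Perm} (hlo : lo % 2 = 0) (hlen : lo + 5 ≤ hi)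
    (hx : x.1 % 2 = 1) (hx2 : x.2 % 2 = 1) (hπ : Plots π (insert x (F lo hi false false))) (h1 : Inv x (P (lo + 1)))
    (hun : ∀ i, lo ≤ i → i ≤ hi → i ≠ lo + 1 → ¬ Inv x (P i)) : Plots π (F lo hi true false) := by
  have b0 := hun lo (by omega) (by omega) (by omega)
  have b2 := hun (lo + 2) (by omega) (by omega) (by omega)
  have b3 := hun (lo + 3) (by omega) (by omega) (by omega)
  have e0 := P_spec lo
  have e1 := P_spec (lo + 1)
  have e2 := P_spec (lo + 2)
  have e3 := P_spec (lo + 3)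
  have e4 := Q_spec lo
  have key : x.1 < 8 * (lo : ℤ) + 4 ∧ 8 * (lo : ℤ) + 8 < x.2 ∧ x.2 < 8 * lo + 24 ∧
      ((x.1 < 8 * (lo : ℤ) - 12 ∧ x.2 < 8 * lo + 12) ∨
        (8 * (lo : ℤ) - 12 < x.1 ∧ 8 * (lo : ℤ) + 12 < x.2)) := by
    unfold Inv NW at *
    omega
  clear b0 b2 b3 e1 e2 e3 h1 hun
  -- The new leaf lies on either side of `P lo`. If it is below, the old `P lo` moves to `Q lo`
  -- first and `x` then takes its place.
  obtain ⟨k1, k2, k3, k4 | k4⟩ := key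
  · have hPG : P lo ∉ F (lo + 1) hi false false := by rw [P_mem_F_iff]; omega
    rw [F_eq_insert_P_left (by omega), Set.insert_comm] at hπ
    have h2 := hπ.replace (y := Q lo) ?_ ?_
    · rw [Set.insert_comm] at h2
      rw [F_eq_insert_left, F_eq_insert_P_left (by omega), Set.insert_comm]
      refine h2.replace ?_ ?_
      · rintro (e | e)
        · rw [e] at hx; omega
        · exact notMem_F_of_odd hx e
      · rintro z (rfl | ⟨j, h1, h2, rfl⟩ | ⟨e, -⟩ | ⟨e, -⟩)
        · omega
        · have e5 := P_spec j
          by_cases hj : j = lo + 1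
          · subst hj; push_cast at *; omega
          · omega
        · cases e
        · cases e
    · rintro (e | e)
      · rw [← e] at hx; omega
      · exact hPG e
    · rintro z (rfl | ⟨j, h1, h2, rfl⟩ | ⟨e, -⟩ | ⟨e, -⟩)
      · omega
      · have e5 := P_spec j
        by_cases hj : j = lo + 1
        · subst hj; push_cast at *; omega
        · omega
      · cases e
      · cases e
  · rw [F_eq_insert_left]
    refine hπ.replace (notMem_F_of_odd hx) ?_
    rintro z (⟨j, h1, h2, rfl⟩ | ⟨e, -⟩ | ⟨e, -⟩)
    · have e5 := P_spec j
      by_cases hj : j = lo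
      · subst hj; omega
      · by_cases hj' : j = lo + 1
        · subst hj'; push_cast at *; omega
        · omega
    · cases e
    · cases e

/-- A tame linked one-point extension of a long path, possibly forked at the lower left end, is
again of this form. -/
theorem Tame.exists_plots {π : Perm} (hl : l = true → lo % 2 = 0) (hlo : 2 ≤ lo)
    (hlen : lo + 5 ≤ hi) (hx : x.1 % 2 = 1) (hx2 : x.2 % 2 = 1) (hπ : Plots π (insert x (F lo hi l false)))
    (h : Tame (insert x (F lo hi l false))) (hlink : Linked (insert x (F lo hi l false))) :
    ∃ lo' hi' l', (l' = true → lo' % 2 = 0) ∧ lo' < hi' ∧ Plots π (F lo' hi' l' false) := by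
  have hm : ∀ k, lo ≤ k → k ≤ hi → P k ∈ insert x (F lo hi l false) := fun k a b =>
    Or.inr (P_mem_F a b)
  have hxm : x ∈ insert x (F lo hi l false) := Or.inl rfl
  have hxP : ∀ k, x ≠ P k := fun k e => by
    have := P_spec k
    rw [← e] at this
    omega
  have hxQ : ∀ k, x ≠ Q k := fun k e => by
    have := Q_spec k
    rw [← e] at this
    omega
  have hPP : ∀ {i j}, i ≠ j → P i ≠ P j := fun hij e => hij (P_injective e)
  by_cases hP : ∃ j, lo ≤ j ∧ j ≤ hi ∧ Inv x (P j)
  · obtain ⟨j, hj1, hj2, hj⟩ := hP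
    have hun : ∀ i, lo ≤ i → i ≤ hi → i ≠ j → ¬ Inv x (P i) := by
      intro i h1 h2 hij hc
      rcases lt_or_gt_of_ne hij with h3 | h3
      · exact h.unique_inv hx h1 h3 hj2 hc hj
      · exact h.unique_inv hx hj1 h3 h2 hj hc
    by_cases c1 : j = hi
    · subst c1
      exact ⟨lo, j + 1, l, hl, by omega, plots_extend_right hl hlen hx hx2 hπ hj
        fun i a b => hun i a b.le b.ne⟩
    by_cases c2 : j = lo
    · subst c2
      cases l with
      | false =>
        exact ⟨j - 1, hi, false, by simp, by omega, plots_extend_left hlo hlen hx hx2 hπ hj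
          fun i a b => hun i a.le b a.ne'⟩
      | true =>
        -- The leaf `P j` of the fork would acquire a second neighbour.
        exfalso
        have e0 := P_spec j
        have e1 := P_spec (j + 1)
        have e2 := P_spec (j + 2)
        have e3 := Q_spec j
        have b1 := hun (j + 1) (by omega) (by omega) (by omega)
        have := hl rfl
        refine h.leaf (P (j + 1)) (hm _ (by omega) (by omega)) (P j) (hm _ (by omega) (by omega))
          (Q j) (Or.inr Q_mem_F_left) (P (j + 2)) (hm _ (by omega) (by omega)) x hxm
          (by omega) (by omega) (hxP _) ?_ ?_ ?_ (Or.inl ?_) <;> unfold Inv NW at * <;> omega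
    have e0 := P_spec j
    have e1 := P_spec (j + 1)
    have e2 := P_spec (j - 1)
    have b1 := hun (j + 1) (by omega) (by omega) (by omega)
    have b2 := hun (j - 1) (by omega) (by omega) (by omega)
    -- An upper point would get three neighbours. A lower point with three neighbours violates
    -- `leaf` through `P (j - 1)`, which continues to `P (j - 2)`, unless it is the second point of
    -- the path.
    rcases Nat.mod_two_eq_zero_or_one j with hpar | hpar
    · exfalso
      refine h.three (P j) (hm _ hj1 hj2) (P (j - 1)) (hm _ (by omega) (by omega)) (P (j + 1))
        (hm _ (by omega) (by omega)) x hxm (hPP (by omega)) (hxP _).symm (hxP _).symm ?_ ?_ ?_ <;>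
        unfold Inv NW at * <;> omega
    by_cases c3 : lo + 2 ≤ j
    · exfalso
      have e3 := P_spec (j - 2)
      have c1 : NW (P (j - 1)) (P j) := by unfold NW; omega
      have c2 : NW (P (j + 1)) (P j) := by unfold NW; omega
      have c3 : NW x (P j) := by unfold Inv NW at *; omega
      have c4 : NW (P (j - 1)) (P (j - 2)) := by unfold NW; omega
      have m0 := hm j hj1 hj2
      have m1 := hm (j - 1) (by omega) (by omega)
      have m2 := hm (j + 1) (by omega) (by omega)
      have m3 := hm (j - 2) (by omega) (by omega)
      have hne : P (j - 2) ≠ P j := hPP (by omega)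
      by_cases d1 : x.1 < (P (j - 1)).1
      · exact h.leaf _ m0 _ hxm _ m1 _ m2 _ m3 d1 (by omega) hne c3 c1 c2 (Or.inr c4)
      by_cases d2 : x.1 < (P (j + 1)).1
      · exact h.leaf _ m0 _ m1 _ hxm _ m2 _ m3 (by omega) d2 hne c1 c3 c2 (Or.inl c4)
      · exact h.leaf _ m0 _ m1 _ m2 _ hxm _ m3 (by omega) (by omega) hne c1 c2 c3 (Or.inl c4)
    · obtain rfl : j = lo + 1 := by omega
      cases l with
      | false =>
        exact ⟨lo, hi, true, by omega, by omega, plots_fork_left (by omega) hlen hx hx2 hπ hj hun⟩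
      | true =>
        exfalso
        have e3 := Q_spec lo
        rw [Nat.add_sub_cancel] at *
        refine h.four (P (lo + 1)) (hm _ hj1 hj2) (P lo) (hm _ (by omega) (by omega)) (Q lo)
          (Or.inr Q_mem_F_left) (P (lo + 1 + 1)) (hm _ (by omega) (by omega)) x hxm (P_ne_Q _ _)
          (hPP (by omega)) (hxP _).symm (P_ne_Q _ _).symm (hxQ _).symm (hxP _).symm ?_ ?_ ?_ ?_ <;>
          unfold Inv NW at * <;> omega
  · exfalso
    push Not at hP
    obtain ⟨z, ⟨j, h1, h2, rfl⟩ | ⟨rfl, rfl⟩ | ⟨e, -⟩, hz⟩ :=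
      exists_inv_of_linked (by omega) (notMem_F_of_odd hx) hlink
    · exact hP j h1 h2 hz
    · have e0 := P_spec lo
      have e1 := P_spec (lo + 1)
      have e2 := P_spec (lo + 2)
      have e3 := Q_spec lo
      have b1 := hP (lo + 1) (by omega) (by omega)
      have := hl rfl
      refine h.leaf (P (lo + 1)) (hm _ (by omega) (by omega)) (P lo) (hm _ (by omega) (by omega))
        (Q lo) (Or.inr Q_mem_F_left) (P (lo + 2)) (hm _ (by omega) (by omega)) x hxm
        (by omega) (by omega) (hxP _) ?_ ?_ ?_ (Or.inr ?_) <;> unfold Inv NW at * <;> omega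
    · cases e

end Extension

/-! ### Finite bases -/

/-- The sequence `1, 1, 2, 3, 3, 3, …`. -/
def threeSeq (n : ℕ) : ℕ := if n ≤ 2 then 1 else if n = 3 then 2 else 3

theorem threeSeq_le (n : ℕ) : threeSeq n ≤ 3 := by unfold threeSeq; split_ifs <;> omega

theorem threeSeq_eq {n : ℕ} (h : 4 ≤ n) : threeSeq n = 3 := by
  unfold threeSeq; rw [if_neg (by omega), if_neg (by omega)]

theorem closed_threeSeq : Closed threeSeq := by
  intro k n hn hk hv k' hv' h1 h2
  have h3 := threeSeq_le n
  have h4 : k' ≤ 2 := by omega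
  unfold Valid at hv'
  unfold threeSeq
  split_ifs <;> omega

theorem tame_of_mem {σ : Perm} (h : σ ∈ indecSet threeSeq) {t : Set (ℤ × ℤ)} (ht : Plots σ t) :
    Tame t := by
  obtain ⟨k, hk, -, hp⟩ := h
  refine Tame.transfer ht hp ?_
  have := threeSeq_le σ.1
  obtain rfl | rfl | rfl : k = 0 ∨ k = 1 ∨ k = 2 := by omega
  · exact tame_F (by simp)
  · exact tame_F (by simp)
  · exact tame_F (by simp)

theorem ncard_insert_le' {s : Set (ℤ × ℤ)} {n : ℕ} (x : ℤ × ℤ) (h : s.ncard ≤ n) :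
    (insert x s).ncard ≤ n + 1 := (Set.ncard_insert_le x s).trans (by omega)

theorem ncard_singleton_le (x : ℤ × ℤ) : ({x} : Set (ℤ × ℤ)).ncard ≤ 1 :=
  (Set.ncard_singleton x).le

/-- Each forbidden configuration spans a linked set of at most five points, hence a proper
indecomposable subpermutation, and those are tame. -/
theorem tame_of_proper {β : Perm} (hlen : 6 ≤ β.1) {X : Set (ℤ × ℤ)} (hX : Plots β X)
    (h : ∀ σ, SumIndecomposable σ → Contains β σ → σ ≠ β → σ ∈ indecSet threeSeq) : Tame X := by
  have key : ∀ Y ⊆ X, Linked Y → Y.ncard ≤ 5 → Tame Y := by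
    intro Y hY hl hc
    obtain ⟨σ, hσ, hβσ⟩ := hX.exists_sub hY
    refine tame_of_mem (h σ (hσ.sumIndecomposable_iff.2 hl) hβσ ?_) hσ
    rintro rfl
    rw [hσ.ncard] at hc
    omega
  refine ⟨?_, ?_, ?_, ?_, ?_⟩
  · intro u hu v hv w hw a b
    refine (key (insert w (insert u {v})) ?_ ?_ ?_).tri u (by simp) v (by simp) w (by simp) a b
    · simp [Set.insert_subset_iff, *]
    · exact ((linked_singleton v).insert (w := v) (by simp) (Or.inr a)).insert (w := v) (by simp)
        (Or.inl b)
    · exact (ncard_insert_le' _ (ncard_insert_le' _ (ncard_singleton_le _))).trans (by omega)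
  · intro u hu u' hu' w hw w' hw' n1 n2 a b c d
    refine (key (insert u' (insert w' (insert w {u}))) ?_ ?_ ?_).square u (by simp) u' (by simp)
      w (by simp) w' (by simp) n1 n2 a b c d
    · simp [Set.insert_subset_iff, *]
    · exact (((linked_singleton u).insert (w := u) (by simp) (Or.inl a)).insert (w := u) (by simp)
        (Or.inl b)).insert (w := w) (by simp) (Or.inr c)
    · exact (ncard_insert_le' _ (ncard_insert_le' _ (ncard_insert_le' _
        (ncard_singleton_le _)))).trans (by omega)
  · intro u hu w hw w' hw' w'' hw'' n1 n2 n3 a b c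
    refine (key (insert w'' (insert w' (insert w {u}))) ?_ ?_ ?_).three u (by simp) w (by simp)
      w' (by simp) w'' (by simp) n1 n2 n3 a b c
    · simp [Set.insert_subset_iff, *]
    · exact (((linked_singleton u).insert (w := u) (by simp) (Or.inl a)).insert (w := u) (by simp)
        (Or.inl b)).insert (w := u) (by simp) (Or.inl c)
    · exact (ncard_insert_le' _ (ncard_insert_le' _ (ncard_insert_le' _
        (ncard_singleton_le _)))).trans (by omega)
  · intro c hc u hu u' hu' u'' hu'' v hv n1 n2 n3 n4 n5 n6 a1 a2 a3 a4
    refine (key (insert v (insert u'' (insert u' (insert u {c})))) ?_ ?_ ?_).four c (by simp)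
      u (by simp) u' (by simp) u'' (by simp) v (by simp) n1 n2 n3 n4 n5 n6 a1 a2 a3 a4
    · simp [Set.insert_subset_iff, *]
    · exact ((((linked_singleton c).insert (w := c) (by simp) (Or.inr a1)).insert (w := c) (by simp)
        (Or.inr a2)).insert (w := c) (by simp) (Or.inr a3)).insert (w := c) (by simp) (Or.inr a4)
    · exact (ncard_insert_le' _ (ncard_insert_le' _ (ncard_insert_le' _ (ncard_insert_le' _
        (ncard_singleton_le _))))).trans (by omega)
  · intro c hc u hu u' hu' u'' hu'' d hd n1 n2 n3 a1 a2 a3 a4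
    refine (key (insert d (insert u'' (insert u' (insert u {c})))) ?_ ?_ ?_).leaf c (by simp)
      u (by simp) u' (by simp) u'' (by simp) d (by simp) n1 n2 n3 a1 a2 a3 a4
    · simp [Set.insert_subset_iff, *]
    · have := (((linked_singleton c).insert (w := c) (by simp) (Or.inr a1)).insert (w := c) (by simp)
        (Or.inr a2)).insert (w := c) (by simp) (Or.inr a3)
      rcases a4 with a4 | a4
      · exact this.insert (w := u) (by simp) (Or.inl a4)
      · exact this.insert (w := u') (by simp) (Or.inl a4)
    · exact (ncard_insert_le' _ (ncard_insert_le' _ (ncard_insert_le' _ (ncard_insert_le' _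
        (ncard_singleton_le _))))).trans (by omega)

theorem plots_F_add {π : Perm} {lo hi : ℕ} {l r : Bool} (m : ℕ) :
    Plots π (F (lo + 2 * m) (hi + 2 * m) l r) ↔ Plots π (F lo hi l r) := by
  induction m with
  | zero => rfl
  | succ m ih =>
    rw [← ih, show lo + 2 * (m + 1) = lo + 2 * m + 2 by ring,
      show hi + 2 * (m + 1) = hi + 2 * m + 2 by ring, plots_F_add_two]

theorem mem_indecSet_of_plots {π : Perm} {lo hi : ℕ} {l : Bool} (hl : l = true → lo % 2 = 0)
    (hlt : lo < hi) (hlen : 4 ≤ π.1) (h : Plots π (F lo hi l false)) : π ∈ indecSet threeSeq := by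
  have hc := h.ncard
  rw [ncard_F (Or.inl hlt)] at hc
  simp only [Bool.toNat_false, add_zero] at hc
  obtain ⟨a, m, ha, rfl⟩ : ∃ a m, a < 2 ∧ lo = a + 2 * m := ⟨lo % 2, lo / 2, by omega, by omega⟩
  obtain ⟨b, rfl⟩ : ∃ b, hi = b + 2 * m := ⟨hi - 2 * m, by omega⟩
  rw [plots_F_add] at h
  have h3 := threeSeq_eq hlen
  have mk : ∀ k, k < 3 → Valid k π.1 → fig k π.1 = F a b l false → π ∈ indecSet threeSeq :=
    fun k h1 h2 h4 => ⟨k, by omega, h2, h4 ▸ h⟩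
  cases l with
  | false =>
    simp only [Bool.toNat_false] at hc
    obtain rfl | rfl : a = 0 ∨ a = 1 := by omega
    · refine mk 0 (by omega) (by unfold Valid; omega) ?_
      rw [fig_zero]; congr 1; omega
    · refine mk 1 (by omega) (by unfold Valid; omega) ?_
      rw [fig_one]; congr 1; omega
  | true =>
    simp only [Bool.toNat_true] at hc
    have := hl rfl
    obtain rfl : a = 0 := by omega
    refine mk 2 (by omega) (by unfold Valid; omega) ?_
    rw [fig_two]; congr 1; omega

theorem exists_contains_pred {β : Perm} (hβ : SumIndecomposable β) (hlen : 2 ≤ β.1) :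
    ∃ τ, SumIndecomposable τ ∧ Contains β τ ∧ τ.1 + 1 = β.1 := by
  obtain ⟨X, hX⟩ := exists_plots_self β
  obtain ⟨z, hz⟩ := (hX.sumIndecomposable_iff.1 hβ).1
  obtain ⟨σ, hσ, hβσ⟩ := hX.exists_sub (Set.singleton_subset_iff.2 hz)
  obtain ⟨τ, h1, h2, -, h3⟩ := exists_contains_succ hβ (hσ.sumIndecomposable_iff.2 (linked_singleton z))
    hβσ (by rintro rfl; have := hσ.ncard; rw [Set.ncard_singleton] at this; omega)
  exact ⟨τ, h1, h2, h3⟩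

/-- A long indecomposable permutation whose proper indecomposable subpermutations are paths or
paths forked at the lower left end is itself of this form. -/
theorem mem_indecSet_of_proper {β : Perm} (hβ : SumIndecomposable β) (hlen : 9 ≤ β.1)
    (h : ∀ σ, SumIndecomposable σ → Contains β σ → σ ≠ β → σ ∈ indecSet threeSeq) :
    β ∈ indecSet threeSeq := by
  obtain ⟨τ, hτ, hβτ, hlen'⟩ := exists_contains_pred hβ (by omega)
  obtain ⟨k, hk, hv, hp⟩ := h τ hτ hβτ (by rintro rfl; omega)
  have h3 := threeSeq_le τ.1
  obtain ⟨lo, hi, l, hl, h1, h2⟩ : ∃ lo hi l, (l = true → lo % 2 = 0) ∧ lo + 5 ≤ hi ∧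
      Plots τ (F lo hi l false) := by
    obtain rfl | rfl | rfl : k = 0 ∨ k = 1 ∨ k = 2 := by omega
    · exact ⟨_, _, _, by simp, by omega, hp⟩
    · exact ⟨_, _, _, by simp, by omega, hp⟩
    · exact ⟨_, _, _, by simp, by omega, hp⟩
  -- Shifting by two leaves room to extend the path at its left end.
  rw [← plots_F_add_two] at h2
  obtain ⟨a, b, ha, hb, hX⟩ := exists_plots_insert hβτ hlen' h2 even_F
  obtain ⟨lo', hi', l', h4, h5, h6⟩ := Tame.exists_plots
    (fun e => by have := hl e; omega) (by omega) (by omega) ha hb hX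
    (tame_of_proper (by omega) hX h) (hX.sumIndecomposable_iff.1 hβ)
  exact mem_indecSet_of_plots h4 h5 (by omega) h6

theorem finite_len_le (N : ℕ) : {β : Perm | β.1 ≤ N}.Finite := by
  have : {β : Perm | β.1 ≤ N} = ⋃ n ∈ Set.Iic N, Set.range (Sigma.mk n) := by
    ext ⟨n, β⟩
    simp only [Set.mem_ofPred_eq, Set.mem_iUnion, Set.mem_Iic, Set.mem_range]
    constructor
    · intro h; exact ⟨n, h, β, rfl⟩
    · rintro ⟨m, h, γ, e⟩
      cases e
      exact h
  rw [this]
  exact (Set.finite_Iic N).biUnion fun n _ => Set.finite_range _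

/-- A long basis element is indecomposable, and its proper indecomposable subpermutations have
colength-one intermediates in the first `c` families. Hence it belongs to the first three families
itself. -/
theorem finitelyBased_sumClass {s : ℕ → ℕ} {M c : ℕ} (hc : c = 0 ∨ c = 2 ∨ c = 3)
    (htail : ∀ n, M ≤ n → s n = c) : FinitelyBased (sumClass (indecSet s)) := by
  refine (finite_len_le (M + 10)).subset ?_
  rintro β ⟨hβC, hprop⟩
  by_contra hlen
  simp only [Set.mem_ofPred_eq, not_le] at hlen
  have hprop' : ∀ σ, SumIndecomposable σ → Contains β σ → σ ≠ β → σ ∈ indecSet s :=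
    fun σ hσ h hne => hprop σ h hne σ hσ (Contains.refl σ)
  obtain ⟨hβ, hβS⟩ : SumIndecomposable β ∧ β ∉ indecSet s := by
    unfold sumClass at hβC
    simp only [Set.mem_ofPred_eq] at hβC
    push Not at hβC
    obtain ⟨σ, hσ, h, h'⟩ := hβC
    by_cases e : σ = β
    · exact e ▸ ⟨hσ, h'⟩
    · exact absurd (hprop' σ hσ h e) h'
  have hc3 : c ≤ 3 := by omega
  have hsub : ∀ τ ∈ indecSet s, τ.1 + 1 = β.1 → τ ∈ indecSet threeSeq ∧ c ≠ 0 := by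
    rintro τ ⟨k, hk, hv, hp⟩ h
    rw [htail τ.1 (by omega)] at hk
    exact ⟨⟨k, by rw [threeSeq_eq (by omega)]; omega, hv, hp⟩, by omega⟩
  have hc0 : c ≠ 0 := by
    obtain ⟨τ, h1, h2, h3⟩ := exists_contains_pred hβ (by omega)
    exact (hsub τ (hprop' τ h1 h2 (by rintro rfl; omega)) h3).2
  have hβ3 : β ∈ indecSet threeSeq := by
    refine mem_indecSet_of_proper hβ (by omega) fun σ hσ h hne => ?_
    obtain ⟨τ, h1, h2, h3, h4⟩ := exists_contains_succ hβ hσ h hne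
    exact closed_threeSeq.mem_indecSet τ (hsub τ (hprop' τ h1 h2 (by rintro rfl; omega)) h4).1 σ hσ h3
  obtain ⟨k, hk, hv, hp⟩ := hβ3
  have h3 := threeSeq_le β.1
  by_cases hkc : k < c
  · exact hβS ⟨k, by rw [htail β.1 (by omega)]; exact hkc, hv, hp⟩
  -- The remaining case is a left fork above a tail of 2s; it is not minimal, since the next shorter
  -- left fork is already excluded.
  obtain rfl : k = 2 := by omega
  obtain rfl : c = 2 := by omega
  have hv2 : Valid 2 (β.1 - 1) := by unfold Valid; omega
  have hsubset : fig 2 (β.1 - 1) ⊆ fig 2 β.1 := by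
    rw [fig_two, fig_two]
    rintro z (⟨j, h1, h2, rfl⟩ | ⟨-, rfl⟩ | ⟨e, -⟩)
    · exact P_mem_F h1 (by omega)
    · exact Q_mem_F_left
    · cases e
  obtain ⟨σ, hσ, hβσ⟩ := hp.exists_sub hsubset
  have hσl := hσ.ncard
  rw [hv2.ncard] at hσl
  obtain ⟨k, hk, hv', hp'⟩ := hprop' σ (hσ.sumIndecomposable_iff.2 hv2.linked) hβσ
    (by rintro rfl; omega)
  rw [htail σ.1 (by omega)] at hk
  rw [← hσl] at hv' hp'
  have := hv2.eq_of_plots hv' hσ hp'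
  omega

/-! ### Growth rates -/

/-- A longer `σ'` would be cut by the boundary of `σ`, which no inversion crosses. -/
theorem dsum_fst_le {σ τ σ' τ' : Perm} (hσ' : SumIndecomposable σ') (hσ : SumIndecomposable σ)
    (h : dsum σ τ = dsum σ' τ') : σ'.1 ≤ σ.1 := by
  by_contra hlt
  push Not at hlt
  rw [sumIndecomposable_iff] at hσ'
  have hlen : ∀ a : Fin σ'.1, a.1 < σ'.1 + τ'.1 := fun a => by have := a.2; omega
  have key : ∀ π : Perm, π = dsum σ τ → ∀ a : Fin π.1, (π.2 a).1 < σ.1 ↔ a.1 < σ.1 := by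
    rintro _ rfl a
    exact dsum_lt_iff σ τ a
  have h2 : ∀ a : Fin σ'.1, (σ'.2 a).1 < σ.1 ↔ a.1 < σ.1 := by
    intro a
    have h3 := dsum_castAdd σ' τ' a
    have h4 := key _ h.symm (Fin.castAdd τ'.1 a)
    rw [h3] at h4
    exact h4
  have h1 : 1 ≤ σ.1 := hσ.1
  have := hσ'.2 (fun a => a.1 < σ.1) (fun a b hab hba => by
    have ha := h2 a
    have hb := h2 b
    rw [Fin.lt_def] at hab hba
    constructor
    · intro h'
      rw [← ha] at h'
      rw [← hb]; omega
    · intro h'; show a.1 < σ.1; omega) ⟨0, by omega⟩ ⟨σ.1, hlt⟩ (by show 0 < σ.1; omega)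
  simp at this

theorem dsum_injective {σ τ σ' τ' : Perm} (hσ : SumIndecomposable σ) (hσ' : SumIndecomposable σ')
    (h : dsum σ τ = dsum σ' τ') : σ = σ' ∧ τ = τ' := by
  have h1 : σ.1 = σ'.1 := le_antisymm (dsum_fst_le hσ hσ' h.symm) (dsum_fst_le hσ' hσ h)
  have h2 : σ.1 + τ.1 = σ'.1 + τ'.1 := congrArg Sigma.fst h
  obtain ⟨n, σ⟩ := σ
  obtain ⟨m, τ⟩ := τ
  obtain ⟨n', σ'⟩ := σ'
  obtain ⟨m', τ'⟩ := τ'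
  simp only at h1 h2
  subst h1
  obtain rfl : m = m' := by omega
  have key : ∀ π π' : Perm, π = π' → ∀ k (hk : k < π.1) (hk' : k < π'.1),
      (π.2 ⟨k, hk⟩).1 = (π'.2 ⟨k, hk'⟩).1 := by
    rintro π _ rfl k _ _; rfl
  constructor
  · congr 1
    ext a
    have h3 := dsum_castAdd ⟨n, σ⟩ ⟨m, τ⟩ a
    have h4 := dsum_castAdd ⟨n, σ'⟩ ⟨m, τ'⟩ a
    have h5 := key _ _ h a.1 (show a.1 < n + m by have := a.2; omega)
      (show a.1 < n + m by have := a.2; omega)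
    exact h3.symm.trans (h5.trans h4)
  · congr 1
    ext b
    have h3 := dsum_natAdd ⟨n, σ⟩ ⟨m, τ⟩ b
    have h4 := dsum_natAdd ⟨n, σ'⟩ ⟨m, τ'⟩ b
    have h5 := key _ _ h (n + b.1) (show n + b.1 < n + m by have := b.2; omega)
      (show n + b.1 < n + m by have := b.2; omega)
    have h6 := h3.symm.trans (h5.trans h4)
    simp only at h6
    omega

theorem ncard_sigma_mk (p : Perm → Prop) (n : ℕ) :
    {π : Equiv.Perm (Fin n) | p ⟨n, π⟩}.ncard = {π : Perm | p π ∧ π.1 = n}.ncard := by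
  rw [← Set.ncard_image_of_injective _ (sigma_mk_injective (β := fun n => Equiv.Perm (Fin n)) (i := n))]
  congr 1
  ext ⟨m, π⟩
  simp only [Set.mem_image, Set.mem_ofPred_eq]
  constructor
  · rintro ⟨σ, h, e⟩
    cases e
    exact ⟨h, rfl⟩
  · rintro ⟨h, e⟩
    subst e
    exact ⟨π, h, rfl⟩

theorem finite_len_eq (p : Perm → Prop) (n : ℕ) : {π : Perm | p π ∧ π.1 = n}.Finite :=
  (finite_len_le n).subset fun _ h => h.2.le

/-- Splitting off the first indecomposable summand. -/
theorem sum_le_numLength {C : Set Perm} (hC : IsSumClosed C) (n : ℕ) :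
    ∑ k ∈ Finset.range n, numIndecomposable C (k + 1) * numLength C (n - 1 - k) ≤ numLength C n := by
  classical
  have hI := fun k => finite_len_eq (fun π => π ∈ C ∧ SumIndecomposable π) k
  have hA := fun k => finite_len_eq (fun π => π ∈ C) k
  have e1 : ∀ k, numIndecomposable C k = (hI k).toFinset.card := fun k => by
    rw [← Set.ncard_eq_toFinset_card _ (hI k)]
    exact ncard_sigma_mk (fun π => π ∈ C ∧ SumIndecomposable π) k
  have e2 : ∀ k, numLength C k = (hA k).toFinset.card := fun k => by
    rw [← Set.ncard_eq_toFinset_card _ (hA k)]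
    exact ncard_sigma_mk (fun π => π ∈ C) k
  simp only [e1, e2, ← Finset.card_product]
  rw [← Finset.card_sigma]
  refine Finset.card_le_card_of_injOn (fun p => dsum p.2.1 p.2.2) ?_ ?_
  · rintro ⟨k, σ, τ⟩ h
    simp only [Finset.coe_sigma, Finset.coe_range, Set.mem_sigma_iff, Set.mem_Iio, Finset.mem_coe,
      Finset.mem_product, Set.Finite.mem_toFinset, Set.mem_ofPred_eq] at h ⊢
    obtain ⟨hk, ⟨⟨hσ, -⟩, hσl⟩, hτ, hτl⟩ := h
    refine ⟨hC _ hσ _ hτ, ?_⟩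
    show σ.1 + τ.1 = n
    omega
  · rintro ⟨k, σ, τ⟩ h ⟨k', σ', τ'⟩ h' e
    simp only [Finset.coe_sigma, Finset.coe_range, Set.mem_sigma_iff, Set.mem_Iio, Finset.mem_coe,
      Finset.mem_product, Set.Finite.mem_toFinset, Set.mem_ofPred_eq] at h h' e
    obtain ⟨rfl, rfl⟩ := dsum_injective h.2.1.1.2 h'.2.1.1.2 e
    have h1 := h.2.1.2
    have h2 := h'.2.1.2
    obtain rfl : k = k' := by omega
    rfl

/-- The number of sequences with total length `n` of objects counted by `1, 1, 2, 3, 4, 4, …`. -/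
def lowerSeq : ℕ → ℕ
  | 0 => 1
  | 1 => 1
  | 2 => 2
  | 3 => 5
  | 4 => 12
  | n + 5 => 2 * lowerSeq (n + 4) + lowerSeq (n + 2) + lowerSeq (n + 1) + lowerSeq n

/-- The sequence `1, 1, 2, 3, 4, 4, …`. -/
def fourSeq (n : ℕ) : ℕ := if n ≤ 2 then 1 else if n = 3 then 2 else if n = 4 then 3 else 4

/-- Subtracting consecutive convolutions leaves the increments of `fourSeq`, which vanish beyond
index 5; this is the five-term recurrence. -/
theorem lowerSeq_eq_sum (n : ℕ) : lowerSeq (n + 1) =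
    ∑ k ∈ Finset.range (n + 1), fourSeq (k + 1) * lowerSeq (n - k) := by
  induction n with
  | zero => rfl
  | succ n ih =>
    rcases Nat.lt_or_ge n 3 with h | h
    · interval_cases n <;> simp [Finset.sum_range_succ, lowerSeq, fourSeq]
    obtain ⟨m, rfl⟩ : ∃ m, n = m + 3 := ⟨n - 3, by omega⟩
    have e1 : ∑ k ∈ Finset.range (m + 3 + 1), fourSeq (k + 1) * lowerSeq (m + 3 - k) =
        ∑ k ∈ Finset.range m, 4 * lowerSeq (m + 3 - (k + 4)) + 3 * lowerSeq m +
          2 * lowerSeq (m + 1) + lowerSeq (m + 2) + lowerSeq (m + 3) := by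
      rw [Finset.sum_range_succ', Finset.sum_range_succ', Finset.sum_range_succ',
        Finset.sum_range_succ']
      simp only [fourSeq, add_assoc, Nat.reduceAdd, Nat.reduceLeDiff, Nat.reduceEqDiff, if_true,
        if_false, one_mul, zero_add, Nat.sub_zero, Nat.add_sub_cancel, Nat.add_sub_add_right,
        Nat.reduceSubDiff]
    have e2 : ∑ k ∈ Finset.range (m + 3 + 1 + 1), fourSeq (k + 1) * lowerSeq (m + 3 + 1 - k) =
        ∑ k ∈ Finset.range m, 4 * lowerSeq (m + 3 - (k + 4)) + 4 * lowerSeq m +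
          3 * lowerSeq (m + 1) + 2 * lowerSeq (m + 2) + lowerSeq (m + 3) + lowerSeq (m + 4) := by
      rw [Finset.sum_range_succ', Finset.sum_range_succ', Finset.sum_range_succ',
        Finset.sum_range_succ', Finset.sum_range_succ']
      have h7 : ∀ k, m + 4 - (k + 5) = m + 3 - (k + 4) := fun k => by omega
      simp only [h7, fourSeq, add_assoc, Nat.reduceAdd, Nat.reduceLeDiff, Nat.reduceEqDiff,
        if_true, if_false, one_mul, zero_add, Nat.sub_zero, Nat.add_sub_cancel,
        Nat.add_sub_add_right, Nat.reduceSubDiff]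
    rw [e1] at ih
    rw [e2]
    have h8 : lowerSeq (m + 3 + 1 + 1) = 2 * lowerSeq (m + 4) + lowerSeq (m + 2) + lowerSeq (m + 1) +
      lowerSeq m := rfl
    have h9 : lowerSeq (m + 4) = lowerSeq (m + 3 + 1) := rfl
    omega

theorem lowerSeq_le_numLength {C : Set Perm} (hC : IsPermClass C) (hC' : IsSumClosed C)
    (h : ∀ n, 1 ≤ n → fourSeq n ≤ numIndecomposable C n) (n : ℕ) : lowerSeq n ≤ numLength C n := by
  induction n using Nat.strong_induction_on with
  | _ n ih =>
    rcases Nat.eq_zero_or_pos n with rfl | hn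
    · obtain ⟨π, hπ⟩ : ∃ π, π ∈ C := by
        by_contra hc
        push Not at hc
        have h1 := h 1 le_rfl
        unfold numIndecomposable at h1
        simp [hc, fourSeq] at h1
      have h0 : (⟨0, 1⟩ : Perm) ∈ C := hC π hπ _ (contains_of_len_zero π rfl)
      have : {π : Equiv.Perm (Fin 0) | (⟨0, π⟩ : Perm) ∈ C}.Nonempty := ⟨1, h0⟩
      exact (Set.ncard_pos (Set.toFinite _)).2 this
    · obtain ⟨m, rfl⟩ : ∃ m, n = m + 1 := ⟨n - 1, by omega⟩
      rw [lowerSeq_eq_sum]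
      refine le_trans (Finset.sum_le_sum fun k hk => ?_) (sum_le_numLength hC' (m + 1))
      rw [Nat.add_sub_cancel]
      exact Nat.mul_le_mul (h (k + 1) (by omega)) (ih _ (by omega))

/-- The recurrence has the defining polynomial of `xi` as characteristic polynomial. The factor `(xi
^ 4)⁻¹` makes the bound hold for the five initial values. -/
theorem pow_le_lowerSeq (n : ℕ) : (xi ^ 4)⁻¹ * xi ^ n ≤ lowerSeq n := by
  obtain ⟨h1, h2, h3, -⟩ := xi_spec
  have hpos : 0 < xi := by linarith
  have h4 : (0 : ℝ) < (xi ^ 4)⁻¹ := by positivity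
  have hsmall : ∀ m, m ≤ 4 → (xi ^ 4)⁻¹ * xi ^ m ≤ 1 := by
    intro m hm
    rw [inv_mul_le_iff₀ (by positivity), mul_one]
    exact pow_le_pow_right₀ (by linarith) hm
  induction n using Nat.strong_induction_on with
  | _ n ih =>
    rcases Nat.lt_or_ge n 5 with h | h
    · refine (hsmall n (by omega)).trans ?_
      interval_cases n <;> simp [lowerSeq]
    · obtain ⟨m, rfl⟩ : ∃ m, n = m + 5 := ⟨n - 5, by omega⟩
      have a0 := ih m (by omega)
      have a1 := ih (m + 1) (by omega)
      have a2 := ih (m + 2) (by omega)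
      have a4 := ih (m + 4) (by omega)
      have e : (lowerSeq (m + 5) : ℝ) =
          2 * lowerSeq (m + 4) + lowerSeq (m + 2) + lowerSeq (m + 1) + lowerSeq m := by
        simp only [lowerSeq]; push_cast; ring
      have e' : (xi ^ 4)⁻¹ * xi ^ (m + 5) = 2 * ((xi ^ 4)⁻¹ * xi ^ (m + 4)) +
          (xi ^ 4)⁻¹ * xi ^ (m + 2) + (xi ^ 4)⁻¹ * xi ^ (m + 1) + (xi ^ 4)⁻¹ * xi ^ m := by
        have : xi ^ 5 = 2 * xi ^ 4 + xi ^ 2 + xi + 1 := by linarith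
        rw [pow_add, this]; ring
      rw [e, e']
      linarith

/-- The constant factor disappears under the `n`-th root. -/
theorem xi_le_upperGrowthRate {C : Set Perm} (hC : IsPermClass C) (hC' : IsSumClosed C)
    (h : ∀ n, 1 ≤ n → fourSeq n ≤ numIndecomposable C n) :
    ENNReal.ofReal xi ≤ upperGrowthRate C := by
  have hpos : 0 < xi := by linarith [xi_spec.1]
  have hc : (0 : ℝ) < (xi ^ 4)⁻¹ := by positivity
  have h1 : Tendsto (fun n : ℕ => ((xi ^ 4)⁻¹ : ℝ) ^ (1 / (n : ℝ)) * xi) atTop (nhds xi) := by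
    have h2 := (Real.continuousAt_const_rpow (b := 0) hc.ne').tendsto.comp
      (tendsto_one_div_atTop_nhds_zero_nat (𝕜 := ℝ))
    have h3 := h2.mul_const xi
    rwa [Real.rpow_zero, one_mul] at h3
  have h2 := (ENNReal.tendsto_ofReal h1).limsup_eq
  rw [← h2]
  unfold upperGrowthRate
  refine limsup_le_limsup ?_
  filter_upwards [eventually_ge_atTop 1] with n hn
  have h3 : (xi ^ 4)⁻¹ * xi ^ n ≤ (numLength C n : ℝ) :=
    (pow_le_lowerSeq n).trans (by exact_mod_cast lowerSeq_le_numLength hC hC' h n)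
  rw [← ENNReal.ofReal_natCast, ENNReal.ofReal_rpow_of_nonneg (by positivity) (by positivity)]
  apply ENNReal.ofReal_le_ofReal
  calc ((xi ^ 4)⁻¹ : ℝ) ^ (1 / (n : ℝ)) * xi = ((xi ^ 4)⁻¹ * xi ^ n) ^ (1 / (n : ℝ)) := by
        rw [Real.mul_rpow hc.le (by positivity), one_div, Real.pow_rpow_inv_natCast hpos.le (by omega)]
    _ ≤ _ := Real.rpow_le_rpow (by positivity) h3 (by positivity)

/-- A legal sequence with an entry below `1, 1, 2, 3, 4, 4, …` is eventually constantly 0, 2 or 3. -/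
theorem Legal.eventually_const {s : ℕ → ℕ} (h : Legal s) (hend : ¬ EndsInOneOne s)
    (hlt : ∃ n, 1 ≤ n ∧ s n < fourSeq n) :
    ∃ M c, (c = 0 ∨ c = 2 ∨ c = 3) ∧ ∀ n, M ≤ n → s n = c := by
  -- A deficit at a length below 5 propagates to length 5 by legality, and from there on entries at
  -- most 3 stay at most 3.
  have hle3 : ∃ N, 5 ≤ N ∧ ∀ n, N ≤ n → s n ≤ 3 := by
    obtain ⟨N, hN, hsN⟩ : ∃ N, 5 ≤ N ∧ s N ≤ 3 := by
      by_contra hc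
      push Not at hc
      obtain ⟨n, hn, hsn⟩ := hlt
      have h5 := hc 5 le_rfl
      have a1 := h.zero_step 1 le_rfl
      have a2 := h.zero_step 2 (by omega)
      have a3 := h.one_step 3 le_rfl
      have a4 := h.two_step 4 le_rfl
      by_cases c5 : 5 ≤ n
      · have := hc n c5
        unfold fourSeq at hsn
        split_ifs at hsn <;> omega
      · unfold fourSeq at hsn
        interval_cases n <;> simp at hsn <;> simp at a1 a2 a3 a4 <;> omega
    refine ⟨N, hN, fun n hn => ?_⟩
    induction n, hn using Nat.le_induction with
    | base => exact hsN
    | succ m hm ih => exact h.three_step m (by omega) ih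
  obtain ⟨N, hN, hN3⟩ := hle3
  by_cases h2 : ∃ M, N ≤ M ∧ s M ≤ 2
  · obtain ⟨M, hM, hsM⟩ := h2
    have hM2 : ∀ n, M ≤ n → s n ≤ 2 := by
      intro n hn
      induction n, hn using Nat.le_induction with
      | base => exact hsM
      | succ m hm ih => exact h.two_step m (by omega) ih
    by_cases h1 : ∃ K, M ≤ K ∧ s K ≤ 1
    · obtain ⟨K, hK, hsK⟩ := h1
      have h0 : s (K + 1) = 0 := by
        rcases Nat.eq_zero_or_pos (s K) with e | e
        · exact h.zero_step K (by omega) e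
        · exact h.eq_zero_of_eq_one hend (by omega) (by omega)
      exact ⟨K + 1, 0, by omega, fun n hn => h.eq_zero_of_le (by omega) h0 hn⟩
    · push Not at h1
      exact ⟨M, 2, by omega, fun n hn => by have := hM2 n hn; have := h1 n hn; omega⟩
  · push Not at h2
    exact ⟨N, 3, by omega, fun n hn => by have := hN3 n hn; have := h2 n hn; omega⟩

end PermClasses

theorem mainTheorem8 (i : ℕ) (s : ℕ → ℕ)
    (hlegal : PermClasses.Legal s)
    (hdom : PermClasses.Dominates (PermClasses.boundSeq i) s)
    (hend : ¬ PermClasses.EndsInOneOne s) :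
    (∃ C : Set PermClasses.Perm,
      PermClasses.IsPermClass C ∧ PermClasses.IsSumClosed C ∧ PermClasses.Realizes C s ∧
      (s 5 ≤ 4 → C ⊆ PermClasses.sumClosure (PermClasses.downClosure PermClasses.Uo))) ∧
    (∀ C : Set PermClasses.Perm,
      PermClasses.IsPermClass C → PermClasses.IsSumClosed C → PermClasses.Realizes C s →
      PermClasses.upperGrowthRate C < ENNReal.ofReal PermClasses.xi →
      ∃ D : Set PermClasses.Perm,
        PermClasses.IsPermClass D ∧ PermClasses.IsSumClosed D ∧ PermClasses.FinitelyBased D ∧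
        PermClasses.Realizes D s) := by
  obtain ⟨hreal, hsub⟩ := PermClasses.exists_realization hlegal hdom hend
  have hclass := PermClasses.isPermClass_sumClass (PermClasses.indecSet s)
  have hsum := PermClasses.isSumClosed_sumClass (PermClasses.indecSet s)
  refine ⟨⟨_, hclass, hsum, hreal, hsub⟩, fun C hC hC' hCs hgr => ?_⟩
  -- The given class only serves to force an entry of `s` below `fourSeq`; the finitely based class
  -- is the one already constructed.
  obtain ⟨M, c, hc, htail⟩ := hlegal.eventually_const hend (by
    by_contra hcon
    push Not at hcon
    exact absurd (PermClasses.xi_le_upperGrowthRate hC hC' fun n hn => by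
      rw [hCs n hn]; exact hcon n hn) (not_le.2 hgr))
  exact ⟨_, hclass, hsum, PermClasses.finitelyBased_sumClass hc htail, hreal⟩
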